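/- Let $n\ge 2$ be an integer and let $u,v,x$ be real numbers with $u<v$, $v\ne -u$ and $x\neq 0$. Regard $\mathrm{SL}(2n,\mathbb C)$ as a real Lie group and let $\mathrm{SB}(2n)<\mathrm{SL}(2n,\mathbb C)$ be the subgroup of upper triangular matrices with positive diagonal entries. Every $K\in \mathrm{SL}(2n,\mathbb C)$ can be written as $K=g_Lb_R^{-1}=b_Lg_R^{-1}$ with unique $g_L,g_R\in \mathrm{SU}(2n)$ and $b_L,b_R\in \mathrm{SB}(2n)$. Write $2n\times 2n$ matrices in $n\times n$ blocks, let $G_+=\mathrm S(\mathrm U(n)\times \mathrm U(n))$ be the block-diagonal subgroup of $\mathrm{SU}(2n)$, let $G_+^*$ be the block-diagonal subgroup of $\mathrm{SB}(2n)$, and let $\pi\colon \mathrm{SB}(2n)\to G_+^*$ be the map that replaces the upper right block by $0$. Define $$\Phi_+\colon \mathrm{SL}(2n,\mathbb C)\to G_+^*\times G_+^*,\qquad \Phi_+(K)=(\pi(b_L),\pi(b_R)).$$ Let $\mu=(\mu_L,\mu_R)$ with $$\mu_L=\begin{bmatrix}e^u\nu(x)&0\\0&e^{-u}\mathbf 1_n\end{bmatrix},\qquad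 \mu_R=\begin{bmatrix}e^v\mathbf 1_n&0\\0&e^{-v}\mathbf 1_n\end{bmatrix},$$ where $\nu(x)$ is the upper triangular $n\times n$ matrix with $\nu(x)_{jj}=1$ and $\nu(x)_{jk}=(1-e^{-x})e^{(k-j)x/2}$ for $j<k$. The group $G_+\times G_+$ acts on $\mathrm{SL}(2n,\mathbb C)$ by $(\eta_L,\eta_R)\cdot K=\eta_LK\eta_R^{-1}$. Let $$G_\mu=\{(\eta_L,\eta_R)\in G_+\times G_+\mid \eta_L\mu_L\mu_L^\dagger\eta_L^{-1}=\mu_L\mu_L^\dagger,\ \eta_R\mu_R\mu_R^\dagger\eta_R^{-1}=\mu_R\mu_R^\dagger\}$$ be the isotropy group of $\mu$ (the condition on $\eta_R$ holds automatically); it preserves $\Phi_+^{-1}(\mu)$. **Theorem 4.4.** The constraint surface $\Phi_+^{-1}(\mu)$ is an embedded submanifold of $\mathrm{SL}(2n,\mathbb C)$, and the reduced phase space $M=\Phi_+^{-1}(\mu)/G_\mu$, with the quotient topology, is a smooth manifold (Hausdorff and second countable) for which the natural projection $\pi_\mu\colon\Phi_+^{-1}(\mu)\to M$ is a smooth submersion.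 -/

import Mathlib

open Matrix Manifold
open scoped ContDiff

namespace HeisenbergReduction

/-- The `2n` indices, arranged as two consecutive blocks of length `n`. -/
abbrev Idx (n : ℕ) : Type := Fin n ⊕ Fin n
/-- The group `SL(2n, ℂ)`, with Mathlib's topology (that of a subspace of the matrices). -/
abbrev SL2n (n : ℕ) : Type := Matrix.SpecialLinearGroup (Idx n) ℂ

noncomputable section

/-! ### `SL(2n, ℂ)` as a real smooth manifold

Near the identity the cofactor of the `(1,1)` entry is nonzero, so the equation `det B = 1` can be
solved for that entry: all the other entries serve as coordinates, and the missing one is a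
rational function of them. These coordinates are moved to the other points by left translation. -/

/-- The first index. -/
def idx0 (n : ℕ) [NeZero n] : Idx n := Sum.inl 0

/-- The model space: all matrix entries but the `(1,1)` one. -/
abbrev SLModel (n : ℕ) [NeZero n] : Type :=
  {p : Idx n × Idx n // p ≠ (idx0 n, idx0 n)} → ℂ

/-- The matrix with `(1,1)` entry `t` and the remaining entries `Y`. -/
def fillEntry {n : ℕ} [NeZero n] (t : ℂ) (Y : SLModel n) : Matrix (Idx n) (Idx n) ℂ :=
  Matrix.of fun i j => if h : (i, j) = (idx0 n, idx0 n) then t else Y ⟨(i, j), h⟩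

theorem fillEntry_same {n : ℕ} [NeZero n] (t : ℂ) (Y : SLModel n) :
    fillEntry t Y (idx0 n) (idx0 n) = t := by simp [fillEntry]

theorem fillEntry_of_ne {n : ℕ} [NeZero n] (t : ℂ) (Y : SLModel n) {i j : Idx n}
    (h : (i, j) ≠ (idx0 n, idx0 n)) : fillEntry t Y i j = Y ⟨(i, j), h⟩ := dif_neg h

/-- Forget the `(1,1)` entry of a matrix. -/
def dropEntry {n : ℕ} [NeZero n] (B : Matrix (Idx n) (Idx n) ℂ) : SLModel n :=
  fun p => B p.1.1 p.1.2

/-- The `(1,1)` cofactor. -/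
def cofactor0 {n : ℕ} [NeZero n] (B : Matrix (Idx n) (Idx n) ℂ) : ℂ :=
  (B.updateRow (idx0 n) (Pi.single (idx0 n) 1)).det

/-- The value of the `(1,1)` entry which makes the determinant equal to one. -/
def solveEntry {n : ℕ} [NeZero n] (Y : SLModel n) : ℂ :=
  (1 - (fillEntry 0 Y).det) / cofactor0 (fillEntry 0 Y)

theorem fillEntry_dropEntry {n : ℕ} [NeZero n] (B : Matrix (Idx n) (Idx n) ℂ) :
    fillEntry (B (idx0 n) (idx0 n)) (dropEntry B) = B := by
  ext i j
  by_cases h : (i, j) = (idx0 n, idx0 n)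
  · obtain ⟨rfl, rfl⟩ := Prod.mk.inj h
    rw [fillEntry_same]
  · rw [fillEntry_of_ne _ _ h]
    rfl

theorem dropEntry_fillEntry {n : ℕ} [NeZero n] (t : ℂ) (Y : SLModel n) :
    dropEntry (fillEntry t Y) = Y := by
  funext p
  exact fillEntry_of_ne t Y p.2

theorem fillEntry_eq_updateRow {n : ℕ} [NeZero n] (t : ℂ) (Y : SLModel n) :
    fillEntry t Y = (fillEntry 0 Y).updateRow (idx0 n)
      (fillEntry 0 Y (idx0 n) + t • Pi.single (idx0 n) 1) := by
  ext i j
  by_cases hi : i = idx0 n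
  · subst hi
    by_cases hj : j = idx0 n
    · subst hj; simp [fillEntry]
    · simp [fillEntry, hj]
  · simp [fillEntry, hi]

theorem cofactor0_fillEntry {n : ℕ} [NeZero n] (t : ℂ) (Y : SLModel n) :
    cofactor0 (fillEntry t Y) = cofactor0 (fillEntry 0 Y) := by
  unfold cofactor0
  rw [fillEntry_eq_updateRow t Y, Matrix.updateRow_idem]

theorem det_fillEntry {n : ℕ} [NeZero n] (t : ℂ) (Y : SLModel n) :
    (fillEntry t Y).det = (fillEntry 0 Y).det + t * cofactor0 (fillEntry 0 Y) := by
  rw [fillEntry_eq_updateRow t Y, Matrix.det_updateRow_add, Matrix.det_updateRow_smul,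
    Matrix.updateRow_eq_self]
  rfl

theorem det_fillEntry_solveEntry {n : ℕ} [NeZero n] {Y : SLModel n}
    (hY : cofactor0 (fillEntry 0 Y) ≠ 0) : (fillEntry (solveEntry Y) Y).det = 1 := by
  rw [det_fillEntry, solveEntry, div_mul_cancel₀ _ hY]
  ring

theorem cofactor0_dropEntry {n : ℕ} [NeZero n] (B : Matrix (Idx n) (Idx n) ℂ) :
    cofactor0 (fillEntry 0 (dropEntry B)) = cofactor0 B := by
  rw [← cofactor0_fillEntry (B (idx0 n) (idx0 n)), fillEntry_dropEntry]

theorem solveEntry_dropEntry {n : ℕ} [NeZero n] {B : Matrix (Idx n) (Idx n) ℂ}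
    (hB : B.det = 1) (hc : cofactor0 B ≠ 0) :
    solveEntry (dropEntry B) = B (idx0 n) (idx0 n) := by
  have h := det_fillEntry (B (idx0 n) (idx0 n)) (dropEntry B)
  rw [fillEntry_dropEntry, hB, cofactor0_dropEntry] at h
  rw [solveEntry, cofactor0_dropEntry, div_eq_iff hc, h]
  ring

theorem contDiff_det {n : ℕ} {E : Type*} [NormedAddCommGroup E] [NormedSpace ℝ E]
    {f : E → Matrix (Idx n) (Idx n) ℂ} (hf : ∀ i j, ContDiff ℝ ∞ fun y => f y i j) :
    ContDiff ℝ ∞ fun y => (f y).det := by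
  simp only [Matrix.det_apply]
  exact ContDiff.sum fun σ _ => (contDiff_prod fun i _ => hf _ _).const_smul (σ.sign : ℤˣ)

theorem contDiff_fillEntry {n : ℕ} [NeZero n] (t : ℂ) (i j : Idx n) :
    ContDiff ℝ ∞ fun Y : SLModel n => fillEntry t Y i j := by
  by_cases h : (i, j) = (idx0 n, idx0 n)
  · obtain ⟨rfl, rfl⟩ := Prod.mk.inj h
    simp only [fillEntry_same]
    exact contDiff_const
  · simp only [fillEntry_of_ne _ _ h]
    exact contDiff_apply ℝ ℂ _

theorem contDiff_cofactor0 {n : ℕ} [NeZero n] :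
    ContDiff ℝ ∞ fun Y : SLModel n => cofactor0 (fillEntry 0 Y) := by
  refine contDiff_det fun i j => ?_
  by_cases hi : i = idx0 n
  · subst hi
    simpa using contDiff_const
  · simpa [hi] using contDiff_fillEntry 0 i j

theorem contDiffOn_fillEntry_solveEntry {n : ℕ} [NeZero n] (i j : Idx n) :
    ContDiffOn ℝ ∞ (fun Y : SLModel n => fillEntry (solveEntry Y) Y i j)
      {Y | cofactor0 (fillEntry 0 Y) ≠ 0} := by
  by_cases h : (i, j) = (idx0 n, idx0 n)
  · have : ContDiffOn ℝ ∞ (fun Y : SLModel n => solveEntry Y)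
        {Y | cofactor0 (fillEntry 0 Y) ≠ 0} := by
      have h1 : ContDiff ℝ ∞ fun Y : SLModel n => 1 - (fillEntry 0 Y).det :=
        contDiff_const.sub (contDiff_det fun i j => contDiff_fillEntry 0 i j)
      have h2 := (contDiff_cofactor0 (n := n)).contDiffOn
        (s := {Y : SLModel n | cofactor0 (fillEntry 0 Y) ≠ 0})
      simp only [solveEntry, div_eq_mul_inv]
      exact h1.contDiffOn.mul (h2.inv fun Y hY => hY)
    obtain ⟨rfl, rfl⟩ := Prod.mk.inj h
    simpa only [fillEntry_same] using this
  · simp only [fillEntry_of_ne _ _ h]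
    exact (contDiff_apply ℝ ℂ _).contDiffOn

/-- The inverse of the coordinate map at the identity. -/
def slInv {n : ℕ} [NeZero n] (Y : SLModel n) : SL2n n :=
  open Classical in
  if hY : cofactor0 (fillEntry 0 Y) ≠ 0 then
    ⟨fillEntry (solveEntry Y) Y, det_fillEntry_solveEntry hY⟩ else 1

theorem coe_slInv {n : ℕ} [NeZero n] {Y : SLModel n} (hY : cofactor0 (fillEntry 0 Y) ≠ 0) :
    (slInv Y : Matrix (Idx n) (Idx n) ℂ) = fillEntry (solveEntry Y) Y := by
  simp [slInv, hY]

/-- The chart at the identity: on the open set where the `(1,1)` cofactor does not vanish, the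
coordinates are all entries but the `(1,1)` one. -/
def slChartOne (n : ℕ) [NeZero n] : OpenPartialHomeomorph (SL2n n) (SLModel n) where
  toFun B := dropEntry (B : Matrix (Idx n) (Idx n) ℂ)
  invFun := slInv
  source := {B | cofactor0 (B : Matrix (Idx n) (Idx n) ℂ) ≠ 0}
  target := {Y | cofactor0 (fillEntry 0 Y) ≠ 0}
  map_source' B hB := by
    simpa only [Set.mem_ofPred_eq, cofactor0_dropEntry] using hB
  map_target' Y hY := by
    simpa only [Set.mem_ofPred_eq, coe_slInv hY, cofactor0_fillEntry] using hY
  left_inv' B hB := by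
    have hY : cofactor0 (fillEntry 0 (dropEntry (B : Matrix (Idx n) (Idx n) ℂ))) ≠ 0 := by
      simpa only [Set.mem_ofPred_eq, cofactor0_dropEntry] using hB
    apply Subtype.ext
    rw [coe_slInv hY, solveEntry_dropEntry B.2 hB, fillEntry_dropEntry]
  right_inv' Y hY := by
    rw [coe_slInv hY, dropEntry_fillEntry]
  open_source := by
    have h : Continuous fun B : SL2n n => cofactor0 (B : Matrix (Idx n) (Idx n) ℂ) :=
      (continuous_subtype_val.matrix_updateRow _ continuous_const).matrix_det
    exact isOpen_ne.preimage h
  open_target := isOpen_ne.preimage (contDiff_cofactor0 (n := n)).continuous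
  continuousOn_toFun := by
    refine Continuous.continuousOn (continuous_pi fun p => ?_)
    exact continuous_subtype_val.matrix_elem _ _
  continuousOn_invFun := by
    refine (Topology.IsInducing.continuousOn_iff (g := fun B : SL2n n => B.1) ⟨rfl⟩).2 ?_
    refine continuousOn_pi.2 fun i => continuousOn_pi.2 fun j => ?_
    refine (contDiffOn_fillEntry_solveEntry i j).continuousOn.congr fun Y hY => ?_
    exact congrFun (congrFun (coe_slInv hY) i) j

/-- The chart centred at `A`, obtained from the one at the identity by left translation. -/
def slChart {n : ℕ} [NeZero n] (A : SL2n n) : OpenPartialHomeomorph (SL2n n) (SLModel n) :=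
  (Homeomorph.mulLeft A⁻¹).transOpenPartialHomeomorph (slChartOne n)

instance slChartedSpace (n : ℕ) [NeZero n] : ChartedSpace (SLModel n) (SL2n n) where
  atlas := Set.range slChart
  chartAt := slChart
  mem_chart_source A := by
    change cofactor0 ((A⁻¹ * A : SL2n n) : Matrix (Idx n) (Idx n) ℂ) ≠ 0
    have h : (1 : Matrix (Idx n) (Idx n) ℂ).updateRow (idx0 n) (Pi.single (idx0 n) 1) = 1 := by
      ext i j
      by_cases hi : i = idx0 n
      · subst hi
        simp [Matrix.one_apply, Pi.single_apply, eq_comm]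
      · simp [hi]
    rw [inv_mul_cancel, Matrix.SpecialLinearGroup.coe_one, cofactor0, h, Matrix.det_one]
    exact one_ne_zero
  chart_mem_atlas A := ⟨A, rfl⟩

instance slIsManifold (n : ℕ) [NeZero n] : IsManifold 𝓘(ℝ, SLModel n) ∞ (SL2n n) := by
  apply isManifold_of_contDiffOn
  rintro _ _ ⟨A, rfl⟩ ⟨A', rfl⟩
  have key : ContDiffOn ℝ ∞ (fun Y : SLModel n =>
      dropEntry (((A'⁻¹ * A : SL2n n) : Matrix (Idx n) (Idx n) ℂ) * fillEntry (solveEntry Y) Y))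
      {Y | cofactor0 (fillEntry 0 Y) ≠ 0} := by
    refine contDiffOn_pi.2 fun p => ?_
    simp only [dropEntry, Matrix.mul_apply]
    exact ContDiffOn.sum fun k _ => contDiffOn_const.mul (contDiffOn_fillEntry_solveEntry _ _)
  simp only [modelWithCornersSelf_coe, modelWithCornersSelf_coe_symm, Set.range_id,
    Set.inter_univ, Set.preimage_id, Function.id_comp, Function.comp_id]
  have hsub : ((slChart A).symm ≫ₕ slChart A').source ⊆ {Y | cofactor0 (fillEntry 0 Y) ≠ 0} := by
    intro Y hY
    exact hY.1
  refine (key.mono hsub).congr fun Y hY => ?_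
  have hY' := hsub hY
  have : ((slChart A).symm ≫ₕ slChart A') Y
      = dropEntry ((A'⁻¹ * (A⁻¹⁻¹ * slInv Y) : SL2n n) : Matrix (Idx n) (Idx n) ℂ) := rfl
  rw [this, inv_inv, ← mul_assoc, Matrix.SpecialLinearGroup.coe_mul, coe_slInv hY']


/-! ### The groups `SU(2n)`, `SB(2n)`, `G₊`, `G₊*` -/

/-- `SU(2n)` as a subgroup of `SL(2n, ℂ)`. -/
def SU (n : ℕ) : Subgroup (SL2n n) where
  carrier := {g | (g : Matrix (Idx n) (Idx n) ℂ)ᴴ * (g : Matrix (Idx n) (Idx n) ℂ) = 1}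
  one_mem' := by simp
  mul_mem' {a b} ha hb := by
    simp only [Set.mem_ofPred_eq, Matrix.SpecialLinearGroup.coe_mul,
      Matrix.conjTranspose_mul] at *
    calc _ = (b.1ᴴ * (a.1ᴴ * a.1)) * b.1 := by simp only [Matrix.mul_assoc]
      _ = 1 := by rw [ha, Matrix.mul_one, hb]
  inv_mem' {a} ha := by
    simp only [Set.mem_ofPred_eq] at *
    have h1 : (a.1) * (a⁻¹).1 = 1 := by
      rw [← Matrix.SpecialLinearGroup.coe_mul, mul_inv_cancel, Matrix.SpecialLinearGroup.coe_one]
    have h2 : (a⁻¹).1 = a.1ᴴ := by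
      calc (a⁻¹).1 = (a.1ᴴ * a.1) * (a⁻¹).1 := by rw [ha, Matrix.one_mul]
        _ = a.1ᴴ := by rw [Matrix.mul_assoc, h1, Matrix.mul_one]
    rw [h2, Matrix.conjTranspose_conjTranspose, ← h2]
    exact h1

/-- Upper triangular with respect to the order `1 < ⋯ < 2n` of the indices
(all of the first block precedes the second one). -/
def UpperTri {n : ℕ} (b : Matrix (Idx n) (Idx n) ℂ) : Prop :=
  b.BlockTriangular (toLex : Idx n → Fin n ⊕ₗ Fin n)

theorem UpperTri.diag_mul {n : ℕ} {a b : Matrix (Idx n) (Idx n) ℂ} (ha : UpperTri a)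
    (hb : UpperTri b) (i : Idx n) : (a * b) i i = a i i * b i i := by
  rw [Matrix.mul_apply]
  refine Finset.sum_eq_single i (fun k _ hk => ?_) (fun h => absurd (Finset.mem_univ _) h)
  rcases lt_trichotomy (toLex k) (toLex i) with h | h | h
  · rw [ha h, zero_mul]
  · exact absurd (toLex.injective h) hk
  · rw [hb h, mul_zero]

theorem UpperTri.inv {n : ℕ} {a : SL2n n} (ha : UpperTri a.1) : UpperTri (a⁻¹).1 := by
  have h : (a⁻¹).1 = (a.1)⁻¹ := by
    refine (Matrix.inv_eq_right_inv ?_).symm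
    rw [← Matrix.SpecialLinearGroup.coe_mul, mul_inv_cancel, Matrix.SpecialLinearGroup.coe_one]
  have : Invertible a.1 := Matrix.invertibleOfIsUnitDet _ (by rw [a.2]; exact isUnit_one)
  rw [h]
  exact Matrix.blockTriangular_inv_of_blockTriangular ha

theorem UpperTri.diag_inv {n : ℕ} {a : SL2n n} (ha : UpperTri a.1) (i : Idx n) :
    (a⁻¹).1 i i = (a.1 i i)⁻¹ := by
  have h := ha.diag_mul ha.inv i
  rw [← Matrix.SpecialLinearGroup.coe_mul, mul_inv_cancel, Matrix.SpecialLinearGroup.coe_one,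
    Matrix.one_apply_eq] at h
  exact (inv_eq_of_mul_eq_one_right h.symm).symm

/-- `SB(2n)`: upper triangular matrices of determinant one with positive diagonal entries. -/
def SB (n : ℕ) : Subgroup (SL2n n) where
  carrier := {b | UpperTri (b : Matrix (Idx n) (Idx n) ℂ) ∧ ∀ i, ∃ r : ℝ, 0 < r ∧ b i i = r}
  one_mem' := by
    refine ⟨Matrix.blockTriangular_one, fun i => ⟨1, one_pos, ?_⟩⟩
    simp
  mul_mem' {a b} ha hb := by
    refine ⟨ha.1.mul hb.1, fun i => ?_⟩
    obtain ⟨r, hr, har⟩ := ha.2 i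
    obtain ⟨s, hs, hbs⟩ := hb.2 i
    refine ⟨r * s, mul_pos hr hs, ?_⟩
    have := ha.1.diag_mul hb.1 i
    rw [Complex.ofReal_mul, ← har, ← hbs]
    exact this
  inv_mem' {a} ha := by
    refine ⟨ha.1.inv, fun i => ?_⟩
    obtain ⟨r, hr, har⟩ := ha.2 i
    exact ⟨r⁻¹, inv_pos.2 hr, by rw [Complex.ofReal_inv, ← har]; exact ha.1.diag_inv i⟩

/-- `G₊ = S(U(n) × U(n))`, the block diagonal subgroup of `SU(2n)`. -/
def Gplus (n : ℕ) : Subgroup (SL2n n) where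
  carrier := {g | g ∈ SU n ∧ g.1.toBlocks₁₂ = 0 ∧ g.1.toBlocks₂₁ = 0}
  one_mem' := by
    refine ⟨one_mem _, ?_, ?_⟩ <;> ext i j <;> simp [Matrix.toBlocks₁₂, Matrix.toBlocks₂₁]
  mul_mem' {a b} ha hb := by
    refine ⟨mul_mem ha.1 hb.1, ?_, ?_⟩
    · rw [Matrix.SpecialLinearGroup.coe_mul, ← Matrix.fromBlocks_toBlocks a.1,
        ← Matrix.fromBlocks_toBlocks b.1, Matrix.fromBlocks_multiply, Matrix.toBlocks_fromBlocks₁₂,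
        ha.2.1, hb.2.1]
      simp
    · rw [Matrix.SpecialLinearGroup.coe_mul, ← Matrix.fromBlocks_toBlocks a.1,
        ← Matrix.fromBlocks_toBlocks b.1, Matrix.fromBlocks_multiply, Matrix.toBlocks_fromBlocks₂₁,
        ha.2.2, hb.2.2]
      simp
  inv_mem' {a} ha := by
    have h1 : (a.1) * (a⁻¹).1 = 1 := by
      rw [← Matrix.SpecialLinearGroup.coe_mul, mul_inv_cancel, Matrix.SpecialLinearGroup.coe_one]
    have h2 : (a⁻¹).1 = a.1ᴴ := by
      calc (a⁻¹).1 = (a.1ᴴ * a.1) * (a⁻¹).1 := by rw [show a.1ᴴ * a.1 = 1 from ha.1, Matrix.one_mul]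
        _ = a.1ᴴ := by rw [Matrix.mul_assoc, h1, Matrix.mul_one]
    refine ⟨inv_mem ha.1, ?_, ?_⟩
    · rw [h2]
      have := congrArg Matrix.conjTranspose ha.2.2
      rwa [Matrix.conjTranspose_zero] at this
    · rw [h2]
      have := congrArg Matrix.conjTranspose ha.2.1
      rwa [Matrix.conjTranspose_zero] at this

theorem UpperTri.toBlocks₂₁ {n : ℕ} {b : Matrix (Idx n) (Idx n) ℂ} (hb : UpperTri b) :
    b.toBlocks₂₁ = 0 := by
  ext i j
  exact hb (Sum.Lex.inl_lt_inr j i)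

/-- Products of block upper triangular matrices. -/
theorem toBlocks_mul_of_upper {n : ℕ} {a b : Matrix (Idx n) (Idx n) ℂ}
    (ha : a.toBlocks₂₁ = 0) (hb : b.toBlocks₂₁ = 0) :
    (a * b).toBlocks₁₁ = a.toBlocks₁₁ * b.toBlocks₁₁ ∧
    (a * b).toBlocks₁₂ = a.toBlocks₁₁ * b.toBlocks₁₂ + a.toBlocks₁₂ * b.toBlocks₂₂ ∧
    (a * b).toBlocks₂₁ = 0 ∧
    (a * b).toBlocks₂₂ = a.toBlocks₂₂ * b.toBlocks₂₂ := by
  rw [← Matrix.fromBlocks_toBlocks a, ← Matrix.fromBlocks_toBlocks b, Matrix.fromBlocks_multiply,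
    ha, hb]
  simp

/-- `G₊*`: the subgroup of block diagonal elements of `SB(2n)`. -/
def GplusStar (n : ℕ) : Subgroup (SL2n n) where
  carrier := {b | b ∈ SB n ∧ b.1.toBlocks₁₂ = 0}
  one_mem' := by
    refine ⟨one_mem _, ?_⟩; ext i j; simp [Matrix.toBlocks₁₂]
  mul_mem' {a b} ha hb := by
    refine ⟨mul_mem ha.1 hb.1, ?_⟩
    rw [Matrix.SpecialLinearGroup.coe_mul,
      (toBlocks_mul_of_upper ha.1.1.toBlocks₂₁ hb.1.1.toBlocks₂₁).2.1, ha.2, hb.2]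
    simp
  inv_mem' {a} ha := by
    have hi : a⁻¹ ∈ SB n := inv_mem ha.1
    refine ⟨hi, ?_⟩
    have h1 : (a⁻¹).1 * a.1 = 1 := by
      rw [← Matrix.SpecialLinearGroup.coe_mul, inv_mul_cancel, Matrix.SpecialLinearGroup.coe_one]
    have h2 : (a.1) * (a⁻¹).1 = 1 := by
      rw [← Matrix.SpecialLinearGroup.coe_mul, mul_inv_cancel, Matrix.SpecialLinearGroup.coe_one]
    have e1 := (toBlocks_mul_of_upper hi.1.toBlocks₂₁ ha.1.1.toBlocks₂₁).1
    have e2 := (toBlocks_mul_of_upper ha.1.1.toBlocks₂₁ hi.1.toBlocks₂₁).2.1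
    rw [h1, ← Matrix.fromBlocks_one, Matrix.toBlocks_fromBlocks₁₁] at e1
    rw [h2, ← Matrix.fromBlocks_one, Matrix.toBlocks_fromBlocks₁₂, ha.2, Matrix.zero_mul,
      add_zero] at e2
    calc (a⁻¹).1.toBlocks₁₂ = ((a⁻¹).1.toBlocks₁₁ * a.1.toBlocks₁₁) * (a⁻¹).1.toBlocks₁₂ := by
          rw [← e1, Matrix.one_mul]
      _ = 0 := by rw [Matrix.mul_assoc, ← e2, Matrix.mul_zero]

theorem blockDiag_mem_SB {n : ℕ} {b : SL2n n} (hb : b ∈ SB n) :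
    ∃ c : SL2n n, c ∈ GplusStar n ∧
      c.1 = Matrix.fromBlocks b.1.toBlocks₁₁ 0 0 b.1.toBlocks₂₂ := by
  have hdet : (Matrix.fromBlocks b.1.toBlocks₁₁ 0 0 b.1.toBlocks₂₂).det = 1 := by
    have h := b.2
    rw [← Matrix.fromBlocks_toBlocks b.1, hb.1.toBlocks₂₁, Matrix.det_fromBlocks_zero₂₁] at h
    rw [Matrix.det_fromBlocks_zero₂₁, h]
  refine ⟨⟨_, hdet⟩, ⟨⟨?_, ?_⟩, Matrix.toBlocks_fromBlocks₁₂ _ _ _ _⟩, rfl⟩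
  · rintro (i | i) (j | j) hij
    · exact hb.1 hij
    · rfl
    · rfl
    · exact hb.1 hij
  · rintro (i | i)
    · exact hb.2 (Sum.inl i)
    · exact hb.2 (Sum.inr i)

/-- The projection `π : SB(2n) → G₊*` which removes the upper right block. -/
def diagProj {n : ℕ} (b : SB n) : GplusStar n :=
  ⟨⟨Matrix.fromBlocks b.1.1.toBlocks₁₁ 0 0 b.1.1.toBlocks₂₂, by
    obtain ⟨c, -, hc⟩ := blockDiag_mem_SB b.2
    rw [← hc]
    exact c.2⟩, by
    obtain ⟨c, hc, hcb⟩ := blockDiag_mem_SB b.2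
    exact (Subtype.ext hcb : c = ⟨_, _⟩) ▸ hc⟩

/-! ### Iwasawa decomposition -/

open scoped ComplexOrder in
/-- Gram-Schmidt orthogonalization: for positive definite `S` there is an upper triangular `b` with
positive diagonal and `b† S b = 1`. -/
theorem exists_triangular_of_posDef {ι : Type*} [Fintype ι] (o : LinearOrder ι)
    (S : Matrix ι ι ℂ) (hS : S.PosDef) :
    ∃ b : Matrix ι ι ℂ, (∀ i j, i < j → b j i = 0) ∧ (∀ i, ∃ r : ℝ, 0 < r ∧ b i i = r) ∧
      (∃ r : ℝ, 0 < r ∧ b.det = r) ∧ bᴴ * S * b = 1 := by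
  have : LocallyFiniteOrderBot ι :=
    LocallyFiniteOrderBot.ofIic ι (fun a => Finset.univ.filter (· ≤ a)) (by simp)
  set P := LDL.lowerInv hS with hP
  have htri : ∀ i j, i < j → P i j = 0 := fun i j h => LDL.lowerInv_triangular hS h
  have hdet : P.det ≠ 0 := by
    have := LDL.invertibleLowerInv hS
    exact (Matrix.isUnit_det_of_invertible P).ne_zero
  have hPd : ∀ i, P i i ≠ 0 := by
    have h := hdet
    rw [Matrix.det_of_isLowerTriangular P (fun i j h => htri i j h), Finset.prod_ne_zero_iff] at h
    exact fun i => h i (Finset.mem_univ i)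
  have hD : (P * S * Pᴴ).PosDef := by
    have hu : IsUnit P := (Matrix.isUnit_iff_isUnit_det P).2 (isUnit_iff_ne_zero.2 hdet)
    have := (Matrix.IsUnit.posDef_star_right_conjugate_iff hu (x := S)).2 hS
    exact this
  have hDd : P * S * Pᴴ = Matrix.diagonal (LDL.diagEntries hS) :=
    (LDL.diag_eq_lowerInv_conj hS).symm
  set d := LDL.diagEntries hS
  have hd : ∀ i, 0 < d i := by
    intro i
    have := hD.diag_pos (i := i)
    rwa [hDd, Matrix.diagonal_apply_eq] at this
  have hdr : ∀ i, 0 < (d i).re ∧ d i = ((d i).re : ℂ) := by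
    intro i
    obtain ⟨h1, h2⟩ := Complex.lt_def.1 (hd i)
    exact ⟨by simpa using h1, Complex.ext (by simp) (by simpa using h2.symm)⟩
  set w : ι → ℂ := fun i => P i i / ((‖P i i‖ * Real.sqrt (d i).re : ℝ) : ℂ) with hw
  have hsq : ∀ i, star (P i i) * P i i = ((‖P i i‖ ^ 2 : ℝ) : ℂ) := by
    intro i
    rw [← Complex.normSq_eq_norm_sq, Complex.star_def, mul_comm, Complex.mul_conj]
  have hpos : ∀ i, 0 < ‖P i i‖ := fun i => norm_pos_iff.2 (hPd i)
  have hdiag : ∀ i, star (P i i) * w i = ((‖P i i‖ / Real.sqrt (d i).re : ℝ) : ℂ) := by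
    intro i
    have h1 := (hpos i).ne'
    have h2 := (Real.sqrt_pos.2 (hdr i).1).ne'
    rw [hw]
    simp only
    rw [← mul_div_assoc, hsq, ← Complex.ofReal_div]
    congr 1
    field_simp
  have hone : ∀ i, star (w i) * d i * w i = 1 := by
    intro i
    have h1 := (hpos i).ne'
    have h2 := (Real.sqrt_pos.2 (hdr i).1).ne'
    have h3 : star (w i) * w i = (((d i).re⁻¹ : ℝ) : ℂ) := by
      rw [hw]
      simp only [star_div₀, Complex.star_def, Complex.conj_ofReal]
      rw [div_mul_div_comm, ← Complex.star_def, hsq, ← Complex.ofReal_mul, ← Complex.ofReal_div]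
      congr 1
      have := Real.mul_self_sqrt (hdr i).1.le
      rw [mul_mul_mul_comm, this]
      have := (hdr i).1.ne'
      field_simp
    rw [mul_right_comm, h3]
    nth_rewrite 2 [(hdr i).2]
    rw [← Complex.ofReal_mul, inv_mul_cancel₀ (hdr i).1.ne', Complex.ofReal_one]
  have hbt : ∀ i j, i < j → (Pᴴ * Matrix.diagonal w) j i = 0 := by
    intro i j h
    rw [Matrix.mul_diagonal, Matrix.conjTranspose_apply, htri i j h, star_zero, zero_mul]
  have hbd : ∀ i, ∃ r : ℝ, 0 < r ∧ (Pᴴ * Matrix.diagonal w) i i = r := by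
    intro i
    refine ⟨_, div_pos (hpos i) (Real.sqrt_pos.2 (hdr i).1), ?_⟩
    rw [Matrix.mul_diagonal, Matrix.conjTranspose_apply]
    exact hdiag i
  refine ⟨Pᴴ * Matrix.diagonal w, hbt, hbd, ?_, ?_⟩
  · choose r hr hrb using hbd
    refine ⟨∏ i, r i, Finset.prod_pos fun i _ => hr i, ?_⟩
    rw [Matrix.det_of_isUpperTriangular (fun i j h => hbt j i h), Complex.ofReal_prod]
    exact Finset.prod_congr rfl fun i _ => hrb i
  · rw [Matrix.conjTranspose_mul, Matrix.conjTranspose_conjTranspose,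
      Matrix.diagonal_conjTranspose]
    calc _ = Matrix.diagonal (star w) * (P * S * Pᴴ) * Matrix.diagonal w := by
          simp only [Matrix.mul_assoc]
      _ = 1 := by
        rw [hDd, Matrix.diagonal_mul_diagonal, Matrix.diagonal_mul_diagonal, ← Matrix.diagonal_one]
        exact congrArg _ (funext hone)

theorem coe_inv_of_mem_SU {n : ℕ} {g : SL2n n} (hg : g ∈ SU n) : (g⁻¹).1 = g.1ᴴ := by
  have h1 : (g.1) * (g⁻¹).1 = 1 := by
    rw [← Matrix.SpecialLinearGroup.coe_mul, mul_inv_cancel, Matrix.SpecialLinearGroup.coe_one]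
  calc (g⁻¹).1 = (g.1ᴴ * g.1) * (g⁻¹).1 := by rw [show g.1ᴴ * g.1 = 1 from hg, Matrix.one_mul]
    _ = g.1ᴴ := by rw [Matrix.mul_assoc, h1, Matrix.mul_one]

theorem eq_one_of_mem_SU_of_mem_SB {n : ℕ} {c : SL2n n} (h1 : c ∈ SU n) (h2 : c ∈ SB n) :
    c = 1 := by
  have hinv := coe_inv_of_mem_SU h1
  apply Subtype.ext
  ext i j
  rw [Matrix.SpecialLinearGroup.coe_one]
  rcases lt_trichotomy (toLex i) (toLex j) with h | h | h
  · have := h2.1.inv h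
    rw [hinv, Matrix.conjTranspose_apply, star_eq_zero] at this
    rw [this, Matrix.one_apply_ne (fun h' => h.ne (congrArg _ h'))]
  · obtain rfl := toLex.injective h
    obtain ⟨r, hr, hcr⟩ := h2.2 i
    have h3 := h2.1.diag_inv i
    have hcr' : c.1 i i = r := hcr
    rw [hinv, Matrix.conjTranspose_apply, hcr', Complex.star_def, Complex.conj_ofReal,
      ← Complex.ofReal_inv] at h3
    have h4 : r * r = 1 := by
      have := Complex.ofReal_injective h3
      nth_rewrite 1 [this]
      exact inv_mul_cancel₀ hr.ne'
    have h5 : r = 1 := by nlinarith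
    rw [hcr', h5, Matrix.one_apply_eq, Complex.ofReal_one]
  · have := h2.1 h
    rw [this, Matrix.one_apply_ne (fun h' => h.ne' (congrArg _ h'))]

open scoped ComplexOrder in
/-- Iwasawa decomposition `K = g_L b_R⁻¹`, existence and uniqueness. -/
theorem iwasawa_right {n : ℕ} (K : SL2n n) :
    ∃! p : SU n × SB n, K = (p.1 : SL2n n) * (p.2 : SL2n n)⁻¹ := by
  have hu : IsUnit K.1 := (Matrix.isUnit_iff_isUnit_det _).2 (by rw [K.2]; exact isUnit_one)
  obtain ⟨b, hbt, hbd, ⟨r, hr, hbr⟩, hb1⟩ := exists_triangular_of_posDef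
    (LinearOrder.lift' (toLex : Idx n → Fin n ⊕ₗ Fin n) toLex.injective) (K.1ᴴ * K.1)
    (Matrix.PosDef.conjTranspose_mul_self _ (Matrix.mulVec_injective_of_isUnit hu))
  replace hbr : b.det = r := by convert hbr
  replace hb1 : bᴴ * (K.1ᴴ * K.1) * b = 1 := by convert hb1
  have hdet : b.det = 1 := by
    have h := congrArg Matrix.det hb1
    rw [Matrix.det_mul, Matrix.det_mul, Matrix.det_mul, Matrix.det_conjTranspose,
      Matrix.det_conjTranspose, K.2, hbr, Matrix.det_one, star_one, Complex.star_def,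
      Complex.conj_ofReal, one_mul, mul_one, ← Complex.ofReal_mul] at h
    have h4 : r * r = 1 := by exact_mod_cast h
    have h5 : r = 1 := by nlinarith
    rw [hbr, h5, Complex.ofReal_one]
  obtain ⟨B, rfl⟩ : ∃ B : SL2n n, B.1 = b := ⟨⟨b, hdet⟩, rfl⟩
  have hbSB : B ∈ SB n := ⟨fun i j h => hbt j i h, hbd⟩
  have hg : K * B ∈ SU n := by
    change (K.1 * B.1)ᴴ * (K.1 * B.1) = 1
    rw [Matrix.conjTranspose_mul, ← hb1]
    simp only [Matrix.mul_assoc]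
  refine ⟨(⟨_, hg⟩, ⟨_, hbSB⟩), by simp, ?_⟩
  rintro ⟨⟨g, hg'⟩, ⟨c, hc⟩⟩ h
  simp only at h
  have h1 : c⁻¹ * B = g⁻¹ * (K * B) := by
    rw [h]; group
  have h2 := eq_one_of_mem_SU_of_mem_SB
    (h1 ▸ mul_mem (inv_mem hg') hg) (mul_mem (inv_mem hc) hbSB)
  have h3 : c = B := by rwa [inv_mul_eq_one] at h2
  have h4 : g = K * B := by rw [h, h3]; group
  exact Prod.ext (Subtype.ext h4) (Subtype.ext h3)

/-- Iwasawa decomposition `K = b_L g_R⁻¹`, existence and uniqueness. -/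
theorem iwasawa_left {n : ℕ} (K : SL2n n) :
    ∃! p : SB n × SU n, K = (p.1 : SL2n n) * (p.2 : SL2n n)⁻¹ := by
  obtain ⟨⟨g, b⟩, h, huniq⟩ := iwasawa_right K⁻¹
  refine ⟨(b, g), ?_, ?_⟩
  · simp only at h ⊢
    rw [← inv_inv K, h]; group
  · rintro ⟨c, k⟩ h'
    simp only at h'
    have := huniq (k, c) (by simp only; rw [h']; group)
    rw [Prod.ext_iff] at this
    exact Prod.ext this.2 this.1

/-! ### The momentum maps -/

/-- The factor `b_L` of `K = b_L g_R⁻¹`. -/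
def bL {n : ℕ} (K : SL2n n) : SB n := (iwasawa_left K).choose.1

/-- The factor `b_R` of `K = g_L b_R⁻¹`. -/
def bR {n : ℕ} (K : SL2n n) : SB n := (iwasawa_right K).choose.2

theorem exists_eq_bL_mul {n : ℕ} (K : SL2n n) :
    ∃ g ∈ SU n, K = (bL K : SL2n n) * g⁻¹ :=
  ⟨_, (iwasawa_left K).choose.2.2, (iwasawa_left K).choose_spec.1⟩

theorem bR_eq_bL_inv {n : ℕ} (K : SL2n n) : bR K = bL K⁻¹ := by
  obtain ⟨g, hg, h⟩ := exists_eq_bL_mul K⁻¹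
  have := (iwasawa_right K).choose_spec.2 (⟨g, hg⟩, bL K⁻¹) (by
    calc K = (K⁻¹)⁻¹ := (inv_inv K).symm
      _ = ((bL K⁻¹ : SL2n n) * g⁻¹)⁻¹ := congrArg _ h
      _ = _ := by group)
  exact (congrArg Prod.snd this).symm

/-- The momentum map `Φ(K) = (b_L, b_R)` of the action of `SU(2n) × SU(2n)`. -/
def momentumMap {n : ℕ} (K : SL2n n) : SB n × SB n := (bL K, bR K)

/-- The momentum map `Φ₊(K) = (π(b_L), π(b_R))` of the action of `G₊ × G₊`. -/
def momentumMapPlus {n : ℕ} (K : SL2n n) : GplusStar n × GplusStar n :=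
  (diagProj (momentumMap K).1, diagProj (momentumMap K).2)

theorem toBlocks_mul_blockDiag {n : ℕ} (a b : Matrix (Idx n) (Idx n) ℂ)
    (h : a.toBlocks₂₁ = 0) (h' : b.toBlocks₂₁ = 0) :
    Matrix.fromBlocks (a * b).toBlocks₁₁ 0 0 (a * b).toBlocks₂₂ =
      Matrix.fromBlocks a.toBlocks₁₁ 0 0 a.toBlocks₂₂ *
      Matrix.fromBlocks b.toBlocks₁₁ 0 0 b.toBlocks₂₂ := by
  rw [(toBlocks_mul_of_upper h h').1, (toBlocks_mul_of_upper h h').2.2.2,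
    Matrix.fromBlocks_multiply]
  simp

theorem Gplus_eq_fromBlocks {n : ℕ} {g : SL2n n} (hg : g ∈ Gplus n) :
    Matrix.fromBlocks g.1.toBlocks₁₁ 0 0 g.1.toBlocks₂₂ = g.1 := by
  conv_rhs => rw [← Matrix.fromBlocks_toBlocks g.1, hg.2.1, hg.2.2]

/-- Equivariance: `π(b_L)` is changed to `η_L π(b_L) h` with some `h ∈ G₊`, so that
`π(b_L) π(b_L)†` is conjugated by `η_L`. -/
theorem diagProj_bL_equivariant {n : ℕ} (K : SL2n n) {ηL ηR : SL2n n}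
    (hL : ηL ∈ Gplus n) (hR : ηR ∈ Gplus n) :
    ∃ h ∈ Gplus n, (diagProj (bL (ηL * K * ηR⁻¹)) : SL2n n) = ηL * diagProj (bL K) * h := by
  obtain ⟨g, hg, hK⟩ := exists_eq_bL_mul K
  obtain ⟨g', hg', hK'⟩ := exists_eq_bL_mul (ηL * K * ηR⁻¹)
  set b := bL K
  set b' := bL (ηL * K * ηR⁻¹)
  have hb' : (b' : SL2n n) = ηL * b * (g⁻¹ * ηR⁻¹ * g') := by
    calc (b' : SL2n n) = (b' * g'⁻¹) * g' := by group
      _ = _ := by rw [← hK']; nth_rewrite 1 [hK]; group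
  set h := g⁻¹ * ηR⁻¹ * g' with hh
  have hSU : h ∈ SU n := mul_mem (mul_mem (inv_mem hg) (inv_mem hR.1)) hg'
  have e1 : h = (b : SL2n n)⁻¹ * ηL⁻¹ * b' := by rw [hb']; group
  have e2 : h⁻¹ = (b' : SL2n n)⁻¹ * ηL * b := by rw [e1]; group
  have hu1 : h.1.toBlocks₂₁ = 0 := by
    rw [e1, Matrix.SpecialLinearGroup.coe_mul, Matrix.SpecialLinearGroup.coe_mul]
    exact (toBlocks_mul_of_upper (toBlocks_mul_of_upper (inv_mem b.2 : _ ∈ SB n).1.toBlocks₂₁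
      (inv_mem hL : _ ∈ Gplus n).2.2).2.2.1 b'.2.1.toBlocks₂₁).2.2.1
  have hu2 : (h⁻¹).1.toBlocks₂₁ = 0 := by
    rw [e2, Matrix.SpecialLinearGroup.coe_mul, Matrix.SpecialLinearGroup.coe_mul]
    exact (toBlocks_mul_of_upper (toBlocks_mul_of_upper (inv_mem b'.2 : _ ∈ SB n).1.toBlocks₂₁
      hL.2.2).2.2.1 b.2.1.toBlocks₂₁).2.2.1
  have hG : h ∈ Gplus n := by
    refine ⟨hSU, ?_, hu1⟩
    rw [coe_inv_of_mem_SU hSU] at hu2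
    ext i j
    have := congrFun (congrFun hu2 j) i
    simpa [Matrix.toBlocks₂₁, Matrix.toBlocks₁₂] using this
  refine ⟨h, hG, Subtype.ext ?_⟩
  have hbm : b'.1.1 = ηL.1 * b.1.1 * h.1 := by
    rw [hb', Matrix.SpecialLinearGroup.coe_mul, Matrix.SpecialLinearGroup.coe_mul]
  have hlhs : (diagProj b' : SL2n n).1 =
      Matrix.fromBlocks b'.1.1.toBlocks₁₁ 0 0 b'.1.1.toBlocks₂₂ := rfl
  rw [hlhs, hbm, toBlocks_mul_blockDiag _ _
      (toBlocks_mul_of_upper hL.2.2 b.2.1.toBlocks₂₁).2.2.1 hu1,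
    toBlocks_mul_blockDiag _ _ hL.2.2 b.2.1.toBlocks₂₁, Gplus_eq_fromBlocks hL,
    Gplus_eq_fromBlocks hG, Matrix.SpecialLinearGroup.coe_mul, Matrix.SpecialLinearGroup.coe_mul]
  rfl

/-! ### Gauge group and reduced space -/

/-- The isotropy group in `G₊` of `c ∈ G₊*` under the dressing action, which in terms of `c c†` is
conjugation: `η` with `η (c c†) η⁻¹ = c c†`. -/
def dressingIsotropy {n : ℕ} (c : GplusStar n) : Subgroup (Gplus n) where
  carrier := {η | η.1.1 * (c.1.1 * c.1.1ᴴ) * (η⁻¹).1.1 = c.1.1 * c.1.1ᴴ}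
  one_mem' := by simp
  mul_mem' {a b} ha hb := by
    simp only [Set.mem_ofPred_eq] at *
    calc (a * b).1.1 * (c.1.1 * c.1.1ᴴ) * ((a * b)⁻¹).1.1
        = a.1.1 * (b.1.1 * (c.1.1 * c.1.1ᴴ) * (b⁻¹).1.1) * (a⁻¹).1.1 := by
          rw [_root_.mul_inv_rev]
          simp only [Subgroup.coe_mul, Matrix.SpecialLinearGroup.coe_mul, Matrix.mul_assoc]
      _ = _ := by rw [hb, ha]
  inv_mem' {a} ha := by
    simp only [Set.mem_ofPred_eq, inv_inv] at *
    have h1 : (a⁻¹).1.1 * a.1.1 = 1 := by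
      rw [← Matrix.SpecialLinearGroup.coe_mul, ← Subgroup.coe_mul, inv_mul_cancel]
      rfl
    calc (a⁻¹).1.1 * (c.1.1 * c.1.1ᴴ) * a.1.1
        = (a⁻¹).1.1 * (a.1.1 * (c.1.1 * c.1.1ᴴ) * (a⁻¹).1.1) * a.1.1 := by rw [ha]
      _ = ((a⁻¹).1.1 * a.1.1) * (c.1.1 * c.1.1ᴴ) * ((a⁻¹).1.1 * a.1.1) := by
          simp only [Matrix.mul_assoc]
      _ = _ := by rw [h1, Matrix.one_mul, Matrix.mul_one]

theorem diagProj_bL_of_mem {n : ℕ} (K : SL2n n) {ηL ηR : Gplus n}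
    (hL : ηL ∈ dressingIsotropy (diagProj (bL K))) :
    diagProj (bL (ηL.1 * K * ηR.1⁻¹)) = diagProj (bL K) := by
  obtain ⟨h, hh, e⟩ := diagProj_bL_equivariant K ηL.2 ηR.2
  set c := diagProj (bL K)
  set c' := diagProj (bL (ηL.1 * K * ηR.1⁻¹))
  have hη : (ηL.1⁻¹).1 = ηL.1.1ᴴ := coe_inv_of_mem_SU ηL.2.1
  have hhh : h.1 * h.1ᴴ = 1 := by
    rw [← coe_inv_of_mem_SU hh.1, ← Matrix.SpecialLinearGroup.coe_mul, mul_inv_cancel,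
      Matrix.SpecialLinearGroup.coe_one]
  have hcc : c'.1.1 * c'.1.1ᴴ = c.1.1 * c.1.1ᴴ := by
    have hm : c'.1.1 = ηL.1.1 * c.1.1 * h.1 := by
      rw [e, Matrix.SpecialLinearGroup.coe_mul, Matrix.SpecialLinearGroup.coe_mul]
    calc c'.1.1 * c'.1.1ᴴ = ηL.1.1 * c.1.1 * (h.1 * h.1ᴴ) * c.1.1ᴴ * ηL.1.1ᴴ := by
          rw [hm]; simp only [Matrix.conjTranspose_mul, Matrix.mul_assoc]
      _ = ηL.1.1 * (c.1.1 * c.1.1ᴴ) * (ηL.1⁻¹).1 := by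
          rw [hhh, Matrix.mul_one, hη]; simp only [Matrix.mul_assoc]
      _ = _ := hL
  have hSU : (c.1⁻¹ * c'.1)⁻¹ ∈ SU n := by
    refine inv_mem ?_
    have h1 : (c.1⁻¹).1 * c.1.1 = 1 := by
      rw [← Matrix.SpecialLinearGroup.coe_mul, inv_mul_cancel, Matrix.SpecialLinearGroup.coe_one]
    have h2 : (c.1⁻¹ * c'.1).1 * (c.1⁻¹ * c'.1).1ᴴ = 1 := by
      rw [Matrix.SpecialLinearGroup.coe_mul, Matrix.conjTranspose_mul]
      calc (c.1⁻¹).1 * c'.1.1 * (c'.1.1ᴴ * (c.1⁻¹).1ᴴ)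
          = (c.1⁻¹).1 * (c'.1.1 * c'.1.1ᴴ) * (c.1⁻¹).1ᴴ := by simp only [Matrix.mul_assoc]
        _ = ((c.1⁻¹).1 * c.1.1) * ((c.1⁻¹).1 * c.1.1)ᴴ := by
            rw [hcc, Matrix.conjTranspose_mul]; simp only [Matrix.mul_assoc]
        _ = 1 := by rw [h1, Matrix.conjTranspose_one, Matrix.mul_one]
    exact mul_eq_one_comm.1 h2
  have hSB : (c.1⁻¹ * c'.1)⁻¹ ∈ SB n := inv_mem (mul_mem (inv_mem c.2.1) c'.2.1)
  have := eq_one_of_mem_SU_of_mem_SB hSU hSB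
  rw [inv_eq_one, inv_mul_eq_one] at this
  exact Subtype.ext this.symm

/-- The action of `G₊ × G₊` on `SL(2n, ℂ)`: `(η_L, η_R) • K = η_L K η_R⁻¹`. -/
instance gplusAction (n : ℕ) : MulAction (Gplus n × Gplus n) (SL2n n) where
  smul η K := η.1.1 * K * (η.2.1)⁻¹
  one_smul K := by
    change (1 : SL2n n) * K * (1 : SL2n n)⁻¹ = K
    simp
  mul_smul η ξ K := by
    change (η.1.1 * ξ.1.1) * K * (η.2.1 * ξ.2.1)⁻¹ = η.1.1 * (ξ.1.1 * K * ξ.2.1⁻¹) * η.2.1⁻¹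
    group

/-- The isotropy group `G_μ` of `μ = (μ_L, μ_R)` in `G₊ × G₊`. -/
def isotropy {n : ℕ} (μ : GplusStar n × GplusStar n) : Subgroup (Gplus n × Gplus n) :=
  (dressingIsotropy μ.1).prod (dressingIsotropy μ.2)

theorem momentumMapPlus_smul {n : ℕ} {μ : GplusStar n × GplusStar n} (η : isotropy μ)
    {K : SL2n n} (hK : momentumMapPlus K = μ) : momentumMapPlus (η • K) = μ := by
  obtain ⟨⟨ηL, ηR⟩, h⟩ := η
  subst hK
  have e : (ηL.1 * K * ηR.1⁻¹)⁻¹ = ηR.1 * K⁻¹ * ηL.1⁻¹ := by group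
  refine Prod.ext (diagProj_bL_of_mem K h.1) ?_
  have h2 : ηR ∈ dressingIsotropy (diagProj (bR K)) := h.2
  change diagProj (bR (ηL.1 * K * ηR.1⁻¹)) = diagProj (bR K)
  rw [bR_eq_bL_inv] at h2 ⊢
  rw [bR_eq_bL_inv, e]
  exact diagProj_bL_of_mem K⁻¹ h2

/-- The level set `Φ₊⁻¹(μ)`, with the subspace topology of `SL(2n, ℂ)`. -/
def levelSet {n : ℕ} (μ : GplusStar n × GplusStar n) : Set (SL2n n) :=
  {K | momentumMapPlus K = μ}

/-- `G_μ` acts on `Φ₊⁻¹(μ)`. -/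
instance isotropyAction {n : ℕ} (μ : GplusStar n × GplusStar n) :
    MulAction (isotropy μ) (levelSet μ) where
  smul η K := ⟨η • (K : SL2n n), momentumMapPlus_smul η K.2⟩
  one_smul K := Subtype.ext (one_smul _ (K : SL2n n))
  mul_smul η ξ K := Subtype.ext (mul_smul η ξ (K : SL2n n))

/-- The upper triangular `n × n` matrix `ν(x)`. -/
def nu (n : ℕ) (x : ℝ) : Matrix (Fin n) (Fin n) ℂ :=
  Matrix.of fun j k =>
    if j = k then 1
    else if j < k then
      (((1 - Real.exp (-x)) * Real.exp (((k : ℝ) - (j : ℝ)) * x / 2) : ℝ) : ℂ)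
    else 0

theorem fromBlocks_mem_GplusStar {n : ℕ} (a : ℝ) (N : Matrix (Fin n) (Fin n) ℂ)
    (hN : ∀ i j, j < i → N i j = 0) (hN' : ∀ i, N i i = 1) :
    ∃ c : SL2n n, c ∈ GplusStar n ∧ c.1 = Matrix.fromBlocks
      ((Real.exp a : ℂ) • N) 0 0 ((Real.exp (-a) : ℂ) • (1 : Matrix (Fin n) (Fin n) ℂ)) := by
  have hdetN : N.det = 1 := by
    rw [Matrix.det_of_isUpperTriangular (fun i j h => hN i j h)]
    simp [hN']
  have hdet : (Matrix.fromBlocks ((Real.exp a : ℂ) • N) 0 0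
      ((Real.exp (-a) : ℂ) • (1 : Matrix (Fin n) (Fin n) ℂ))).det = 1 := by
    rw [Matrix.det_fromBlocks_zero₂₁, Matrix.det_smul, Matrix.det_smul, hdetN, Matrix.det_one,
      mul_one, mul_one, ← mul_pow, ← Complex.ofReal_mul, ← Real.exp_add]
    simp
  refine ⟨⟨_, hdet⟩, ⟨⟨?_, ?_⟩, Matrix.toBlocks_fromBlocks₁₂ _ _ _ _⟩, rfl⟩
  · rintro (i | i) (j | j) hij
    · have : j < i := Sum.Lex.inl_lt_inl_iff.1 hij
      simp [hN i j this]
    · rfl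
    · rfl
    · have : j < i := Sum.Lex.inr_lt_inr_iff.1 hij
      simp [Matrix.one_apply_ne this.ne']
  · rintro (i | i)
    · exact ⟨Real.exp a, Real.exp_pos _, by simp [hN']⟩
    · exact ⟨Real.exp (-a), Real.exp_pos _, by simp⟩

theorem muL_aux (n : ℕ) (u x : ℝ) : ∃ c : SL2n n, c ∈ GplusStar n ∧ c.1 = Matrix.fromBlocks
    ((Real.exp u : ℂ) • nu n x) 0 0 ((Real.exp (-u) : ℂ) • (1 : Matrix (Fin n) (Fin n) ℂ)) :=
  fromBlocks_mem_GplusStar u (nu n x)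
    (fun _ _ h => by simp [nu, h.ne', h.not_gt]) (fun i => by simp [nu])

theorem muR_aux (n : ℕ) (v : ℝ) : ∃ c : SL2n n, c ∈ GplusStar n ∧ c.1 = Matrix.fromBlocks
    ((Real.exp v : ℂ) • (1 : Matrix (Fin n) (Fin n) ℂ)) 0 0
    ((Real.exp (-v) : ℂ) • (1 : Matrix (Fin n) (Fin n) ℂ)) :=
  fromBlocks_mem_GplusStar v 1 (fun _ _ h => Matrix.one_apply_ne h.ne')
    (fun i => Matrix.one_apply_eq i)

/-- `μ_L = diag(e^u ν(x), e^{-u} 1)`. -/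
def muL (n : ℕ) (u x : ℝ) : GplusStar n :=
  ⟨⟨Matrix.fromBlocks ((Real.exp u : ℂ) • nu n x) 0
      0 ((Real.exp (-u) : ℂ) • (1 : Matrix (Fin n) (Fin n) ℂ)), by
    obtain ⟨c, -, hc⟩ := muL_aux n u x
    exact hc ▸ c.2⟩, by
    obtain ⟨c, hc, hcb⟩ := muL_aux n u x
    exact (Subtype.ext hcb : c = ⟨_, _⟩) ▸ hc⟩

/-- `μ_R = diag(e^v 1, e^{-v} 1)`. -/
def muR (n : ℕ) (v : ℝ) : GplusStar n :=
  ⟨⟨Matrix.fromBlocks ((Real.exp v : ℂ) • (1 : Matrix (Fin n) (Fin n) ℂ)) 0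
      0 ((Real.exp (-v) : ℂ) • (1 : Matrix (Fin n) (Fin n) ℂ)), by
    obtain ⟨c, -, hc⟩ := muR_aux n v
    exact hc ▸ c.2⟩, by
    obtain ⟨c, hc, hcb⟩ := muR_aux n v
    exact (Subtype.ext hcb : c = ⟨_, _⟩) ▸ hc⟩

/-- The value `μ = (μ_L, μ_R)` of the momentum map constraint. -/
def mu (n : ℕ) (u v x : ℝ) : GplusStar n × GplusStar n := (muL n u x, muR n v)

/-- The constraint surface `Φ₊⁻¹(μ)`. -/
abbrev ConstraintSurface (n : ℕ) (u v x : ℝ) : Type := levelSet (mu n u v x)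

/-- The reduced phase space `M = Φ₊⁻¹(μ) / G_μ`, with the quotient topology. -/
abbrev ReducedSpace (n : ℕ) (u v x : ℝ) : Type :=
  Quotient (MulAction.orbitRel (isotropy (mu n u v x)) (ConstraintSurface n u v x))

/-- The canonical projection `π_μ : Φ₊⁻¹(μ) → M`. -/
def reductionMap (n : ℕ) (u v x : ℝ) : ConstraintSurface n u v x → ReducedSpace n u v x :=
  Quotient.mk _

/-- The isotropy group of a matrix of the shape of `μ_L`: only the first block of `η` is
constrained, and it has to commute with `N N†`. -/
theorem mem_dressingIsotropy_fromBlocks {n : ℕ} {a : ℝ} {N : Matrix (Fin n) (Fin n) ℂ}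
    {c : GplusStar n} (hc : c.1.1 = Matrix.fromBlocks ((Real.exp a : ℂ) • N) 0
      0 ((Real.exp (-a) : ℂ) • (1 : Matrix (Fin n) (Fin n) ℂ))) (η : Gplus n) :
    η ∈ dressingIsotropy c ↔
      η.1.1.toBlocks₁₁ * (N * Nᴴ) * (η⁻¹).1.1.toBlocks₁₁ = N * Nᴴ := by
  have hη := Gplus_eq_fromBlocks η.2
  have hη' := Gplus_eq_fromBlocks (η⁻¹).2
  have h1 : η.1.1 * (η⁻¹).1.1 = 1 := by
    rw [← Matrix.SpecialLinearGroup.coe_mul, ← Subgroup.coe_mul, mul_inv_cancel]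
    rfl
  have h22 : η.1.1.toBlocks₂₂ * (η⁻¹).1.1.toBlocks₂₂ = 1 := by
    rw [← (toBlocks_mul_of_upper η.2.2.2 (η⁻¹).2.2.2).2.2.2, h1, ← Matrix.fromBlocks_one,
      Matrix.toBlocks_fromBlocks₂₂]
  have ha : ((Real.exp a : ℂ) * (Real.exp a : ℂ)) ≠ 0 :=
    mul_ne_zero (by exact_mod_cast (Real.exp_pos a).ne') (by exact_mod_cast (Real.exp_pos a).ne')
  change η.1.1 * (c.1.1 * c.1.1ᴴ) * (η⁻¹).1.1 = c.1.1 * c.1.1ᴴ ↔ _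
  rw [hc, ← hη, ← hη', Matrix.fromBlocks_conjTranspose, Matrix.fromBlocks_multiply,
    Matrix.fromBlocks_multiply, Matrix.fromBlocks_multiply, Matrix.fromBlocks_inj]
  simp only [Matrix.conjTranspose_zero, Matrix.mul_zero, Matrix.zero_mul, add_zero, zero_add, smul_zero,
    Matrix.toBlocks_fromBlocks₁₁, Matrix.conjTranspose_smul, Matrix.smul_mul, Matrix.mul_smul, smul_smul, Matrix.conjTranspose_one,
    Matrix.mul_one, Complex.star_def, Complex.conj_ofReal, h22, and_true]
  rw [smul_right_inj ha]

theorem mem_dressingIsotropy_muL {n : ℕ} (u x : ℝ) (η : Gplus n) :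
    η ∈ dressingIsotropy (muL n u x) ↔
      η.1.1.toBlocks₁₁ * (nu n x * (nu n x)ᴴ) * (η⁻¹).1.1.toBlocks₁₁ = nu n x * (nu n x)ᴴ :=
  mem_dressingIsotropy_fromBlocks rfl η

theorem dressingIsotropy_muR (n : ℕ) (v : ℝ) :
    dressingIsotropy (muR n v) = ⊤ := by
  refine (Subgroup.eq_top_iff' _).2 fun η => (mem_dressingIsotropy_fromBlocks rfl η).2 ?_
  rw [Matrix.one_mul, Matrix.conjTranspose_one, Matrix.mul_one,
    ← (toBlocks_mul_of_upper η.2.2.2 (η⁻¹).2.2.2).1, ← Matrix.SpecialLinearGroup.coe_mul,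
    ← Subgroup.coe_mul, mul_inv_cancel]
  exact (congrArg Matrix.toBlocks₁₁ Matrix.fromBlocks_one.symm).trans
    (Matrix.toBlocks_fromBlocks₁₁ _ _ _ _)

end

end HeisenbergReduction

open HeisenbergReduction

/-! ### Inverse functions as charts -/

/-! This is regular reduction by the compact group `G_μ`. At a point `K` of the constraint surface
three things are needed: the derivative of the constraints is onto, the infinitesimal action of
`G_μ` is injective, and every element of `G_μ` fixing `K` acts trivially on all of `SL(2n, ℂ)`. The
last replaces freeness, which fails because equal scalars in the two factors act trivially.

Since `K = b_L g_R⁻¹ = g_L b_R⁻¹`, the constraints can be written without Iwasawa factors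
(`mem_levelSet_mu_iff`): they fix the lower right block of `L = K K†`, the upper left block of
`L⁻¹`, the upper left block of `K† K` and the lower right block of its inverse. All of these are
scalar except the block of `L⁻¹`, which is a scalar plus a multiple of `w w†`, because `ν ν†` is
itself a rank one perturbation of a scalar (`nu_mul_conjTranspose`).

The heart is a rigidity statement, `stabilizer_scalar`: if `A`, `C` are Hermitian and block
diagonal, `A K = K C`, and `w` is an eigenvector of the first block of `A` with eigenvalue `θ`, then
`A = C = θ`. Otherwise `A` has an eigenvalue `t ≠ θ`. Compressing `K` to the `t`-eigenspaces of `C`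
and `A`, which are orthogonal to `w` in the first block, gives an invertible matrix all of whose
prescribed blocks are scalar. With `α = -2v`, `β = -2u`, `γ = 2u - x`, the logarithms `t` of the
eigenvalues of the compressed `K K†` then satisfy `(t - γ)(t - β) ≥ 0` and `|t| ≥ |α|`, and
determinants relate the block sizes `p, q, r, s` by `pγ + qβ = (r - s)α`. According to whether `β <
-α` or `β > -α`, an off-diagonal block is invertible, which forces `p = q` or `r = s` and a
reflection symmetry of the spectrum. Together these are contradictory, since `β + γ = -x ≠ 0`.

Rigidity yields all three facts. Group elements are split into Hermitian and skew Hermitian parts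
(`smul_eq_of_smul_eq`); Lie algebra elements are multiplied by `i` (`orbitTangent_injective`). For
surjectivity, a covector annihilating the image of the derivative produces a pair `A`, `C` as above,
and the trace conditions then kill it (`eq_zero_of_multiplierMatrix_eq_smul_one`). Here the
constraints are first freed of two redundant scalar equations, using complementary minors.

Given these facts, the inverse function theorem for `(slice, constraint, Lie algebra) ↦ exp(ξ) •
point` gives charts of `SL(2n, ℂ)` in which the surface is a linear subspace and its orbits are the
fibres of a linear projection; compactness of `G_μ` is what prevents an orbit from returning to the
slice (`exists_foliated_slice_chart`). Such charts induce the structures on the surface and on the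
quotient (`exists_reduced_manifold`). -/

section LocalInverse

variable {E F : Type*} [NormedAddCommGroup E] [NormedSpace ℝ E] [CompleteSpace E]
  [NormedAddCommGroup F] [NormedSpace ℝ F]

/-- The inverse function theorem, with a smooth local inverse on a whole neighbourhood. -/
theorem exists_openPartialHomeomorph_of_contDiff {f : E → F} (hf : ContDiff ℝ ∞ f)
    {a : E} {f' : E ≃L[ℝ] F} (hf' : HasFDerivAt f (f' : E →L[ℝ] F) a) {U : Set E}
    (hU : IsOpen U) (haU : a ∈ U) :
    ∃ h : OpenPartialHomeomorph E F, a ∈ h.source ∧ h.source ⊆ U ∧ (∀ x, h x = f x) ∧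
      ContDiffOn ℝ ∞ h h.source ∧ ContDiffOn ℝ ∞ h.symm h.target := by
  have hinf : (∞ : WithTop ℕ∞) ≠ 0 := by simp
  set h₀ := hf.contDiffAt.toOpenPartialHomeomorph f hf' hinf with hh₀
  -- The inverse is smooth wherever the derivative is invertible. Invertible operators form an open
  -- set, so shrinking the source to `V` gives smoothness on the whole target.
  set V : Set E := fderiv ℝ f ⁻¹' Set.range ((↑) : (E ≃L[ℝ] F) → E →L[ℝ] F) with hV
  have hVo : IsOpen V := (ContinuousLinearEquiv.isOpen).preimage (hf.continuous_fderiv hinf)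
  have haV : a ∈ V := ⟨f', hf'.fderiv.symm⟩
  refine ⟨h₀.restrOpen (U ∩ V) (hU.inter hVo), ⟨?_, haU, haV⟩, fun x hx => hx.2.1,
    fun _ => rfl, hf.contDiffOn, ?_⟩
  · exact hf.contDiffAt.mem_toOpenPartialHomeomorph_source hf' hinf
  · intro y hy
    set h := h₀.restrOpen (U ∩ V) (hU.inter hVo)
    obtain ⟨g, hg⟩ := (h.map_target hy).2.2
    refine (h.contDiffAt_symm (f₀' := g) hy ?_ hf.contDiffAt).contDiffWithinAt
    rw [hg]
    exact ((hf.differentiable hinf) _).hasFDerivAt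

end LocalInverse

/-! ### Charts of the maximal atlas and their changes -/

section MaximalAtlas

variable {E M : Type*} [NormedAddCommGroup E] [NormedSpace ℝ E] [TopologicalSpace M]
  [ChartedSpace E M]

theorem mem_contDiffGroupoid_self_iff {h : OpenPartialHomeomorph E E} :
    h ∈ contDiffGroupoid ∞ 𝓘(ℝ, E) ↔
      ContDiffOn ℝ ∞ h h.source ∧ ContDiffOn ℝ ∞ h.symm h.target := by
  rw [contDiffGroupoid, mem_groupoid_of_pregroupoid, contDiffPregroupoid]
  simp

/-- The adapted charts below are standard charts followed by a local diffeomorphism of the model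
space. -/
theorem trans_mem_maximalAtlas {φ : OpenPartialHomeomorph M E}
    (hφ : φ ∈ IsManifold.maximalAtlas 𝓘(ℝ, E) ∞ M) {h : OpenPartialHomeomorph E E}
    (hh : ContDiffOn ℝ ∞ h h.source) (hh' : ContDiffOn ℝ ∞ h.symm h.target) :
    φ ≫ₕ h ∈ IsManifold.maximalAtlas 𝓘(ℝ, E) ∞ M := by
  have hG := mem_contDiffGroupoid_self_iff.2 ⟨hh, hh'⟩
  intro e he
  obtain ⟨h1, h2⟩ := hφ e he
  constructor
  · rw [OpenPartialHomeomorph.trans_symm_eq_symm_trans_symm, OpenPartialHomeomorph.trans_assoc]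
    exact StructureGroupoid.trans _ (StructureGroupoid.symm _ hG) h1
  · rw [← OpenPartialHomeomorph.trans_assoc]
    exact StructureGroupoid.trans _ h2 hG

theorem isManifold_of_contDiffOn_self
    (h : ∀ e ∈ atlas E M, ∀ e' ∈ atlas E M,
      ContDiffOn ℝ ∞ (e.symm ≫ₕ e') (e.symm ≫ₕ e').source) :
    IsManifold 𝓘(ℝ, E) ∞ M := by
  apply isManifold_of_contDiffOn
  intro e e' he he'
  simpa using h e he e' he'

end MaximalAtlas

/-! ### Embedded submanifolds from slice charts -/

section Submanifold

variable {E M : Type*} [NormedAddCommGroup E] [NormedSpace ℝ E] [TopologicalSpace M]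
  [ChartedSpace E M]

/-- A chart of `M` in which the set `Z` becomes a linear subspace. -/
structure SliceChart (Z : Set M) (D C : Type*) [NormedAddCommGroup D] [NormedSpace ℝ D]
    [NormedAddCommGroup C] [NormedSpace ℝ C] where
  /-- the chart of the ambient manifold -/
  chart : OpenPartialHomeomorph M E
  chart_mem : chart ∈ IsManifold.maximalAtlas 𝓘(ℝ, E) ∞ M
  /-- the splitting of the model space -/
  equiv : E ≃L[ℝ] D × C
  mem_iff : ∀ q ∈ chart.source, q ∈ Z ↔ (equiv (chart q)).2 = 0

namespace SliceChart

variable {Z : Set M} {D C : Type*} [NormedAddCommGroup D] [NormedSpace ℝ D]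
  [NormedAddCommGroup C] [NormedSpace ℝ C]

theorem symm_mem (S : SliceChart (E := E) Z D C) {y : D}
    (hy : S.equiv.symm (y, 0) ∈ S.chart.target) : S.chart.symm (S.equiv.symm (y, 0)) ∈ Z := by
  rw [S.mem_iff _ (S.chart.map_target hy), S.chart.right_inv hy]
  simp

theorem equiv_symm_eq (S : SliceChart (E := E) Z D C) (q : Z) (hq : (q : M) ∈ S.chart.source) :
    S.equiv.symm ((S.equiv (S.chart q)).1, 0) = S.chart q := by
  rw [← (S.mem_iff _ hq).1 q.2]
  exact S.equiv.symm_apply_apply _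

open Classical in
/-- The chart of `Z` induced by a slice chart. -/
noncomputable def restrict (S : SliceChart (E := E) Z D C) (p : Z) :
    OpenPartialHomeomorph Z D where
  toFun q := (S.equiv (S.chart q)).1
  -- The point `p` is only a junk value off the target.
  invFun y := if h : S.equiv.symm (y, 0) ∈ S.chart.target then
    ⟨S.chart.symm (S.equiv.symm (y, 0)), S.symm_mem h⟩ else p
  source := {q | (q : M) ∈ S.chart.source}
  target := {y | S.equiv.symm (y, 0) ∈ S.chart.target}
  map_source' q hq := by
    change S.equiv.symm ((S.equiv (S.chart q)).1, 0) ∈ S.chart.target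
    rw [S.equiv_symm_eq q hq]
    exact S.chart.map_source hq
  map_target' y hy := by
    have hy' : S.equiv.symm (y, 0) ∈ S.chart.target := hy
    simp only [hy', dite_true]
    exact S.chart.map_target hy
  left_inv' q hq := by
    have e := S.equiv_symm_eq q hq
    have h : S.equiv.symm ((S.equiv (S.chart q)).1, 0) ∈ S.chart.target := by
      rw [e]; exact S.chart.map_source hq
    rw [dif_pos h]
    apply Subtype.ext
    simp only [e]
    exact S.chart.left_inv hq
  right_inv' y hy := by
    have hy' : S.equiv.symm (y, 0) ∈ S.chart.target := hy
    simp only [hy', dite_true]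
    rw [S.chart.right_inv hy']
    simp
  open_source := S.chart.open_source.preimage continuous_subtype_val
  open_target := S.chart.open_target.preimage
    (S.equiv.symm.continuous.comp (Continuous.prodMk_left 0))
  continuousOn_toFun := by
    refine (continuous_fst.comp S.equiv.continuous).comp_continuousOn ?_
    exact S.chart.continuousOn.comp continuous_subtype_val.continuousOn fun q hq => hq
  continuousOn_invFun := by
    refine (Topology.IsInducing.subtypeVal).continuousOn_iff.2 ?_
    have h : ContinuousOn (fun y : D => S.chart.symm (S.equiv.symm (y, 0)))
        {y | S.equiv.symm (y, 0) ∈ S.chart.target} :=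
      S.chart.symm.continuousOn.comp
        (S.equiv.symm.continuous.comp (Continuous.prodMk_left 0)).continuousOn fun y hy => hy
    refine h.congr fun y hy => ?_
    have hy' : S.equiv.symm (y, 0) ∈ S.chart.target := hy
    simp [hy']

theorem restrict_apply (S : SliceChart (E := E) Z D C) (p q : Z) :
    S.restrict p q = (S.equiv (S.chart q)).1 := rfl

theorem coe_restrict_symm (S : SliceChart (E := E) Z D C) (p : Z) {y : D}
    (hy : y ∈ (S.restrict p).target) :
    ((S.restrict p).symm y : M) = S.chart.symm (S.equiv.symm (y, 0)) := by
  classical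
  have hy' : S.equiv.symm (y, 0) ∈ S.chart.target := hy
  change ((if h : S.equiv.symm (y, 0) ∈ S.chart.target then
    ⟨S.chart.symm (S.equiv.symm (y, 0)), S.symm_mem h⟩ else p : Z) : M) = _
  rw [dif_pos hy']

/-- The transition is the ambient one preceded by `y ↦ (y, 0)` and followed by the first projection.
-/
theorem contDiffOn_restrict_symm_trans (S S' : SliceChart (E := E) Z D C) (p p' : Z) :
    ContDiffOn ℝ ∞ ((S.restrict p).symm ≫ₕ S'.restrict p')
      ((S.restrict p).symm ≫ₕ S'.restrict p').source := by
  have h1 := (mem_contDiffGroupoid_self_iff.1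
    (IsManifold.compatible_of_mem_maximalAtlas S.chart_mem S'.chart_mem)).1
  have h2 : ContDiff ℝ ∞ fun y : D => S.equiv.symm (y, (0 : C)) :=
    S.equiv.symm.contDiff.comp (contDiff_prodMk_left 0)
  have h3 : ContDiff ℝ ∞ fun z : E => (S'.equiv z).1 := contDiff_fst.comp S'.equiv.contDiff
  refine (h3.comp_contDiffOn (h1.comp h2.contDiffOn (s := ((S.restrict p).symm ≫ₕ
    S'.restrict p').source) ?_)).congr ?_
  · intro y hy
    have hy1 : y ∈ (S.restrict p).target := hy.1
    refine ⟨hy1, ?_⟩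
    have : (((S.restrict p).symm y : Z) : M) ∈ S'.chart.source := hy.2
    rwa [S.coe_restrict_symm p hy1] at this
  · intro y hy
    have hy1 : y ∈ (S.restrict p).target := hy.1
    simp [restrict_apply, S.coe_restrict_symm p hy1]

/-- The manifold structure on `Z` given by a family of slice charts. -/
@[reducible]
noncomputable def chartedSpace (S : Z → SliceChart (E := E) Z D C)
    (hS : ∀ p, (p : M) ∈ (S p).chart.source) : ChartedSpace D Z where
  atlas := Set.range fun p => (S p).restrict p
  chartAt p := (S p).restrict p
  mem_chart_source p := hS p
  chart_mem_atlas p := ⟨p, rfl⟩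

theorem isManifold (S : Z → SliceChart (E := E) Z D C)
    (hS : ∀ p, (p : M) ∈ (S p).chart.source) :
    @IsManifold ℝ _ D _ _ D _ 𝓘(ℝ, D) ∞ Z _ (chartedSpace S hS) := by
  let := chartedSpace S hS
  apply isManifold_of_contDiffOn_self
  rintro _ ⟨p, rfl⟩ _ ⟨p', rfl⟩
  exact contDiffOn_restrict_symm_trans _ _ _ _

/-- In the charts `S.restrict` and `S.chart` the inclusion reads `y ↦ (y, 0)`, the normal form of an
immersion with complement `C`. -/
theorem isSmoothEmbedding (S : Z → SliceChart (E := E) Z D C)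
    (hS : ∀ p, (p : M) ∈ (S p).chart.source) :
    letI := chartedSpace S hS
    IsSmoothEmbedding 𝓘(ℝ, D) 𝓘(ℝ, E) ∞ (Subtype.val : Z → M) := by
  let := chartedSpace S hS
  have := isManifold S hS
  refine ⟨?_, Topology.IsEmbedding.subtypeVal⟩
  have h : IsImmersionOfComplement C 𝓘(ℝ, D) 𝓘(ℝ, E) ∞ (Subtype.val : Z → M) := by
    intro p
    refine IsImmersionAtOfComplement.mk_of_charts (S p).equiv.symm ((S p).restrict p) (S p).chart
      (hS p) (hS p) (IsManifold.subset_maximalAtlas ⟨p, rfl⟩) (S p).chart_mem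
      (fun q hq => hq) ?_
    intro y hy
    have hy' : y ∈ ((S p).restrict p).target := by simpa using hy
    simp only [OpenPartialHomeomorph.extend_coe, OpenPartialHomeomorph.extend_coe_symm,
      modelWithCornersSelf_coe, modelWithCornersSelf_coe_symm, Function.comp_apply, id_eq]
    rw [(S p).coe_restrict_symm p hy', (S p).chart.right_inv hy']
  exact h.isImmersion

end SliceChart

end Submanifold

/-! ### Quotients from foliated charts -/

section Quotient

open Topology

variable {D N : Type*} [NormedAddCommGroup D] [NormedSpace ℝ D] [TopologicalSpace N]
  [ChartedSpace D N]

/-- A chart in which the classes of the equivalence relation `r` are the fibres of a linear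
projection. -/
structure FoliatedChart (r : Setoid N) (A B : Type*) [NormedAddCommGroup A] [NormedSpace ℝ A]
    [NormedAddCommGroup B] [NormedSpace ℝ B] where
  /-- the chart of the manifold -/
  chart : OpenPartialHomeomorph N D
  chart_mem : chart ∈ IsManifold.maximalAtlas 𝓘(ℝ, D) ∞ N
  /-- the splitting of the model space -/
  equiv : D ≃L[ℝ] A × B
  rel_iff : ∀ q ∈ chart.source, ∀ q' ∈ chart.source,
    r q q' ↔ (equiv (chart q)).1 = (equiv (chart q')).1

namespace FoliatedChart

variable {r : Setoid N} {A B : Type*} [NormedAddCommGroup A] [NormedSpace ℝ A]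
  [NormedAddCommGroup B] [NormedSpace ℝ B] (S : FoliatedChart (D := D) r A B)

/-- The point of the transversal with parameter `a`. -/
def transversal (a : A) : N := S.chart.symm (S.equiv.symm (a, 0))

/-- The parameters of the transversal. -/
def parameters : Set A := {a | S.equiv.symm (a, 0) ∈ S.chart.target}

theorem continuous_param : Continuous fun a : A => S.equiv.symm (a, (0 : B)) :=
  S.equiv.symm.continuous.comp (Continuous.prodMk_left 0)

theorem isOpen_parameters : IsOpen S.parameters :=
  S.chart.open_target.preimage S.continuous_param

theorem continuousOn_transversal : ContinuousOn S.transversal S.parameters :=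
  S.chart.symm.continuousOn.comp S.continuous_param.continuousOn fun _ h => h

theorem transversal_mem {a : A} (ha : a ∈ S.parameters) : S.transversal a ∈ S.chart.source :=
  S.chart.map_target ha

theorem equiv_chart_transversal {a : A} (ha : a ∈ S.parameters) :
    S.equiv (S.chart (S.transversal a)) = (a, 0) := by
  rw [transversal, S.chart.right_inv ha, S.equiv.apply_symm_apply]

theorem rel_transversal {q : N} (hq : q ∈ S.chart.source)
    (h : (S.equiv (S.chart q)).1 ∈ S.parameters) : r q (S.transversal (S.equiv (S.chart q)).1) := by
  rw [S.rel_iff q hq _ (S.transversal_mem h), S.equiv_chart_transversal h]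

/-- The points of the chart domain lying over the parameter set. -/
def dom : Set N := {q | q ∈ S.chart.source ∧ (S.equiv (S.chart q)).1 ∈ S.parameters}

theorem isOpen_slab {W : Set A} (hW : IsOpen W) :
    IsOpen {q | q ∈ S.chart.source ∧ (S.equiv (S.chart q)).1 ∈ W} :=
  S.chart.isOpen_inter_preimage (s := {y | (S.equiv y).1 ∈ W})
    (hW.preimage (continuous_fst.comp S.equiv.continuous))

open Classical in
/-- The chart of the quotient induced by a foliated chart. -/
noncomputable def quotientChart (hr : IsOpenMap (Quotient.mk r)) :
    OpenPartialHomeomorph (Quotient r) A :=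
  -- The map `a ↦ [transversal a]` is the one whose continuity and openness are accessible, so it is
  -- built first and inverted at the end.
  (OpenPartialHomeomorph.ofContinuousOpenRestrict
    (X := A) (Y := Quotient r)
    { toFun := fun a => Quotient.mk r (S.transversal a)
      invFun := fun z => if h : ∃ q ∈ S.dom, Quotient.mk r q = z
        then (S.equiv (S.chart h.choose)).1 else 0
      source := S.parameters
      target := Quotient.mk r '' S.dom
      map_source' := fun a ha => ⟨S.transversal a, ⟨S.transversal_mem ha, by
        rw [S.equiv_chart_transversal ha]; exact ha⟩, rfl⟩
      map_target' := by
        rintro z hz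
        have h : ∃ q ∈ S.dom, Quotient.mk r q = z := hz
        rw [dif_pos h]
        exact h.choose_spec.1.2
      left_inv' := by
        intro a ha
        have h : ∃ q ∈ S.dom, Quotient.mk r q = Quotient.mk r (S.transversal a) :=
          ⟨S.transversal a, ⟨S.transversal_mem ha, by
            rw [S.equiv_chart_transversal ha]; exact ha⟩, rfl⟩
        rw [dif_pos h]
        have := (S.rel_iff _ h.choose_spec.1.1 _ (S.transversal_mem ha)).1
          (Quotient.exact h.choose_spec.2)
        rw [this, S.equiv_chart_transversal ha]
      right_inv' := by
        rintro z hz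
        have h : ∃ q ∈ S.dom, Quotient.mk r q = z := hz
        rw [dif_pos h]
        refine Eq.trans (Quotient.sound ?_) h.choose_spec.2
        exact r.symm (S.rel_transversal h.choose_spec.1.1 h.choose_spec.1.2) }
    (continuous_quotient_mk'.comp_continuousOn S.continuousOn_transversal)
    (by
      intro W hW
      obtain ⟨W', hW', rfl⟩ := isOpen_induced_iff.1 hW
      -- Each point of the slab over `W'` is equivalent to the transversal point with the same
      -- parameter. So the image of a piece of the transversal is the image of an open subset of
      -- `N`, and openness of the quotient map applies.
      have : (S.parameters.domRestrict fun a => Quotient.mk r (S.transversal a)) ''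
          (Subtype.val ⁻¹' W') = Quotient.mk r ''
            {q | q ∈ S.chart.source ∧ (S.equiv (S.chart q)).1 ∈ W' ∩ S.parameters} := by
        ext z
        constructor
        · rintro ⟨⟨a, ha⟩, haW, rfl⟩
          refine ⟨S.transversal a, ⟨S.transversal_mem ha, ?_⟩, rfl⟩
          rw [S.equiv_chart_transversal ha]
          exact ⟨haW, ha⟩
        · rintro ⟨q, ⟨hq, hqW, hqp⟩, rfl⟩
          exact ⟨⟨_, hqp⟩, hqW, Quotient.sound (r.symm (S.rel_transversal hq hqp))⟩
      change IsOpen ((S.parameters.domRestrict fun a => Quotient.mk r (S.transversal a)) ''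
          (Subtype.val ⁻¹' W'))
      rw [this]
      exact hr _ (S.isOpen_slab (hW'.inter S.isOpen_parameters)))
    S.isOpen_parameters).symm

variable (hr : IsOpenMap (Quotient.mk r))

theorem mk_mem_quotientChart_source {q : N} (hq : q ∈ S.dom) :
    Quotient.mk r q ∈ (S.quotientChart hr).source := ⟨q, hq, rfl⟩

theorem quotientChart_mk {q : N} (hq : q ∈ S.dom) :
    S.quotientChart hr (Quotient.mk r q) = (S.equiv (S.chart q)).1 := by
  have h : Quotient.mk r q = (S.quotientChart hr).symm (S.equiv (S.chart q)).1 :=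
    Quotient.sound (S.rel_transversal hq.1 hq.2)
  rw [h, (S.quotientChart hr).right_inv hq.2]

/-- Transition functions of quotient charts are smooth if equivalent points are related by smooth
maps preserving the classes. -/
theorem contDiffOn_quotientChart_symm_trans [IsManifold 𝓘(ℝ, D) ∞ N]
    (hsm : ∀ q q', r q q' → ∃ φ : N → N, ContMDiff 𝓘(ℝ, D) 𝓘(ℝ, D) ∞ φ ∧ φ q = q' ∧
      ∀ z, r z (φ z))
    (S S' : FoliatedChart (D := D) r A B) :
    ContDiffOn ℝ ∞ ((S.quotientChart hr).symm ≫ₕ S'.quotientChart hr)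
      ((S.quotientChart hr).symm ≫ₕ S'.quotientChart hr).source := by
  intro a₀ ha₀
  have ha : a₀ ∈ S.parameters := ha₀.1
  obtain ⟨q', hq', hqq⟩ := ha₀.2
  -- The points `transversal a₀` and `q'` are equivalent but may be far apart in `N`. The map `φ`
  -- carries one to the other along classes, so near `a₀` the transition is `a ↦` the
  -- `S'`-coordinate of `φ (transversal a)`.
  obtain ⟨φ, hφ, hφq, hφr⟩ := hsm (S.transversal a₀) q' (Quotient.exact hqq.symm)
  have hcont : ContinuousAt S.transversal a₀ :=
    S.continuousOn_transversal.continuousAt (S.isOpen_parameters.mem_nhds ha)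
  have hc1 : ContMDiffAt 𝓘(ℝ, D) 𝓘(ℝ, D) ∞ S.chart.symm (S.equiv.symm (a₀, 0)) :=
    (contMDiffOn_symm_of_mem_maximalAtlas S.chart_mem).contMDiffAt
      (S.chart.open_target.mem_nhds ha)
  have hc2 : ContMDiffAt 𝓘(ℝ, D) 𝓘(ℝ, D) ∞ S'.chart q' :=
    (contMDiffOn_of_mem_maximalAtlas S'.chart_mem).contMDiffAt
      (S'.chart.open_source.mem_nhds hq'.1)
  have hp : ContMDiffAt 𝓘(ℝ, A) 𝓘(ℝ, D) ∞ (fun a : A => S.equiv.symm (a, (0 : B))) a₀ :=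
    (S.equiv.symm.contDiff.comp (contDiff_prodMk_left 0)).contMDiff.contMDiffAt
  have hl : ContMDiffAt 𝓘(ℝ, D) 𝓘(ℝ, A) ∞ (fun y => (S'.equiv y).1) (S'.chart q') :=
    (contDiff_fst.comp S'.equiv.contDiff).contMDiff.contMDiffAt
  have h1 : ContMDiffAt 𝓘(ℝ, A) 𝓘(ℝ, D) ∞ S.transversal a₀ := hc1.comp a₀ hp
  have h2 : ContMDiffAt 𝓘(ℝ, A) 𝓘(ℝ, D) ∞ (fun a => φ (S.transversal a)) a₀ :=
    hφ.contMDiffAt.comp a₀ h1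
  have h3 : ContMDiffAt 𝓘(ℝ, A) 𝓘(ℝ, A) ∞
      (fun a => (S'.equiv (S'.chart (φ (S.transversal a)))).1) a₀ := by
    have hc2' : ContMDiffAt 𝓘(ℝ, D) 𝓘(ℝ, D) ∞ S'.chart (φ (S.transversal a₀)) := by
      rwa [hφq]
    have hl' : ContMDiffAt 𝓘(ℝ, D) 𝓘(ℝ, A) ∞ (fun y => (S'.equiv y).1)
        (S'.chart (φ (S.transversal a₀))) := by rwa [hφq]
    exact ContMDiffAt.comp (g := fun y => (S'.equiv y).1)
      (f := fun a => S'.chart (φ (S.transversal a))) a₀ hl' (ContMDiffAt.comp (g := S'.chart) (f := fun a => φ (S.transversal a)) a₀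
      hc2' h2)
  have hdom : IsOpen S'.dom := S'.isOpen_slab S'.isOpen_parameters
  have hev : ∀ᶠ a in 𝓝 a₀, φ (S.transversal a) ∈ S'.dom := by
    refine h2.continuousAt.eventually_mem ?_
    rw [hφq]
    exact hdom.mem_nhds hq'
  refine (h3.contDiffAt.congr_of_eventuallyEq ?_).contDiffWithinAt
  filter_upwards [hev] with a ha'
  change S'.quotientChart hr (Quotient.mk r (S.transversal a)) = _
  rw [← S'.quotientChart_mk hr ha']
  exact congrArg _ (Quotient.sound (hφr _))

/-- The manifold structure on the quotient. -/
@[reducible]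
noncomputable def chartedSpace (S : N → FoliatedChart (D := D) r A B)
    (hS : ∀ p, p ∈ (S p).dom) : ChartedSpace A (Quotient r) where
  atlas := Set.range fun p => (S p).quotientChart hr
  chartAt z := (S z.out).quotientChart hr
  mem_chart_source z := by
    have := (S z.out).mk_mem_quotientChart_source hr (hS z.out)
    rwa [Quotient.out_eq] at this
  chart_mem_atlas z := ⟨z.out, rfl⟩

theorem isManifold [IsManifold 𝓘(ℝ, D) ∞ N]
    (hsm : ∀ q q', r q q' → ∃ φ : N → N, ContMDiff 𝓘(ℝ, D) 𝓘(ℝ, D) ∞ φ ∧ φ q = q' ∧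
      ∀ z, r z (φ z))
    (S : N → FoliatedChart (D := D) r A B) (hS : ∀ p, p ∈ (S p).dom) :
    @IsManifold ℝ _ A _ _ A _ 𝓘(ℝ, A) ∞ (Quotient r) _ (chartedSpace hr S hS) := by
  let := chartedSpace hr S hS
  apply isManifold_of_contDiffOn_self
  rintro _ ⟨p, rfl⟩ _ ⟨p', rfl⟩
  exact contDiffOn_quotientChart_symm_trans hr hsm _ _

/-- Read in a foliated chart and its quotient chart, the projection is the linear map `A × B → A`.
The foliated chart is restricted to `dom`, where `quotientChart_mk` computes the quotient chart. -/
theorem isSubmersion [IsManifold 𝓘(ℝ, D) ∞ N]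
    (hsm : ∀ q q', r q q' → ∃ φ : N → N, ContMDiff 𝓘(ℝ, D) 𝓘(ℝ, D) ∞ φ ∧ φ q = q' ∧
      ∀ z, r z (φ z))
    (S : N → FoliatedChart (D := D) r A B) (hS : ∀ p, p ∈ (S p).dom) :
    letI := chartedSpace hr S hS
    IsSubmersion 𝓘(ℝ, D) 𝓘(ℝ, A) ∞ (Quotient.mk r) := by
  let := chartedSpace hr S hS
  have := isManifold hr hsm S hS
  have h : IsSubmersionOfComplement B 𝓘(ℝ, D) 𝓘(ℝ, A) ∞ (Quotient.mk r) := by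
    intro p
    have hdom : IsOpen (S p).dom := (S p).isOpen_slab (S p).isOpen_parameters
    refine IsSubmersionAtOfComplement.mk_of_charts (S p).equiv ((S p).chart.restrOpen _ hdom)
      ((S p).quotientChart hr) ⟨(hS p).1, hS p⟩
      ((S p).mk_mem_quotientChart_source hr (hS p)) ?_
      (IsManifold.subset_maximalAtlas ⟨p, rfl⟩)
      (fun q hq => (S p).mk_mem_quotientChart_source hr hq.2) ?_
    · have h := restr_mem_maximalAtlas _ (S p).chart_mem hdom
      simp only [OpenPartialHomeomorph.restr, hdom.interior_eq] at h
      exact h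
    intro y hy
    have hy' : y ∈ ((S p).chart.restrOpen _ hdom).target := by simpa using hy
    have hq := ((S p).chart.restrOpen _ hdom).map_target hy'
    simp only [OpenPartialHomeomorph.extend_coe, OpenPartialHomeomorph.extend_coe_symm,
      modelWithCornersSelf_coe, modelWithCornersSelf_coe_symm, Function.comp_apply, id_eq]
    rw [(S p).quotientChart_mk hr hq.2]
    exact congrArg (fun z => ((S p).equiv z).1)
      (((S p).chart.restrOpen _ hdom).right_inv hy')
  exact h.isSubmersion

end FoliatedChart

end Quotient

/-! ### Hermitian block matrices with a scalar block and a scalar Schur complement -/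

section SchurForm

variable {p q : Type*} [Fintype p] [Fintype q]

/-- `z` is an eigenvalue of `M`. -/
def HasEig {m : Type*} [Fintype m] (M : Matrix m m ℂ) (z : ℝ) : Prop :=
  ∃ ψ : m → ℂ, ψ ≠ 0 ∧ M *ᵥ ψ = (z : ℂ) • ψ

variable [DecidableEq p] [DecidableEq q]

/-- The Hermitian matrix with lower right block `b`, upper right block `Z` and Schur complement
`c`. -/
noncomputable def schurForm (b c : ℝ) (Z : Matrix p q ℂ) : Matrix (p ⊕ q) (p ⊕ q) ℂ :=
  Matrix.fromBlocks ((c : ℂ) • (1 : Matrix p p ℂ) + (b : ℂ)⁻¹ • (Z * Zᴴ)) Z Zᴴ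
    ((b : ℂ) • (1 : Matrix q q ℂ))

/-- The upper right block of `M L = 1` gives `M₁₂` in terms of `L₁₂`; inserting this in the upper
left block solves for `L₁₁`. -/
theorem eq_schurForm {b c : ℝ} (hb : b ≠ 0) (hc : c ≠ 0) {L M : Matrix (p ⊕ q) (p ⊕ q) ℂ}
    (hL : Lᴴ = L) (hML : M * L = 1) (h22 : L.toBlocks₂₂ = (b : ℂ) • (1 : Matrix q q ℂ))
    (h11 : M.toBlocks₁₁ = (c : ℂ)⁻¹ • (1 : Matrix p p ℂ)) :
    L = schurForm b c L.toBlocks₁₂ := by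
  have hb' : (b : ℂ) ≠ 0 := by exact_mod_cast hb
  have hc' : (c : ℂ) ≠ 0 := by exact_mod_cast hc
  have h21 : L.toBlocks₂₁ = L.toBlocks₁₂ᴴ := by
    ext i j
    exact (congrFun (congrFun hL (Sum.inr i)) (Sum.inl j)).symm
  rw [← Matrix.fromBlocks_toBlocks M, ← Matrix.fromBlocks_toBlocks L, Matrix.fromBlocks_multiply,
    ← Matrix.fromBlocks_one, Matrix.fromBlocks_inj, h11, h22, h21] at hML
  obtain ⟨e1, e2, -, -⟩ := hML
  have e3 : M.toBlocks₁₂ = -((b : ℂ)⁻¹ * (c : ℂ)⁻¹) • L.toBlocks₁₂ := by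
    have : (b : ℂ)⁻¹ • ((b : ℂ) • M.toBlocks₁₂) =
        (b : ℂ)⁻¹ • (-((c : ℂ)⁻¹ • L.toBlocks₁₂)) := by
      congr 1
      simp only [Matrix.smul_mul, Matrix.one_mul, Matrix.mul_smul, Matrix.mul_one] at e2
      exact eq_neg_of_add_eq_zero_right e2
    rw [smul_smul, inv_mul_cancel₀ hb', one_smul] at this
    rw [this, smul_neg, smul_smul, neg_smul]
  rw [e3] at e1
  have e4 : L.toBlocks₁₁ = (c : ℂ) • (1 : Matrix p p ℂ) +
      (b : ℂ)⁻¹ • (L.toBlocks₁₂ * L.toBlocks₁₂ᴴ) := by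
    have := congrArg (fun X => (c : ℂ) • X) e1
    simp only [Matrix.smul_mul, Matrix.one_mul, smul_add, smul_smul, neg_smul,
      mul_inv_cancel₀ hc', one_smul] at this
    rw [← this, Matrix.neg_mul, Matrix.smul_mul, smul_neg, smul_smul]
    have hs : (c : ℂ) * ((b : ℂ)⁻¹ * (c : ℂ)⁻¹) = (b : ℂ)⁻¹ := by field_simp
    rw [hs]
    abel
  rw [schurForm, ← e4, ← h21, ← h22, Matrix.fromBlocks_toBlocks]

/-- The Schur complement of the lower right block is `c • 1`, so `Z` drops out. -/
theorem det_schurForm {b c : ℝ} (hb : b ≠ 0) (Z : Matrix p q ℂ) :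
    (schurForm b c Z).det = (c : ℂ) ^ Fintype.card p * (b : ℂ) ^ Fintype.card q := by
  have hb' : (b : ℂ) ≠ 0 := by exact_mod_cast hb
  let _ : Invertible ((b : ℂ) • (1 : Matrix q q ℂ)) :=
    ⟨(b : ℂ)⁻¹ • 1,
      by rw [Matrix.smul_mul, Matrix.one_mul, smul_smul, inv_mul_cancel₀ hb', one_smul],
      by rw [Matrix.smul_mul, Matrix.one_mul, smul_smul, mul_inv_cancel₀ hb', one_smul]⟩
  have hinv : ⅟((b : ℂ) • (1 : Matrix q q ℂ)) = (b : ℂ)⁻¹ • 1 := rfl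
  rw [schurForm, Matrix.det_fromBlocks₂₂, hinv]
  simp only [Matrix.mul_smul, Matrix.mul_one, Matrix.smul_mul, add_sub_cancel_right]
  rw [Matrix.det_smul, Matrix.det_smul, Matrix.det_one, Matrix.det_one, mul_one, mul_one, mul_comm]

theorem schurForm_mulVec (b c : ℝ) (Z : Matrix p q ℂ) (ψ₁ : p → ℂ) (ψ₂ : q → ℂ) :
    schurForm b c Z *ᵥ Sum.elim ψ₁ ψ₂ =
      Sum.elim ((c : ℂ) • ψ₁ + (b : ℂ)⁻¹ • (Z *ᵥ (Zᴴ *ᵥ ψ₁)) + Z *ᵥ ψ₂)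
        (Zᴴ *ᵥ ψ₁ + (b : ℂ) • ψ₂) := by
  rw [schurForm, Matrix.fromBlocks_mulVec]
  simp only [Sum.elim_comp_inl, Sum.elim_comp_inr, Matrix.add_mulVec, Matrix.smul_mulVec,
    Matrix.one_mulVec, Matrix.mulVec_mulVec]

/-- The eigenvalue equation of `schurForm`. -/
theorem schurForm_eigen_iff {b c : ℝ} (hb : b ≠ 0) (Z : Matrix p q ℂ) (z : ℝ) (ψ₁ : p → ℂ)
    (ψ₂ : q → ℂ) :
    schurForm b c Z *ᵥ Sum.elim ψ₁ ψ₂ = (z : ℂ) • Sum.elim ψ₁ ψ₂ ↔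
      (((z : ℂ) / b) • (Z *ᵥ ψ₂) = ((z : ℂ) - c) • ψ₁ ∧ Zᴴ *ᵥ ψ₁ = ((z : ℂ) - b) • ψ₂) := by
  have hb' : (b : ℂ) ≠ 0 := by exact_mod_cast hb
  have hsm : (z : ℂ) • Sum.elim ψ₁ ψ₂ = Sum.elim ((z : ℂ) • ψ₁) ((z : ℂ) • ψ₂) := by
    ext (i | i) <;> simp
  rw [schurForm_mulVec, hsm, Sum.elim_eq_iff]
  constructor
  · rintro ⟨h1, h2⟩
    have h3 : Zᴴ *ᵥ ψ₁ = ((z : ℂ) - b) • ψ₂ := by rw [sub_smul, ← h2]; abel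
    refine ⟨?_, h3⟩
    rw [h3, Matrix.mulVec_smul, smul_smul] at h1
    have e : (z : ℂ) / b = (b : ℂ)⁻¹ * ((z : ℂ) - b) + 1 := by field_simp; ring
    rw [e, add_smul, one_smul, sub_smul, ← h1]
    abel
  · rintro ⟨h1, h3⟩
    refine ⟨?_, by rw [h3, sub_smul]; abel⟩
    rw [h3, Matrix.mulVec_smul, smul_smul]
    have e : (z : ℂ) / b = (b : ℂ)⁻¹ * ((z : ℂ) - b) + 1 := by field_simp; ring
    rw [e, add_smul, one_smul, sub_smul] at h1
    rw [add_assoc, h1]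
    abel

theorem HasEig.exists_schurForm {b c : ℝ} (hb : b ≠ 0) {Z : Matrix p q ℂ} {z : ℝ}
    (h : HasEig (schurForm b c Z) z) : ∃ (ψ₁ : p → ℂ) (ψ₂ : q → ℂ), (ψ₁ ≠ 0 ∨ ψ₂ ≠ 0) ∧
      ((z : ℂ) / b) • (Z *ᵥ ψ₂) = ((z : ℂ) - c) • ψ₁ ∧ Zᴴ *ᵥ ψ₁ = ((z : ℂ) - b) • ψ₂ := by
  obtain ⟨ψ, hψ, e⟩ := h
  have hs : ψ = Sum.elim (ψ ∘ Sum.inl) (ψ ∘ Sum.inr) := (Sum.elim_comp_inl_inr ψ).symm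
  rw [hs, schurForm_eigen_iff hb] at e
  refine ⟨_, _, ?_, e⟩
  by_contra! hc
  rw [hc.1, hc.2] at hs
  exact hψ (hs.trans (by ext (i | i) <;> rfl))

theorem hasEig_schurForm {b c : ℝ} (hb : b ≠ 0) {Z : Matrix p q ℂ} {z : ℝ} {ψ₁ : p → ℂ}
    {ψ₂ : q → ℂ} (h0 : ψ₁ ≠ 0 ∨ ψ₂ ≠ 0)
    (h1 : ((z : ℂ) / b) • (Z *ᵥ ψ₂) = ((z : ℂ) - c) • ψ₁)
    (h2 : Zᴴ *ᵥ ψ₁ = ((z : ℂ) - b) • ψ₂) : HasEig (schurForm b c Z) z := by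
  refine ⟨Sum.elim ψ₁ ψ₂, ?_, (schurForm_eigen_iff hb Z z ψ₁ ψ₂).2 ⟨h1, h2⟩⟩
  intro h
  rcases h0 with h0 | h0
  · exact h0 (funext fun i => congrFun h (Sum.inl i))
  · exact h0 (funext fun i => congrFun h (Sum.inr i))

/-- The squared length of a complex vector. -/
def normSqVec {m : Type*} [Fintype m] (ψ : m → ℂ) : ℝ := ∑ i, Complex.normSq (ψ i)

theorem star_dotProduct_self {m : Type*} [Fintype m] (ψ : m → ℂ) :
    star ψ ⬝ᵥ ψ = (normSqVec ψ : ℂ) := by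
  simp [normSqVec, dotProduct, Complex.normSq_eq_conj_mul_self]

theorem normSqVec_nonneg {m : Type*} [Fintype m] (ψ : m → ℂ) : 0 ≤ normSqVec ψ :=
  Finset.sum_nonneg fun _ _ => Complex.normSq_nonneg _

theorem normSqVec_eq_zero {m : Type*} [Fintype m] {ψ : m → ℂ} : normSqVec ψ = 0 ↔ ψ = 0 := by
  rw [normSqVec, Finset.sum_eq_zero_iff_of_nonneg fun _ _ => Complex.normSq_nonneg _]
  simp [funext_iff]

theorem normSqVec_pos {m : Type*} [Fintype m] {ψ : m → ℂ} (h : ψ ≠ 0) : 0 < normSqVec ψ :=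
  (normSqVec_nonneg ψ).lt_of_ne fun h' => h (normSqVec_eq_zero.1 h'.symm)

theorem star_dotProduct_conjTranspose_mul {m k : Type*} [Fintype m] [Fintype k]
    (Z : Matrix m k ℂ) (φ : k → ℂ) :
    star φ ⬝ᵥ (Zᴴ *ᵥ (Z *ᵥ φ)) = (normSqVec (Z *ᵥ φ) : ℂ) := by
  rw [← star_dotProduct_self, Matrix.dotProduct_mulVec, Matrix.star_mulVec]

/-- Apply `Zᴴ` to the first equation, eliminate `Zᴴ ψ₁` by the second, and pair with `ψ₂`. -/
theorem schurForm_eigen_norm {b c : ℝ} {Z : Matrix p q ℂ} {z : ℝ} {ψ₁ : p → ℂ} {ψ₂ : q → ℂ}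
    (h1 : ((z : ℂ) / b) • (Z *ᵥ ψ₂) = ((z : ℂ) - c) • ψ₁)
    (h2 : Zᴴ *ᵥ ψ₁ = ((z : ℂ) - b) • ψ₂) :
    z / b * normSqVec (Z *ᵥ ψ₂) = (z - c) * (z - b) * normSqVec ψ₂ := by
  have h3 := congrArg (fun φ => star ψ₂ ⬝ᵥ (Zᴴ *ᵥ φ)) h1
  simp only [Matrix.mulVec_smul, h2, dotProduct_smul, star_dotProduct_conjTranspose_mul,
    star_dotProduct_self, smul_eq_mul] at h3
  have h4 : ((z / b * normSqVec (Z *ᵥ ψ₂) : ℝ) : ℂ) =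
      ((z - c) * (z - b) * normSqVec ψ₂ : ℝ) := by
    push_cast
    rw [h3]
    ring
  exact_mod_cast h4

/-- No positive eigenvalue lies strictly between `b` and `c`: this is the sign of the norm identity
if `ψ₂ ≠ 0`, while `ψ₂ = 0` forces `z = c`. -/
theorem HasEig.schurForm_nonneg {b c : ℝ} (hb : 0 < b) {Z : Matrix p q ℂ} {z : ℝ} (hz : 0 < z)
    (h : HasEig (schurForm b c Z) z) : 0 ≤ (z - c) * (z - b) := by
  obtain ⟨ψ₁, ψ₂, h0, h1, h2⟩ := h.exists_schurForm hb.ne'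
  by_cases hψ : ψ₂ = 0
  · have hψ₁ : ψ₁ ≠ 0 := h0.resolve_right fun h => h hψ
    rw [hψ, Matrix.mulVec_zero, smul_zero] at h1
    have : (z : ℂ) - c = 0 := (smul_eq_zero.1 h1.symm).resolve_right hψ₁
    have : z - c = 0 := by exact_mod_cast this
    rw [this, zero_mul]
  · have e := schurForm_eigen_norm h1 h2
    have hpos := normSqVec_pos hψ
    have : 0 ≤ (z - c) * (z - b) * normSqVec ψ₂ := by
      rw [← e]
      exact mul_nonneg (div_pos hz hb).le (normSqVec_nonneg _)
    exact nonneg_of_mul_nonneg_left this hpos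

theorem HasEig.schurForm_pos {b c : ℝ} (hb : 0 < b) {Z : Matrix p q ℂ} {z : ℝ} (hz : 0 < z)
    (h : HasEig (schurForm b c Z) z) (hZ : ∀ ψ, Z *ᵥ ψ = 0 → ψ = 0)
    (hZ' : ∀ ψ, Zᴴ *ᵥ ψ = 0 → ψ = 0) : 0 < (z - c) * (z - b) := by
  obtain ⟨ψ₁, ψ₂, h0, h1, h2⟩ := h.exists_schurForm hb.ne'
  by_cases hψ : ψ₂ = 0
  · rw [hψ, smul_zero] at h2
    exact absurd (hZ' _ h2) (h0.resolve_right fun h => h hψ)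
  · have e := schurForm_eigen_norm h1 h2
    have hpos := normSqVec_pos hψ
    have : 0 < (z - c) * (z - b) * normSqVec ψ₂ := by
      rw [← e]
      exact mul_pos (div_pos hz hb) (normSqVec_pos fun h => hψ (hZ _ h))
    exact pos_of_mul_pos_left this hpos.le

theorem exists_mulVec_eq_zero_of_card_lt (Z : Matrix p q ℂ) (h : Fintype.card p < Fintype.card q) :
    ∃ ψ : q → ℂ, ψ ≠ 0 ∧ Z *ᵥ ψ = 0 := by
  have : Module.finrank ℂ (p → ℂ) < Module.finrank ℂ (q → ℂ) := by simpa using h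
  obtain ⟨ψ, hψ, h0⟩ := (Submodule.ne_bot_iff _).1
    (LinearMap.ker_ne_bot_of_finrank_lt (f := Z.mulVecLin) this)
  exact ⟨ψ, h0, hψ⟩

theorem hasEig_schurForm_right {b c : ℝ} (hb : b ≠ 0) (Z : Matrix p q ℂ) {ψ : q → ℂ} (hψ : ψ ≠ 0)
    (h : Z *ᵥ ψ = 0) : HasEig (schurForm b c Z) b :=
  hasEig_schurForm (ψ₁ := 0) hb (Or.inr hψ) (by simp [h]) (by simp)

theorem hasEig_schurForm_left {b c : ℝ} (hb : b ≠ 0) (Z : Matrix p q ℂ) {ψ : p → ℂ} (hψ : ψ ≠ 0)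
    (h : Zᴴ *ᵥ ψ = 0) : HasEig (schurForm b c Z) c :=
  hasEig_schurForm (ψ₂ := 0) hb (Or.inl hψ) (by simp) (by simp [h])

/-- If the two blocks have the same size, the spectrum is symmetric under `z ↦ bc/z`. -/
theorem HasEig.schurForm_symm {b c : ℝ} (hb : b ≠ 0) (hc : c ≠ 0) {Z : Matrix p q ℂ} {z : ℝ}
    (hz : z ≠ 0) (hpq : Fintype.card p = Fintype.card q) (h : HasEig (schurForm b c Z) z) :
    HasEig (schurForm b c Z) (b * c / z) := by
  -- The reflection exchanges the exceptional eigenvalues `b` and `c`, whose eigenvectors come from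
  -- the kernels of `Z` and `Zᴴ`. For equal block sizes these kernels are nonzero simultaneously,
  -- the determinants being conjugate.
  have hsq : (∃ ψ, ψ ≠ 0 ∧ Z *ᵥ ψ = 0) ↔ ∃ ψ, ψ ≠ 0 ∧ Zᴴ *ᵥ ψ = 0 := by
    let e := Fintype.equivOfCardEq hpq
    have h1 : ∀ (X : Matrix p q ℂ), (∃ ψ, ψ ≠ 0 ∧ X *ᵥ ψ = 0) ↔ (X.submatrix id e).det = 0 := by
      intro X
      rw [← Matrix.exists_mulVec_eq_zero_iff]
      constructor
      · rintro ⟨ψ, h0, hψ⟩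
        refine ⟨ψ ∘ e, fun h => h0 (funext fun i => ?_), ?_⟩
        · simpa using congrFun h (e.symm i)
        · rw [Matrix.submatrix_mulVec_equiv]
          simp [Function.comp_assoc, hψ]
      · rintro ⟨ψ, h0, hψ⟩
        refine ⟨ψ ∘ e.symm, fun h => h0 (funext fun i => ?_), ?_⟩
        · simpa using congrFun h (e i)
        · rw [Matrix.submatrix_mulVec_equiv] at hψ
          simpa using hψ
    have h2 : ∀ (X : Matrix q p ℂ), (∃ ψ, ψ ≠ 0 ∧ X *ᵥ ψ = 0) ↔ (X.submatrix e id).det = 0 := by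
      intro X
      rw [← Matrix.exists_mulVec_eq_zero_iff]
      constructor
      · rintro ⟨ψ, h0, hψ⟩
        exact ⟨ψ, h0, funext fun i => congrFun hψ (e i)⟩
      · rintro ⟨ψ, h0, hψ⟩
        refine ⟨ψ, h0, funext fun i => ?_⟩
        simpa [Matrix.mulVec] using congrFun hψ (e.symm i)
    rw [h1, h2, ← star_eq_zero, ← Matrix.det_conjTranspose, Matrix.conjTranspose_submatrix]
  obtain ⟨ψ₁, ψ₂, h0, h1, h2⟩ := h.exists_schurForm hb
  have hb' : (b : ℂ) ≠ 0 := by exact_mod_cast hb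
  have hc' : (c : ℂ) ≠ 0 := by exact_mod_cast hc
  have hz' : (z : ℂ) ≠ 0 := by exact_mod_cast hz
  by_cases hzb : z = b
  · subst hzb
    have e : z * c / z = c := by field_simp
    rw [e]
    obtain ⟨ψ, hψ, hψ'⟩ : ∃ ψ, ψ ≠ 0 ∧ Zᴴ *ᵥ ψ = 0 := by
      rw [sub_self, zero_smul] at h2
      by_cases h : ψ₁ = 0
      · refine hsq.1 ⟨ψ₂, h0.resolve_left fun h' => h' h, ?_⟩
        rw [h, smul_zero, div_self hb', one_smul] at h1
        exact h1
      · exact ⟨ψ₁, h, h2⟩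
    exact hasEig_schurForm_left hb Z hψ hψ'
  by_cases hψ : ψ₂ = 0
  · have hψ₁ : ψ₁ ≠ 0 := h0.resolve_right fun h => h hψ
    rw [hψ, Matrix.mulVec_zero, smul_zero] at h1
    have hzc : (z : ℂ) - c = 0 := (smul_eq_zero.1 h1.symm).resolve_right hψ₁
    have hzc : z = c := by
      have : z - c = 0 := by exact_mod_cast hzc
      linarith
    subst hzc
    have e : b * z / z = b := by field_simp
    rw [e]
    rw [hψ, smul_zero] at h2
    obtain ⟨ψ, hψ, hψ'⟩ := hsq.2 ⟨ψ₁, hψ₁, h2⟩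
    exact hasEig_schurForm_right hb Z hψ hψ'
  · have hzb' : (z : ℂ) - b ≠ 0 := by
      rw [sub_ne_zero]; exact_mod_cast hzb
    have hne : (b : ℂ) * c / z - c ≠ 0 := by
      rw [sub_ne_zero]
      intro h
      apply hzb'
      field_simp at h
      rw [h, sub_self]
    -- The vector `ψ₂` is kept, and `ψ₁` is chosen to solve the first equation at `bc/z`, where
    -- `(bc/z)/b = c/z`; the second equation then holds automatically.
    refine hasEig_schurForm hb (ψ₁ := (((b * c / z : ℂ) - c)⁻¹ * (c / z)) • (Z *ᵥ ψ₂)) (ψ₂ := ψ₂)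
      (Or.inr hψ) ?_ ?_
    · push_cast
      rw [smul_smul, ← mul_assoc, mul_inv_cancel₀ hne, one_mul]
      congr 1
      field_simp
    · push_cast
      have h3 := congrArg (fun φ => ((b : ℂ) / z) • (Zᴴ *ᵥ φ)) h1
      simp only [Matrix.mulVec_smul, h2, smul_smul] at h3
      have e : (b : ℂ) / z * (z / b) = 1 := by field_simp
      rw [e, one_smul] at h3
      rw [Matrix.mulVec_smul, h3, smul_smul]
      congr 1
      have : (b : ℂ) - z ≠ 0 := by rw [← neg_sub]; exact neg_ne_zero.2 hzb'
      have e2 : (b : ℂ) * c / z - c = c * (b - z) / z := by field_simp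
      rw [e2]
      field_simp
      ring

end SchurForm

/-! ### Rectangular block matrices with prescribed blocks of `K K†`, `K† K` and their inverses -/

section ScaleArithmetic

theorem mul_sub_nonneg_of_exp {t s r : ℝ}
    (h : 0 ≤ (Real.exp t - Real.exp s) * (Real.exp t - Real.exp r)) : 0 ≤ (t - s) * (t - r) := by
  by_contra hneg
  rcases mul_neg_iff.1 (not_le.1 hneg) with ⟨h1, h2⟩ | ⟨h1, h2⟩
  · have e1 := Real.exp_lt_exp.2 (sub_pos.1 h1)
    have e2 := Real.exp_lt_exp.2 (sub_neg.1 h2)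
    exact absurd h (not_le.2 (mul_neg_of_pos_of_neg (sub_pos.2 e1) (sub_neg.2 e2)))
  · have e1 := Real.exp_lt_exp.2 (sub_neg.1 h1)
    have e2 := Real.exp_lt_exp.2 (sub_pos.1 h2)
    exact absurd h (not_le.2 (mul_neg_of_neg_of_pos (sub_neg.2 e1) (sub_pos.2 e2)))

variable {α β γ : ℝ} {p q r s : ℕ} {E : ℝ → Prop}

/-- Here `E t` stands for `exp t` being an eigenvalue of `K K†`, and both blocks of rows have size
`p`. If `s < r`, then `α` and its reflection `β + γ - α` are in the spectrum; `h2` and the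
determinant identity `h6` leave only `β + γ = 2α`, and then `h1` at `α` reads `-(β - α)² ≥ 0`. The
case `r < s` is the same with `-α` in place of `α`, and `r = s` gives `β + γ = 0`. -/
theorem scales_false_of_left_balanced (hα : α < 0) (hβ : β ≠ α) (hβ' : β ≠ -α) (hx : β + γ ≠ 0)
    (h1 : ∀ t, E t → 0 ≤ (t - γ) * (t - β)) (h2 : ∀ t, E t → 0 ≤ (t - α) * (t - -α))
    (h3 : s < r → E α) (h4 : r < s → E (-α)) (h5 : ∀ t, E t → E (β + γ - t))
    (h6 : p * γ + p * β = (r - s) * α) (h7 : p + p = r + s) (h8 : 0 < p) : False := by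
  have hp : (0 : ℝ) < p := by exact_mod_cast h8
  have h7' : (p : ℝ) + p = r + s := by exact_mod_cast h7
  have hr : (0 : ℝ) ≤ r := Nat.cast_nonneg r
  have hs : (0 : ℝ) ≤ s := Nat.cast_nonneg s
  rcases lt_trichotomy s r with h | h | h
  · have e1 := h3 h
    have e2 := h2 _ (h5 _ e1)
    have h' : (s : ℝ) < r := by exact_mod_cast h
    have hx' : β + γ < 0 := by
      have : p * (β + γ) < 0 := by nlinarith
      by_contra hc
      exact absurd this (not_lt.2 (mul_nonneg hp.le (not_lt.1 hc)))
    have e3 : β + γ - α - α ≤ 0 := by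
      have : (β + γ - α - α) * (β + γ) ≥ 0 := by linarith
      exact nonpos_of_mul_nonneg_left this hx'
    have e4 : p * (β + γ - α - α) = -(2 * s * α) := by linear_combination h6 - α * h7'
    have e5 : (s : ℝ) * α = 0 := by nlinarith
    have e6 : β + γ - α - α = 0 := by
      have : p * (β + γ - α - α) = 0 := by rw [e4, mul_assoc, e5]; ring
      exact (mul_eq_zero.1 this).resolve_left hp.ne'
    have e7 := h1 _ e1
    have : (α - γ) * (α - β) = -(β - α) ^ 2 := by
      have : γ = α + α - β := by linarith
      rw [this]; ring
    have := pow_pos (abs_pos.2 (sub_ne_zero.2 hβ)) 2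
    rw [sq_abs] at this
    linarith
  · rw [h, sub_self, zero_mul] at h6
    exact hx ((mul_eq_zero.1 (by linarith : (p : ℝ) * (β + γ) = 0)).resolve_left hp.ne')
  · have e1 := h4 h
    have e2 := h2 _ (h5 _ e1)
    have h' : (r : ℝ) < s := by exact_mod_cast h
    have hx' : 0 < β + γ := by
      have : 0 < p * (β + γ) := by nlinarith
      exact (pos_iff_pos_of_mul_pos this).1 hp
    have e3 : 0 ≤ β + γ + α + α := by
      have : 0 ≤ (β + γ) * (β + γ + α + α) := by linarith
      exact nonneg_of_mul_nonneg_right this hx'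
    have e4 : p * (β + γ + α + α) = 2 * r * α := by linear_combination h6 + α * h7'
    have e5 : (r : ℝ) * α = 0 := by nlinarith
    have e6 : β + γ + α + α = 0 := by
      have : p * (β + γ + α + α) = 0 := by rw [e4, mul_assoc, e5]; ring
      exact (mul_eq_zero.1 this).resolve_left hp.ne'
    have e7 := h1 _ e1
    have : (-α - γ) * (-α - β) = -(β - -α) ^ 2 := by
      have : γ = -α - α - β := by linarith
      rw [this]; ring
    have := pow_pos (abs_pos.2 (sub_ne_zero.2 hβ')) 2
    rw [sq_abs] at this
    linarith

/-- Now the spectrum is symmetric under `t ↦ -t`. If `q < p`, then `±γ` are in it; multiplying `h6`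
by `γ` and using `h1` at `-γ` forces `γ = 0`, excluded by `h2`. If `p < q`, then `h1` at `-β` gives
`β + γ ≥ 0`, so the left side of `h6` is positive. If `p = q`, then `β + γ = 0`. -/
theorem scales_false_of_right_balanced (hβ : 0 < β) (hx : β + γ ≠ 0)
    (h1 : ∀ t, E t → 0 ≤ (t - γ) * (t - β)) (h2 : ¬ E 0)
    (h3 : q < p → E γ) (h4 : p < q → E β) (h5 : ∀ t, E t → E (-t))
    (h6 : p * γ + q * β = 0) (h7 : 0 < p + q) : False := by
  have hp0 : (0 : ℝ) ≤ p := Nat.cast_nonneg p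
  have hq0 : (0 : ℝ) ≤ q := Nat.cast_nonneg q
  rcases lt_trichotomy q p with h | h | h
  · have e1 := h3 h
    have e2 := h1 _ (h5 _ e1)
    have h' : (q : ℝ) < p := by exact_mod_cast h
    have e3 : 0 ≤ q * (γ * (γ + β)) := mul_nonneg hq0 (by linarith)
    have e4 : q * (γ * (γ + β)) = -((p - q) * γ ^ 2) := by linear_combination γ * h6
    have e5 : (p - q) * γ ^ 2 ≤ 0 := by linarith
    have e6 : γ ^ 2 ≤ 0 := by
      by_contra hc
      exact absurd e5 (not_le.2 (mul_pos (sub_pos.2 h') (not_le.1 hc)))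
    have e7 : γ = 0 := pow_eq_zero_iff two_ne_zero |>.1 (le_antisymm e6 (sq_nonneg _))
    exact h2 (e7 ▸ e1)
  · have hp : (p : ℝ) ≠ 0 := by
      have : p ≠ 0 := by omega
      exact_mod_cast this
    rw [h] at h6
    exact hx ((mul_eq_zero.1 (by linarith : (p : ℝ) * (β + γ) = 0)).resolve_left hp)
  · have e1 := h4 h
    have e2 := h1 _ (h5 _ e1)
    have h' : (p : ℝ) < q := by exact_mod_cast h
    have e3 : 0 ≤ β + γ := by
      have : 0 ≤ (β + γ) * (2 * β) := by linarith
      exact nonneg_of_mul_nonneg_left this (by linarith)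
    have e4 : p * (β + γ) + (q - p) * β = 0 := by linarith
    have e5 := mul_nonneg hp0 e3
    have e6 := mul_pos (sub_pos.2 h') hβ
    linarith

end ScaleArithmetic

/-! ### Compressed block matrices and their spectra -/

section Pair

variable {p q r s : Type*} [Fintype p] [Fintype q] [Fintype r] [Fintype s]
  [DecidableEq p] [DecidableEq q] [DecidableEq r] [DecidableEq s]

/-- An invertible block matrix with scalar prescribed blocks. -/
structure IsScalarPair (a b c : ℝ) (K : Matrix (p ⊕ q) (r ⊕ s) ℂ) (Ki : Matrix (r ⊕ s) (p ⊕ q) ℂ) :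
    Prop where
  mul_eq : K * Ki = 1
  inv_mul : Ki * K = 1
  left22 : (K * Kᴴ).toBlocks₂₂ = (b : ℂ) • 1
  left11 : (Kiᴴ * Ki).toBlocks₁₁ = (c : ℂ)⁻¹ • 1
  right11 : (Kᴴ * K).toBlocks₁₁ = (a : ℂ) • 1
  right22 : (Ki * Kiᴴ).toBlocks₂₂ = (a : ℂ) • 1

variable {a b c : ℝ} {K : Matrix (p ⊕ q) (r ⊕ s) ℂ} {Ki : Matrix (r ⊕ s) (p ⊕ q) ℂ}

theorem adjoint_mul_of_inv {m k : Type*} [Fintype m] [Fintype k] [DecidableEq m] [DecidableEq k]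
    {K : Matrix m k ℂ} {Ki : Matrix k m ℂ} (h : K * Ki = 1) (h' : Ki * K = 1) :
    (Kiᴴ * Ki) * (K * Kᴴ) = 1 := by
  calc Kiᴴ * Ki * (K * Kᴴ) = Kiᴴ * (Ki * K) * Kᴴ := by simp only [Matrix.mul_assoc]
    _ = (K * Ki)ᴴ := by rw [h', Matrix.mul_one, Matrix.conjTranspose_mul]
    _ = 1 := by rw [h, Matrix.conjTranspose_one]

theorem IsScalarPair.left_eq (h : IsScalarPair a b c K Ki) (hb : b ≠ 0) (hc : c ≠ 0) :
    K * Kᴴ = schurForm b c (K * Kᴴ).toBlocks₁₂ :=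
  eq_schurForm hb hc (by rw [Matrix.conjTranspose_mul, Matrix.conjTranspose_conjTranspose])
    (adjoint_mul_of_inv h.mul_eq h.inv_mul) h.left22 h.left11

theorem right_eq_schurForm (h : K * Ki = 1) (h' : Ki * K = 1) (ha : a ≠ 0)
    (right11 : (Kᴴ * K).toBlocks₁₁ = (a : ℂ) • 1) (right22 : (Ki * Kiᴴ).toBlocks₂₂ = (a : ℂ) • 1) :
    Ki * Kiᴴ = schurForm a a⁻¹ (Ki * Kiᴴ).toBlocks₁₂ :=
  eq_schurForm ha (inv_ne_zero ha)
    (by rw [Matrix.conjTranspose_mul, Matrix.conjTranspose_conjTranspose])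
    (adjoint_mul_of_inv h' h) right22 (by rw [right11]; simp)

theorem IsScalarPair.right_eq (h : IsScalarPair a b c K Ki) (ha : a ≠ 0) :
    Ki * Kiᴴ = schurForm a a⁻¹ (Ki * Kiᴴ).toBlocks₁₂ :=
  right_eq_schurForm h.mul_eq h.inv_mul ha h.right11 h.right22

/-- `Ki * Kiᴴ` is the inverse of `Kᴴ * K`, and `Kᴴ` carries eigenvectors of `K * Kᴴ` to eigenvectors
of `Kᴴ * K`. -/
theorem hasEig_inv_of_hasEig {m k : Type*} [Fintype m] [Fintype k] [DecidableEq m] [DecidableEq k]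
    {K : Matrix m k ℂ} {Ki : Matrix k m ℂ} (h : K * Ki = 1) (h' : Ki * K = 1) {z : ℝ} (hz : z ≠ 0)
    (hE : HasEig (K * Kᴴ) z) : HasEig (Ki * Kiᴴ) z⁻¹ := by
  obtain ⟨ψ, h0, hψ⟩ := hE
  have e : Ki * Kiᴴ * Kᴴ * (K * Kᴴ) = Kᴴ := by
    calc Ki * Kiᴴ * Kᴴ * (K * Kᴴ) = Ki * (K * Ki)ᴴ * K * Kᴴ := by
          simp only [Matrix.conjTranspose_mul, Matrix.mul_assoc]
      _ = Kᴴ := by rw [h, Matrix.conjTranspose_one, Matrix.mul_one, h', Matrix.one_mul]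
  have hz' : (z : ℂ) ≠ 0 := by exact_mod_cast hz
  refine ⟨Kᴴ *ᵥ ψ, fun h1 => h0 ?_, ?_⟩
  · have : Kiᴴ *ᵥ (Kᴴ *ᵥ ψ) = ψ := by
      rw [Matrix.mulVec_mulVec, ← Matrix.conjTranspose_mul, h, Matrix.conjTranspose_one,
        Matrix.one_mulVec]
    rw [← this, h1, Matrix.mulVec_zero]
  · have h2 := congrArg (fun φ => (Ki * Kiᴴ * Kᴴ) *ᵥ φ) hψ
    simp only [Matrix.mulVec_smul] at h2
    rw [Matrix.mulVec_mulVec, e] at h2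
    rw [Matrix.mulVec_mulVec, h2, smul_smul, Complex.ofReal_inv, inv_mul_cancel₀ hz', one_smul]

theorem hasEig_of_hasEig_inv {m k : Type*} [Fintype m] [Fintype k] [DecidableEq m] [DecidableEq k]
    {K : Matrix m k ℂ} {Ki : Matrix k m ℂ} (h : K * Ki = 1) (h' : Ki * K = 1) {z : ℝ} (hz : z ≠ 0)
    (hE : HasEig (Ki * Kiᴴ) z) : HasEig (K * Kᴴ) z⁻¹ :=
  hasEig_inv_of_hasEig h' h hz hE

theorem IsScalarPair.det_eq (h : IsScalarPair a b c K Ki) (ha : a ≠ 0) (hb : b ≠ 0) (hc : c ≠ 0) :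
    c ^ Fintype.card p * b ^ Fintype.card q * (a⁻¹ ^ Fintype.card r * a ^ Fintype.card s) = 1 := by
  have e1 : (K * Kᴴ).det * (Ki * Kiᴴ).det = 1 := by
    -- Rows and columns of `K` have different index types, so `K` has no determinant of its own;
    -- instead the two Gram matrices are conjugate by `K`.
    have : (K * Kᴴ).det = (Kᴴ * K).det := by
      have e : Ki * (K * Kᴴ) * K = Kᴴ * K := by
        rw [← Matrix.mul_assoc Ki, h.inv_mul, Matrix.one_mul]
      rw [← e, Matrix.mul_assoc, Matrix.det_comm' h.inv_mul h.mul_eq, Matrix.mul_assoc, h.mul_eq, Matrix.mul_one]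
    rw [this, ← Matrix.det_mul]
    have := adjoint_mul_of_inv h.inv_mul h.mul_eq
    rw [this, Matrix.det_one]
  rw [h.left_eq hb hc, h.right_eq ha, det_schurForm hb, det_schurForm ha] at e1
  exact_mod_cast e1

theorem IsScalarPair.card_eq (h : IsScalarPair a b c K Ki) :
    Fintype.card p + Fintype.card q = Fintype.card r + Fintype.card s := by
  rw [← Fintype.card_sum, ← Fintype.card_sum]
  refine le_antisymm ?_ ?_
  · by_contra hlt
    obtain ⟨ψ, h0, hψ⟩ := exists_mulVec_eq_zero_of_card_lt Ki (not_le.1 hlt)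
    apply h0
    rw [← Matrix.one_mulVec ψ, ← h.mul_eq, ← Matrix.mulVec_mulVec, hψ, Matrix.mulVec_zero]
  · by_contra hlt
    obtain ⟨ψ, h0, hψ⟩ := exists_mulVec_eq_zero_of_card_lt K (not_le.1 hlt)
    apply h0
    rw [← Matrix.one_mulVec ψ, ← h.inv_mul, ← Matrix.mulVec_mulVec, hψ, Matrix.mulVec_zero]

theorem card_eq_of_injective {Z : Matrix p q ℂ} (hZ : ∀ ψ, Z *ᵥ ψ = 0 → ψ = 0)
    (hZ' : ∀ ψ, Zᴴ *ᵥ ψ = 0 → ψ = 0) : Fintype.card p = Fintype.card q := by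
  refine le_antisymm ?_ ?_
  · by_contra hlt
    obtain ⟨ψ, h0, hψ⟩ := exists_mulVec_eq_zero_of_card_lt Zᴴ (not_le.1 hlt)
    exact h0 (hZ' _ hψ)
  · by_contra hlt
    obtain ⟨ψ, h0, hψ⟩ := exists_mulVec_eq_zero_of_card_lt Z (not_le.1 hlt)
    exact h0 (hZ _ hψ)

theorem hasEig_schurForm_of_card_lt_left {b c : ℝ} (hb : b ≠ 0) (Z : Matrix p q ℂ)
    (h : Fintype.card q < Fintype.card p) : HasEig (schurForm b c Z) c := by
  obtain ⟨ψ, h0, hψ⟩ := exists_mulVec_eq_zero_of_card_lt Zᴴ h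
  exact hasEig_schurForm_left hb Z h0 hψ

theorem hasEig_schurForm_of_card_lt_right {b c : ℝ} (hb : b ≠ 0) (Z : Matrix p q ℂ)
    (h : Fintype.card p < Fintype.card q) : HasEig (schurForm b c Z) b := by
  obtain ⟨ψ, h0, hψ⟩ := exists_mulVec_eq_zero_of_card_lt Z h
  exact hasEig_schurForm_right hb Z h0 hψ

variable {α β γ : ℝ}

theorem IsScalarPair.log_det_eq
    (h : IsScalarPair (Real.exp α) (Real.exp β) (Real.exp γ) K Ki) :
    Fintype.card p * γ + Fintype.card q * β = (Fintype.card r - Fintype.card s) * α := by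
  have := h.det_eq (Real.exp_ne_zero _) (Real.exp_ne_zero _) (Real.exp_ne_zero _)
  rw [← Real.exp_neg, ← Real.exp_nat_mul, ← Real.exp_nat_mul, ← Real.exp_nat_mul,
    ← Real.exp_nat_mul, ← Real.exp_add, ← Real.exp_add, ← Real.exp_add, Real.exp_eq_one_iff] at this
  linarith

theorem IsScalarPair.left_scale
    (h : IsScalarPair (Real.exp α) (Real.exp β) (Real.exp γ) K Ki) {t : ℝ}
    (ht : HasEig (K * Kᴴ) (Real.exp t)) : 0 ≤ (t - γ) * (t - β) := by
  rw [h.left_eq (Real.exp_ne_zero _) (Real.exp_ne_zero _)] at ht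
  exact mul_sub_nonneg_of_exp (ht.schurForm_nonneg (Real.exp_pos _) (Real.exp_pos _))

theorem right_scale (h : K * Ki = 1) (h' : Ki * K = 1)
    (right11 : (Kᴴ * K).toBlocks₁₁ = (Real.exp α : ℂ) • 1)
    (right22 : (Ki * Kiᴴ).toBlocks₂₂ = (Real.exp α : ℂ) • 1) {t : ℝ}
    (ht : HasEig (K * Kᴴ) (Real.exp t)) : 0 ≤ (t - α) * (t - -α) := by
  have e := hasEig_inv_of_hasEig h h' (Real.exp_ne_zero _) ht
  rw [right_eq_schurForm (a := Real.exp α) h h' (Real.exp_ne_zero _) right11 right22,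
    ← Real.exp_neg, ← Real.exp_neg] at e
  have := mul_sub_nonneg_of_exp (e.schurForm_nonneg (Real.exp_pos _) (Real.exp_pos _))
  linarith

/-- An off-diagonal block of `K Kᴴ` injective on both sides is square, so `p = q` and the spectrum
is symmetric under `z ↦ bc/z`. If `r` and `s` differ, an off-diagonal kernel of `Ki Kiᴴ` puts `α` or
`-α` among the logarithms of the spectrum of `K Kᴴ`. -/
theorem IsScalarPair.false_of_left_injective
    (h : IsScalarPair (Real.exp α) (Real.exp β) (Real.exp γ) K Ki)
    (hα : α < 0) (hβ : β ≠ α) (hβ' : β ≠ -α) (hx : β + γ ≠ 0)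
    (hZ : ∀ ψ, (K * Kᴴ).toBlocks₁₂ *ᵥ ψ = 0 → ψ = 0)
    (hZ' : ∀ ψ, (K * Kᴴ).toBlocks₁₂ᴴ *ᵥ ψ = 0 → ψ = 0)
    (hpos : 0 < Fintype.card p + Fintype.card q) : False := by
  have hc := card_eq_of_injective hZ hZ'
  have hl := h.left_eq (Real.exp_ne_zero _) (Real.exp_ne_zero _)
  have hr := h.right_eq (Real.exp_ne_zero _)
  have hdet := h.log_det_eq
  have hcard := h.card_eq
  rw [← hc] at hdet hcard
  refine scales_false_of_left_balanced (E := fun t => HasEig (K * Kᴴ) (Real.exp t))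
    hα hβ hβ' hx (fun t => h.left_scale)
    (fun t => right_scale h.mul_eq h.inv_mul h.right11 h.right22) (fun hlt => ?_) (fun hlt => ?_)
    (fun t ht => ?_) hdet hcard (by omega)
  · have := hasEig_schurForm_of_card_lt_left (b := Real.exp α) (c := (Real.exp α)⁻¹)
      (Real.exp_ne_zero _) (Ki * Kiᴴ).toBlocks₁₂ hlt
    rw [← hr] at this
    have := hasEig_of_hasEig_inv h.mul_eq h.inv_mul (inv_ne_zero (Real.exp_ne_zero _)) this
    rwa [inv_inv] at this
  · have := hasEig_schurForm_of_card_lt_right (b := Real.exp α) (c := (Real.exp α)⁻¹)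
      (Real.exp_ne_zero _) (Ki * Kiᴴ).toBlocks₁₂ hlt
    rw [← hr] at this
    have := hasEig_of_hasEig_inv h.mul_eq h.inv_mul (Real.exp_ne_zero _) this
    rwa [← Real.exp_neg] at this
  · rw [hl] at ht ⊢
    have := ht.schurForm_symm (Real.exp_ne_zero _) (Real.exp_ne_zero _) (Real.exp_ne_zero _) hc
    rwa [← Real.exp_add, ← Real.exp_sub] at this

/-- Here the off-diagonal block of `Ki Kiᴴ` is square, whence `r = s` and a spectrum symmetric under
`z ↦ 1/z`. Injectivity also makes the spectral inequality strict, which excludes the eigenvalue `1`.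
-/
theorem IsScalarPair.false_of_right_injective
    (h : IsScalarPair (Real.exp α) (Real.exp β) (Real.exp γ) K Ki)
    (hβ : 0 < β) (hx : β + γ ≠ 0)
    (hZ : ∀ ψ, (Ki * Kiᴴ).toBlocks₁₂ *ᵥ ψ = 0 → ψ = 0)
    (hZ' : ∀ ψ, (Ki * Kiᴴ).toBlocks₁₂ᴴ *ᵥ ψ = 0 → ψ = 0)
    (hpos : 0 < Fintype.card p + Fintype.card q) : False := by
  have hc := card_eq_of_injective hZ hZ'
  have hl := h.left_eq (Real.exp_ne_zero _) (Real.exp_ne_zero _)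
  have hr := h.right_eq (Real.exp_ne_zero _)
  have hdet := h.log_det_eq
  rw [← hc, sub_self, zero_mul] at hdet
  refine scales_false_of_right_balanced (E := fun t => HasEig (K * Kᴴ) (Real.exp t))
    hβ hx (fun t => h.left_scale) (fun h0 => ?_) (fun hlt => ?_) (fun hlt => ?_)
    (fun t ht => ?_) hdet hpos
  · have e := hasEig_inv_of_hasEig h.mul_eq h.inv_mul (Real.exp_ne_zero _) h0
    rw [hr, Real.exp_zero, inv_one] at e
    have e' := e.schurForm_pos (Real.exp_pos _) one_pos hZ hZ'
    have ha := Real.exp_pos α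
    -- The number `1` always lies between `a` and `a⁻¹`, contrary to the strict inequality.
    have : (1 - (Real.exp α)⁻¹) * (1 - Real.exp α) = -((1 - Real.exp α) ^ 2 * (Real.exp α)⁻¹) := by
      field_simp
      ring
    rw [this] at e'
    have := mul_nonneg (sq_nonneg (1 - Real.exp α)) (inv_pos.2 ha).le
    linarith
  · have := hasEig_schurForm_of_card_lt_left (b := Real.exp β) (c := Real.exp γ)
      (Real.exp_ne_zero _) (K * Kᴴ).toBlocks₁₂ hlt
    rwa [← hl] at this
  · have := hasEig_schurForm_of_card_lt_right (b := Real.exp β) (c := Real.exp γ)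
      (Real.exp_ne_zero _) (K * Kᴴ).toBlocks₁₂ hlt
    rwa [← hl] at this
  · have e := hasEig_inv_of_hasEig h.mul_eq h.inv_mul (Real.exp_ne_zero _) ht
    rw [hr] at e
    have := e.schurForm_symm (Real.exp_ne_zero _) (inv_ne_zero (Real.exp_ne_zero _))
      (inv_ne_zero (Real.exp_ne_zero _)) hc
    rw [← hr, mul_inv_cancel₀ (Real.exp_ne_zero _), one_div, inv_inv] at this
    have := hasEig_of_hasEig_inv h.mul_eq h.inv_mul (Real.exp_ne_zero _) this
    rwa [← Real.exp_neg] at this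

end Pair

/-! ### Eigenspaces of block diagonal Hermitian matrices -/

section Eigenspaces

variable {m k : Type} [Fintype m] [DecidableEq m] [Fintype k] [DecidableEq k]

/-- The columns of `V` are the members of an orthonormal eigenbasis with eigenvalue `t`. There may
be none, which makes the statement uniform in `t`. -/
theorem Matrix.IsHermitian.exists_eigenspace_isometry {A : Matrix m m ℂ} (hA : A.IsHermitian)
    (t : ℝ) : ∃ (p : Type) (_ : Fintype p) (_ : DecidableEq p) (V : Matrix m p ℂ),
      Vᴴ * V = 1 ∧ A * V = (t : ℂ) • V ∧
        ∀ ψ, A *ᵥ ψ = (t : ℂ) • ψ → V *ᵥ (Vᴴ *ᵥ ψ) = ψ := by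
  classical
  set U : Matrix m m ℂ := (hA.eigenvectorUnitary : Matrix m m ℂ)
  have hU : Uᴴ * U = 1 := (Matrix.mem_unitaryGroup_iff').1 hA.eigenvectorUnitary.2
  have hU' : U * Uᴴ = 1 := (Matrix.mem_unitaryGroup_iff).1 hA.eigenvectorUnitary.2
  have hAU : ∀ i, A *ᵥ (fun j => U j i) = (hA.eigenvalues i : ℂ) • fun j => U j i := by
    intro i
    have := hA.mulVec_eigenvectorBasis i
    simpa [U] using this
  have hUA : ∀ ψ i, (Uᴴ *ᵥ (A *ᵥ ψ)) i = (hA.eigenvalues i : ℂ) * (Uᴴ *ᵥ ψ) i := by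
    intro ψ i
    have e : Uᴴ * A = Matrix.diagonal (fun i => (hA.eigenvalues i : ℂ)) * Uᴴ := by
      have : A * U = U * Matrix.diagonal (fun i => (hA.eigenvalues i : ℂ)) := by
        ext j i
        rw [Matrix.mul_diagonal, mul_comm]
        exact congrFun (hAU i) j
      have := congrArg Matrix.conjTranspose this
      rw [Matrix.conjTranspose_mul, Matrix.conjTranspose_mul, hA, Matrix.diagonal_conjTranspose]
        at this
      rw [this]
      congr 2
      ext i
      simp
    rw [Matrix.mulVec_mulVec, e, ← Matrix.mulVec_mulVec, Matrix.mulVec_diagonal]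
  refine ⟨{i // hA.eigenvalues i = t}, inferInstance, inferInstance,
    U.submatrix id Subtype.val, ?_, ?_, ?_⟩
  · have : (U.submatrix id (Subtype.val : {i // hA.eigenvalues i = t} → m))ᴴ *
        (U.submatrix id (Subtype.val : {i // hA.eigenvalues i = t} → m)) =
        (Uᴴ * U).submatrix (Subtype.val : {i // hA.eigenvalues i = t} → m) Subtype.val := by
      rw [Matrix.conjTranspose_submatrix]
      rfl
    rw [this, hU]
    exact Matrix.submatrix_one _ Subtype.val_injective
  · ext j i
    have := congrFun (hAU i) j
    rw [i.2] at this
    exact this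
  · intro ψ hψ
    have h0 : ∀ i, hA.eigenvalues i ≠ t → (Uᴴ *ᵥ ψ) i = 0 := by
      intro i hi
      have := hUA ψ i
      rw [hψ, Matrix.mulVec_smul, Pi.smul_apply, smul_eq_mul, ← sub_eq_zero, ← sub_mul] at this
      refine (mul_eq_zero.1 this).resolve_left fun h => hi ?_
      have := sub_eq_zero.1 h
      exact_mod_cast this.symm
    have h1 : U *ᵥ (Uᴴ *ᵥ ψ) = ψ := by rw [Matrix.mulVec_mulVec, hU', Matrix.one_mulVec]
    conv_rhs => rw [← h1]
    ext j
    have e1 : (U.submatrix id Subtype.val *ᵥ ((U.submatrix id Subtype.val)ᴴ *ᵥ ψ)) j =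
        ∑ i : {i // hA.eigenvalues i = t}, U j i * (Uᴴ *ᵥ ψ) i := rfl
    have e2 : (U *ᵥ (Uᴴ *ᵥ ψ)) j = ∑ i, U j i * (Uᴴ *ᵥ ψ) i := rfl
    rw [e1, e2, ← Finset.sum_subtype (Finset.univ.filter fun i => hA.eigenvalues i = t) (by simp)
      fun i => U j i * (Uᴴ *ᵥ ψ) i]
    refine Finset.sum_subset (Finset.filter_subset _ _) fun i _ hi => ?_
    rw [h0 i (by simpa using hi), mul_zero]

theorem Matrix.IsHermitian.eq_smul_one_of_eigen {A : Matrix m m ℂ} (hA : A.IsHermitian) (θ : ℝ)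
    (h : ∀ (t : ℝ) ψ, t ≠ θ → A *ᵥ ψ = (t : ℂ) • ψ → ψ = 0) : A = (θ : ℂ) • 1 := by
  have he : ∀ i, hA.eigenvalues i = θ := by
    intro i
    by_contra hne
    have h1 := h _ _ hne (hA.mulVec_eigenvectorBasis i)
    have h2 : hA.eigenvectorBasis i = 0 := by
      ext j
      exact congrFun h1 j
    exact hA.eigenvectorBasis.orthonormal.ne_zero i h2
  have := hA.spectral_theorem
  have e : (RCLike.ofReal ∘ hA.eigenvalues : m → ℂ) = fun _ => (θ : ℂ) := by
    ext i
    simp [he i]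
  rw [this, e, ← Matrix.smul_one_eq_diagonal]
  simp

/-- A matrix with columns in the eigenspace is unchanged by the projection `V Vᴴ`; this lets
products of compressions be computed as compressions of products. -/
theorem projection_mul_of_eigen {A : Matrix m m ℂ} {V : Matrix m k ℂ} {t : ℂ}
    (hV : ∀ ψ, A *ᵥ ψ = t • ψ → V *ᵥ (Vᴴ *ᵥ ψ) = ψ) {l : Type*} (X : Matrix m l ℂ)
    (hX : A * X = t • X) : V * (Vᴴ * X) = X := by
  ext i j
  have h1 : A *ᵥ (fun i => X i j) = t • fun i => X i j :=
    funext fun i => congrFun (congrFun hX i) j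
  exact congrFun (hV _ h1) i

/-- Isometry onto the eigenspace of a block diagonal matrix. -/
theorem exists_eigenspace_isometry_fromBlocks {A₁ A₂ : Matrix m m ℂ} (h₁ : A₁.IsHermitian)
    (h₂ : A₂.IsHermitian) (t : ℝ) : ∃ (p : Type) (_ : Fintype p) (_ : DecidableEq p)
      (q : Type) (_ : Fintype q) (_ : DecidableEq q) (V₁ : Matrix m p ℂ) (V₂ : Matrix m q ℂ),
      V₁ᴴ * V₁ = 1 ∧ V₂ᴴ * V₂ = 1 ∧ A₁ * V₁ = (t : ℂ) • V₁ ∧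
      Matrix.fromBlocks A₁ 0 0 A₂ * Matrix.fromBlocks V₁ 0 0 V₂ =
        (t : ℂ) • Matrix.fromBlocks V₁ 0 0 V₂ ∧
      ∀ ψ, Matrix.fromBlocks A₁ 0 0 A₂ *ᵥ ψ = (t : ℂ) • ψ →
        Matrix.fromBlocks V₁ 0 0 V₂ *ᵥ ((Matrix.fromBlocks V₁ 0 0 V₂)ᴴ *ᵥ ψ) = ψ := by
  obtain ⟨p, ip, dp, V₁, hV₁, hAV₁, hc₁⟩ := h₁.exists_eigenspace_isometry t
  obtain ⟨q, iq, dq, V₂, hV₂, hAV₂, hc₂⟩ := h₂.exists_eigenspace_isometry t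
  refine ⟨p, ip, dp, q, iq, dq, V₁, V₂, hV₁, hV₂, hAV₁, ?_, ?_⟩
  · rw [Matrix.fromBlocks_multiply, Matrix.fromBlocks_smul, ← hAV₁, ← hAV₂]
    simp
  · intro ψ hψ
    rw [Matrix.fromBlocks_mulVec] at hψ
    have e1 : A₁ *ᵥ (ψ ∘ Sum.inl) = (t : ℂ) • (ψ ∘ Sum.inl) := by
      funext i
      simpa using congrFun hψ (Sum.inl i)
    have e2 : A₂ *ᵥ (ψ ∘ Sum.inr) = (t : ℂ) • (ψ ∘ Sum.inr) := by
      funext i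
      simpa using congrFun hψ (Sum.inr i)
    rw [Matrix.fromBlocks_conjTranspose, Matrix.fromBlocks_mulVec, Matrix.fromBlocks_mulVec]
    simp only [Sum.elim_comp_inl, Sum.elim_comp_inr, Matrix.conjTranspose_zero, Matrix.zero_mulVec,
      add_zero, zero_add, hc₁ _ e1, hc₂ _ e2, Sum.elim_comp_inl_inr]

theorem conjTranspose_mulVec_injective {Z : Matrix m m ℂ} (h : ∀ ψ, Z *ᵥ ψ = 0 → ψ = 0) :
    ∀ ψ, Zᴴ *ᵥ ψ = 0 → ψ = 0 := by
  by_contra! hc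
  obtain ⟨ψ, hψ, h0⟩ := hc
  have h1 : Zᴴ.det = 0 := Matrix.exists_mulVec_eq_zero_iff.1 ⟨ψ, h0, hψ⟩
  rw [Matrix.det_conjTranspose, star_eq_zero] at h1
  obtain ⟨φ, hφ, hφ'⟩ := Matrix.exists_mulVec_eq_zero_iff.2 h1
  exact hφ (h _ hφ')

/-- By `hZ`, the range of `V₂` is mapped by `Z` into that of `V₁`, so compressing loses nothing. -/
theorem compress_mulVec_injective {p q : Type*} [Fintype p] [Fintype q] [DecidableEq q]
    {Z : Matrix m m ℂ} {V₁ : Matrix m p ℂ} {V₂ : Matrix m q ℂ} (hV₂ : V₂ᴴ * V₂ = 1)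
    (hZ : V₁ * (V₁ᴴ * (Z * V₂)) = Z * V₂) (h : ∀ ψ, Z *ᵥ ψ = 0 → ψ = 0) :
    ∀ ψ, (V₁ᴴ * Z * V₂) *ᵥ ψ = 0 → ψ = 0 := by
  intro ψ hψ
  have h1 : Z *ᵥ (V₂ *ᵥ ψ) = 0 := by
    rw [Matrix.mulVec_mulVec, ← hZ, ← Matrix.mulVec_mulVec, ← Matrix.mul_assoc, hψ,
      Matrix.mulVec_zero]
  rw [← Matrix.one_mulVec ψ, ← hV₂, ← Matrix.mulVec_mulVec, h _ h1, Matrix.mulVec_zero]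

end Eigenspaces

/-! ### Stabilizers -/

section Stabilizer

variable {m : Type} [Fintype m] [DecidableEq m] {K Ki : Matrix (m ⊕ m) (m ⊕ m) ℂ} {α β γ : ℝ}

/-- A kernel vector `ψ` would make `(0, ψ)` an eigenvector of `K Kᴴ` with eigenvalue `exp β`,
contrary to `right_scale`, as `β` lies strictly between `α` and `-α`. -/
theorem left_offdiag_injective (h : K * Ki = 1) (h' : Ki * K = 1)
    (left22 : (K * Kᴴ).toBlocks₂₂ = (Real.exp β : ℂ) • 1)
    (right11 : (Kᴴ * K).toBlocks₁₁ = (Real.exp α : ℂ) • 1)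
    (right22 : (Ki * Kiᴴ).toBlocks₂₂ = (Real.exp α : ℂ) • 1)
    (hαβ : (β - α) * (β - -α) < 0) : ∀ ψ, (K * Kᴴ).toBlocks₁₂ *ᵥ ψ = 0 → ψ = 0 := by
  intro ψ hψ
  by_contra h0
  refine absurd (right_scale h h' right11 right22 (t := β) ⟨Sum.elim 0 ψ, fun e => h0 ?_, ?_⟩)
    (not_le.2 hαβ)
  · funext i
    exact congrFun e (Sum.inr i)
  · rw [← Matrix.fromBlocks_toBlocks (K * Kᴴ), Matrix.fromBlocks_mulVec]
    simp only [Sum.elim_comp_inl, Sum.elim_comp_inr, Matrix.mulVec_zero, hψ, left22,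
      Matrix.smul_mulVec, Matrix.one_mulVec, zero_add]
    ext (i | i) <;> simp

/-- Given a kernel vector `ψ` of `Y`, choose `χ ≠ 0` such that the second component of `φ = Kᴴ (0,
χ)` is a multiple of `ψ`. The quadratic form of `Ki Kiᴴ` has no cross terms at `φ`, so it is at
least the smaller of `exp α`, `exp (-α)` times `‖φ‖²`. It also equals `‖χ‖² = exp (-β) ‖φ‖²`, which
is smaller unless `φ = 0`. -/
theorem right_offdiag_injective (h : K * Ki = 1) (h' : Ki * K = 1)
    (left22 : (K * Kᴴ).toBlocks₂₂ = (Real.exp β : ℂ) • 1)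
    (right11 : (Kᴴ * K).toBlocks₁₁ = (Real.exp α : ℂ) • 1)
    (right22 : (Ki * Kiᴴ).toBlocks₂₂ = (Real.exp α : ℂ) • 1)
    (h1 : α < β) (h2 : -α < β) : ∀ ψ, (Ki * Kiᴴ).toBlocks₁₂ *ᵥ ψ = 0 → ψ = 0 := by
  intro ψ hψ
  by_contra h0
  set Y := (Ki * Kiᴴ).toBlocks₁₂ with hY
  have hQ := right_eq_schurForm (a := Real.exp α) h h' (Real.exp_ne_zero _) right11 right22
  rw [← hY] at hQ
  -- a vector of the second block which `Kᴴ` maps to `(φ₁, s ψ)`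
  obtain ⟨χ, s, hne, hχ⟩ : ∃ (χ : m → ℂ) (s : ℂ), χ ≠ 0 ∧
      Kᴴ.toBlocks₂₂ *ᵥ χ = s • ψ := by
    -- The additional unknown `s` makes the domain one dimension larger than the target, so a
    -- nonzero solution exists. It has `χ ≠ 0`, since `χ = 0` would give `s ψ = 0`.
    let f : ((m → ℂ) × ℂ) →ₗ[ℂ] (m → ℂ) :=
      (Kᴴ.toBlocks₂₂.mulVecLin).comp (LinearMap.fst ℂ _ _) -
        (LinearMap.toSpanSingleton ℂ (m → ℂ) ψ).comp (LinearMap.snd ℂ _ _)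
    have hlt : Module.finrank ℂ (m → ℂ) < Module.finrank ℂ ((m → ℂ) × ℂ) := by
      rw [Module.finrank_prod]; simp
    obtain ⟨⟨χ, s⟩, hχ, hne⟩ := (Submodule.ne_bot_iff _).1
      (LinearMap.ker_ne_bot_of_finrank_lt (f := f) hlt)
    have hχ' : Kᴴ.toBlocks₂₂ *ᵥ χ = s • ψ := by
      have : Kᴴ.toBlocks₂₂ *ᵥ χ - s • ψ = 0 := hχ
      exact sub_eq_zero.1 this
    refine ⟨χ, s, fun hc => hne ?_, hχ'⟩
    rw [hc, Matrix.mulVec_zero] at hχ'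
    rw [hc, (smul_eq_zero.1 hχ'.symm).resolve_right h0]
    rfl
  set φ₁ := Kᴴ.toBlocks₁₂ *ᵥ χ
  have hφ : Kᴴ *ᵥ Sum.elim (0 : m → ℂ) χ = Sum.elim φ₁ (s • ψ) := by
    conv_lhs => rw [← Matrix.fromBlocks_toBlocks Kᴴ]
    rw [Matrix.fromBlocks_mulVec]
    simp [hχ, φ₁]
  have hinv : Kiᴴ *ᵥ Sum.elim φ₁ (s • ψ) = Sum.elim (0 : m → ℂ) χ := by
    rw [← hφ, Matrix.mulVec_mulVec, ← Matrix.conjTranspose_mul, h, Matrix.conjTranspose_one,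
      Matrix.one_mulVec]
  have hsum : ∀ (x y : m → ℂ), normSqVec (Sum.elim x y) = normSqVec x + normSqVec y := by
    intro x y
    simp [normSqVec]
  have hz : normSqVec (0 : m → ℂ) = 0 := normSqVec_eq_zero.2 rfl
  -- the norm of `φ`
  have e1 : normSqVec φ₁ + normSqVec (s • ψ) = Real.exp β * normSqVec χ := by
    have : (normSqVec (Kᴴ *ᵥ Sum.elim (0 : m → ℂ) χ) : ℂ) = (Real.exp β : ℂ) * normSqVec χ := by
      rw [← star_dotProduct_conjTranspose_mul, Matrix.conjTranspose_conjTranspose,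
        Matrix.mulVec_mulVec, ← Matrix.fromBlocks_toBlocks (K * Kᴴ), Matrix.fromBlocks_mulVec,
        left22, ← star_dotProduct_self]
      simp [dotProduct, Matrix.smul_mulVec, Finset.mul_sum, mul_left_comm]
    rw [hφ, hsum] at this
    exact_mod_cast this
  have e2 : (Real.exp α)⁻¹ * normSqVec φ₁ + (Real.exp α)⁻¹ * normSqVec (Yᴴ *ᵥ φ₁) +
      Real.exp α * normSqVec (s • ψ) = normSqVec χ := by
    have h3 := star_dotProduct_conjTranspose_mul Kiᴴ (Sum.elim φ₁ (s • ψ))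
    rw [Matrix.conjTranspose_conjTranspose, Matrix.mulVec_mulVec, hinv, hsum, hz, zero_add, hQ,
      schurForm_mulVec, Matrix.mulVec_smul, hψ, smul_zero, add_zero] at h3
    have h4 : star (s • ψ) ⬝ᵥ (Yᴴ *ᵥ φ₁) = 0 := by
      rw [Matrix.dotProduct_mulVec, ← Matrix.star_mulVec, Matrix.mulVec_smul, hψ, smul_zero,
        star_zero, zero_dotProduct]
    have h5 : star φ₁ ⬝ᵥ (Y *ᵥ (Yᴴ *ᵥ φ₁)) = (normSqVec (Yᴴ *ᵥ φ₁) : ℂ) := by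
      rw [← star_dotProduct_conjTranspose_mul, Matrix.conjTranspose_conjTranspose]
    have h6 : star (Sum.elim φ₁ (s • ψ)) = Sum.elim (star φ₁) (star (s • ψ)) := by
      ext (i | i) <;> rfl
    rw [h6, sumElim_dotProduct_sumElim, dotProduct_add, dotProduct_add, dotProduct_smul,
      dotProduct_smul, dotProduct_smul, h4, h5, star_dotProduct_self, star_dotProduct_self] at h3
    have h7 : (((Real.exp α)⁻¹ * normSqVec φ₁ + (Real.exp α)⁻¹ * normSqVec (Yᴴ *ᵥ φ₁) +
      Real.exp α * normSqVec (s • ψ) : ℝ) : ℂ) = (normSqVec χ : ℝ) := by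
      rw [← h3]
      push_cast
      simp only [smul_eq_mul]
      ring
    exact_mod_cast h7
  have h3 : Real.exp α < Real.exp β := Real.exp_lt_exp.2 h1
  have h4 : (Real.exp α)⁻¹ < Real.exp β := by rw [← Real.exp_neg]; exact Real.exp_lt_exp.2 h2
  have hpos := normSqVec_pos hne
  have ha := Real.exp_pos α
  have hi : Real.exp α * (Real.exp α)⁻¹ = 1 := mul_inv_cancel₀ ha.ne'
  have n1 := normSqVec_nonneg φ₁
  have n2 := normSqVec_nonneg (s • ψ)
  have n3 := mul_nonneg (inv_pos.2 ha).le (normSqVec_nonneg (Yᴴ *ᵥ φ₁))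
  have hb := Real.exp_pos β
  have k1 : 1 < Real.exp β * (Real.exp α)⁻¹ := by
    rw [← hi]; exact mul_lt_mul_of_pos_right h3 (inv_pos.2 ha)
  have k2 : 1 < Real.exp β * Real.exp α := by
    rw [← inv_mul_cancel₀ ha.ne']; exact mul_lt_mul_of_pos_right h4 ha
  -- Eliminating `‖χ‖²` from `e1` and `e2` leaves a combination of nonnegative terms with strictly
  -- positive coefficients, so `φ` vanishes.
  have e3 : (Real.exp β * (Real.exp α)⁻¹ - 1) * normSqVec φ₁ +
      (Real.exp β * Real.exp α - 1) * normSqVec (s • ψ) ≤ 0 := by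
    have : Real.exp β * ((Real.exp α)⁻¹ * normSqVec φ₁ + (Real.exp α)⁻¹ * normSqVec (Yᴴ *ᵥ φ₁) +
      Real.exp α * normSqVec (s • ψ)) = normSqVec φ₁ + normSqVec (s • ψ) := by rw [e2, e1]
    nlinarith [mul_nonneg hb.le n3]
  have p1 := mul_nonneg (sub_pos.2 k1).le n1
  have p2 := mul_nonneg (sub_pos.2 k2).le n2
  have z1 : normSqVec φ₁ = 0 :=
    (mul_eq_zero.1 (le_antisymm (by linarith) p1)).resolve_left (sub_pos.2 k1).ne'
  have z2 : normSqVec (s • ψ) = 0 :=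
    (mul_eq_zero.1 (le_antisymm (by linarith) p2)).resolve_left (sub_pos.2 k2).ne'
  have := mul_pos hb hpos
  linarith

end Stabilizer

/-! ### Rigidity: intertwined block diagonal Hermitian matrices are scalar -/

section Stabilizer

variable {m : Type} [Fintype m] [DecidableEq m] {K Ki : Matrix (m ⊕ m) (m ⊕ m) ℂ} {α β γ : ℝ}

theorem toBlocks_conj_fromBlocks {p q : Type*} [Fintype p] [Fintype q] (L : Matrix (m ⊕ m) (m ⊕ m) ℂ)
    (V₁ : Matrix m p ℂ) (V₂ : Matrix m q ℂ) :
    (Matrix.fromBlocks V₁ 0 0 V₂)ᴴ * L * Matrix.fromBlocks V₁ 0 0 V₂ =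
      Matrix.fromBlocks (V₁ᴴ * L.toBlocks₁₁ * V₁) (V₁ᴴ * L.toBlocks₁₂ * V₂)
        (V₂ᴴ * L.toBlocks₂₁ * V₁) (V₂ᴴ * L.toBlocks₂₂ * V₂) := by
  conv_lhs => rw [← Matrix.fromBlocks_toBlocks L]
  rw [Matrix.fromBlocks_conjTranspose, Matrix.fromBlocks_multiply, Matrix.fromBlocks_multiply]
  simp

/-- A projection onto an eigenspace of a matrix commuting with `L`, in blocks. -/
theorem toBlocks_of_projection {p q : Type*} [Fintype p] [Fintype q]
    {L : Matrix (m ⊕ m) (m ⊕ m) ℂ} {V₁ : Matrix m p ℂ} {V₂ : Matrix m q ℂ}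
    (h : Matrix.fromBlocks V₁ 0 0 V₂ * ((Matrix.fromBlocks V₁ 0 0 V₂)ᴴ *
      (L * Matrix.fromBlocks V₁ 0 0 V₂)) = L * Matrix.fromBlocks V₁ 0 0 V₂) :
    V₁ * (V₁ᴴ * (L.toBlocks₁₂ * V₂)) = L.toBlocks₁₂ * V₂ ∧
    V₂ * (V₂ᴴ * (L.toBlocks₂₁ * V₁)) = L.toBlocks₂₁ * V₁ := by
  rw [← Matrix.fromBlocks_toBlocks L, Matrix.fromBlocks_conjTranspose, Matrix.fromBlocks_multiply,
    Matrix.fromBlocks_multiply, Matrix.fromBlocks_multiply, Matrix.fromBlocks_inj] at h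
  simp only [Matrix.conjTranspose_zero, Matrix.mul_zero, Matrix.zero_mul, add_zero, zero_add] at h
  exact ⟨h.2.1, h.2.2.1⟩

theorem toBlocks₂₁_eq_conjTranspose {L : Matrix (m ⊕ m) (m ⊕ m) ℂ} (h : Lᴴ = L) :
    L.toBlocks₂₁ = L.toBlocks₁₂ᴴ := by
  ext i j
  exact (congrFun (congrFun h (Sum.inr i)) (Sum.inl j)).symm

/-- The stabilizer of `K` in the block diagonal Hermitian matrices consists of scalars, if the
blocks of `K K†`, `K† K` and their inverses are prescribed. -/
theorem stabilizer_scalar (h : K * Ki = 1) (h' : Ki * K = 1)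
    (left22 : (K * Kᴴ).toBlocks₂₂ = (Real.exp β : ℂ) • 1)
    {w : m → ℂ} {τ : ℂ} (left11 : (Kiᴴ * Ki).toBlocks₁₁ =
      (Real.exp γ : ℂ)⁻¹ • 1 + τ • Matrix.vecMulVec w (star w))
    (right11 : (Kᴴ * K).toBlocks₁₁ = (Real.exp α : ℂ) • 1)
    (right22 : (Ki * Kiᴴ).toBlocks₂₂ = (Real.exp α : ℂ) • 1)
    (hx : β + γ ≠ 0) (hcase : (α < β ∧ β < -α) ∨ (α < β ∧ -α < β))
    {A₁ A₂ C₁ C₂ : Matrix m m ℂ} (hA₁ : A₁.IsHermitian) (hA₂ : A₂.IsHermitian)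
    (hC₁ : C₁.IsHermitian) (hC₂ : C₂.IsHermitian)
    (hAK : Matrix.fromBlocks A₁ 0 0 A₂ * K = K * Matrix.fromBlocks C₁ 0 0 C₂)
    {θ : ℝ} (hw : A₁ *ᵥ w = (θ : ℂ) • w) :
    Matrix.fromBlocks A₁ 0 0 A₂ = (θ : ℂ) • 1 ∧ Matrix.fromBlocks C₁ 0 0 C₂ = (θ : ℂ) • 1 := by
  set A := Matrix.fromBlocks A₁ 0 0 A₂ with hAdef
  set C := Matrix.fromBlocks C₁ 0 0 C₂ with hCdef
  have hA : Aᴴ = A := by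
    rw [hAdef, Matrix.fromBlocks_conjTranspose, hA₁.eq, hA₂.eq, Matrix.conjTranspose_zero]
  have hC : Cᴴ = C := by
    rw [hCdef, Matrix.fromBlocks_conjTranspose, hC₁.eq, hC₂.eq, Matrix.conjTranspose_zero]
  have hKA : Kᴴ * A = C * Kᴴ := by
    have := congrArg Matrix.conjTranspose hAK
    rwa [Matrix.conjTranspose_mul, Matrix.conjTranspose_mul, hA, hC] at this
  have hCK : C * Ki = Ki * A := by
    calc C * Ki = Ki * K * C * Ki := by rw [h', Matrix.one_mul]
      _ = Ki * (A * K) * Ki := by rw [hAK]; simp only [Matrix.mul_assoc]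
      _ = Ki * A := by simp only [Matrix.mul_assoc, h, Matrix.mul_one]
  have hKC : Kiᴴ * C = A * Kiᴴ := by
    have := congrArg Matrix.conjTranspose hCK
    rwa [Matrix.conjTranspose_mul, Matrix.conjTranspose_mul, hA, hC] at this
  have hAL : A * (K * Kᴴ) = K * Kᴴ * A := by
    rw [← Matrix.mul_assoc, hAK, Matrix.mul_assoc, ← hKA, Matrix.mul_assoc]
  have hCQ : C * (Ki * Kiᴴ) = Ki * Kiᴴ * C := by
    rw [← Matrix.mul_assoc, hCK, Matrix.mul_assoc, ← hKC, Matrix.mul_assoc]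
  -- A Hermitian matrix with no eigenvalue other than `θ` is `θ • 1`, and `C` is conjugate to `A` by
  -- `K`.
  suffices hmain : ∀ (t : ℝ), t ≠ θ → ∀ ψ, A *ᵥ ψ = (t : ℂ) • ψ → ψ = 0 by
    have hA' : A = (θ : ℂ) • 1 :=
      Matrix.IsHermitian.eq_smul_one_of_eigen (A := A) hA θ fun t ψ ht => hmain t ht ψ
    refine ⟨hA', ?_⟩
    calc C = Ki * (K * C) := by rw [← Matrix.mul_assoc, h', Matrix.one_mul]
      _ = (θ : ℂ) • 1 := by
        rw [← hAK, hA', Matrix.smul_mul, Matrix.one_mul, Matrix.mul_smul, h']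
  intro t ht
  obtain ⟨p, _, _, q, _, _, V₁, V₂, hV₁, hV₂, hAV₁, hAV, hVc⟩ :=
    exists_eigenspace_isometry_fromBlocks hA₁ hA₂ t
  obtain ⟨r, _, _, s, _, _, W₁, W₂, hW₁, hW₂, -, hCW, hWc⟩ :=
    exists_eigenspace_isometry_fromBlocks hC₁ hC₂ t
  rw [← hAdef] at hAV hVc
  rw [← hCdef] at hCW hWc
  set V := Matrix.fromBlocks V₁ 0 0 V₂ with hVdef
  set W := Matrix.fromBlocks W₁ 0 0 W₂ with hWdef
  by_cases hpos : 0 < Fintype.card p + Fintype.card q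
  swap
  · have hp : IsEmpty p := Fintype.card_eq_zero_iff.1 (by omega)
    have hq : IsEmpty q := Fintype.card_eq_zero_iff.1 (by omega)
    intro ψ hψ
    rw [← hVc ψ hψ]
    have : Vᴴ *ᵥ ψ = 0 := Subsingleton.elim _ _
    rw [this, Matrix.mulVec_zero]
  exfalso
  have hVV : Vᴴ * V = 1 := by
    rw [hVdef, Matrix.fromBlocks_conjTranspose, Matrix.fromBlocks_multiply]
    simp [hV₁, hV₂]
  have hWW : Wᴴ * W = 1 := by
    rw [hWdef, Matrix.fromBlocks_conjTranspose, Matrix.fromBlocks_multiply]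
    simp [hW₁, hW₂]
  -- All of `K`, `Ki` and their adjoints intertwine `A` and `C`, hence exchange the `t`-eigenspaces.
  -- So compressing to these commutes with forming Gram matrices and inverses.
  have pKW : V * (Vᴴ * (K * W)) = K * W := projection_mul_of_eigen hVc _ (by
    rw [← Matrix.mul_assoc, hAK, Matrix.mul_assoc, hCW, Matrix.mul_smul])
  have pKiV : W * (Wᴴ * (Ki * V)) = Ki * V := projection_mul_of_eigen hWc _ (by
    rw [← Matrix.mul_assoc, hCK, Matrix.mul_assoc, hAV, Matrix.mul_smul])
  have pKhV : W * (Wᴴ * (Kᴴ * V)) = Kᴴ * V := projection_mul_of_eigen hWc _ (by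
    rw [← Matrix.mul_assoc, ← hKA, Matrix.mul_assoc, hAV, Matrix.mul_smul])
  have pKihW : V * (Vᴴ * (Kiᴴ * W)) = Kiᴴ * W := projection_mul_of_eigen hVc _ (by
    rw [← Matrix.mul_assoc, ← hKC, Matrix.mul_assoc, hCW, Matrix.mul_smul])
  have pLV : V * (Vᴴ * (K * Kᴴ * V)) = K * Kᴴ * V := projection_mul_of_eigen hVc _ (by
    rw [← Matrix.mul_assoc, hAL, Matrix.mul_assoc, hAV, Matrix.mul_smul])
  have pQW : W * (Wᴴ * (Ki * Kiᴴ * W)) = Ki * Kiᴴ * W := projection_mul_of_eigen hWc _ (by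
    rw [← Matrix.mul_assoc, hCQ, Matrix.mul_assoc, hCW, Matrix.mul_smul])
  have hLL : (Vᴴ * K * W) * (Vᴴ * K * W)ᴴ = Vᴴ * (K * Kᴴ) * V := by
    simp only [Matrix.conjTranspose_mul, Matrix.conjTranspose_conjTranspose, Matrix.mul_assoc, pKhV]
  have hMM : (Wᴴ * Ki * V)ᴴ * (Wᴴ * Ki * V) = Vᴴ * (Kiᴴ * Ki) * V := by
    simp only [Matrix.conjTranspose_mul, Matrix.conjTranspose_conjTranspose, Matrix.mul_assoc, pKiV]
  have hRR : (Vᴴ * K * W)ᴴ * (Vᴴ * K * W) = Wᴴ * (Kᴴ * K) * W := by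
    simp only [Matrix.conjTranspose_mul, Matrix.conjTranspose_conjTranspose, Matrix.mul_assoc, pKW]
  have hQQ : (Wᴴ * Ki * V) * (Wᴴ * Ki * V)ᴴ = Wᴴ * (Ki * Kiᴴ) * W := by
    simp only [Matrix.conjTranspose_mul, Matrix.conjTranspose_conjTranspose, Matrix.mul_assoc,
      pKihW]
  -- Eigenvectors of `A₁` for `t` and `θ` are orthogonal. This removes the rank one term from the
  -- compressed `left11`, the only prescribed block that is not scalar.
  have hVw : V₁ᴴ *ᵥ w = 0 := by
    have e : (t : ℂ) • (V₁ᴴ *ᵥ w) = (θ : ℂ) • (V₁ᴴ *ᵥ w) := by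
      have : V₁ᴴ * A₁ = (t : ℂ) • V₁ᴴ := by
        have := congrArg Matrix.conjTranspose hAV₁
        rw [Matrix.conjTranspose_mul, hA₁.eq, Matrix.conjTranspose_smul] at this
        simpa using this
      rw [← Matrix.smul_mulVec, ← this, ← Matrix.mulVec_mulVec, hw, Matrix.mulVec_smul]
    rw [← sub_eq_zero, ← sub_smul] at e
    refine (smul_eq_zero.1 e).resolve_left fun h0 => ht ?_
    exact_mod_cast sub_eq_zero.1 h0
  have hpair : IsScalarPair (Real.exp α) (Real.exp β) (Real.exp γ) (Vᴴ * K * W) (Wᴴ * Ki * V) := by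
    constructor
    · calc Vᴴ * K * W * (Wᴴ * Ki * V) = Vᴴ * K * (W * (Wᴴ * (Ki * V))) := by
            simp only [Matrix.mul_assoc]
        _ = Vᴴ * (K * Ki) * V := by rw [pKiV]; simp only [Matrix.mul_assoc]
        _ = 1 := by rw [h, Matrix.mul_one, hVV]
    · calc Wᴴ * Ki * V * (Vᴴ * K * W) = Wᴴ * Ki * (V * (Vᴴ * (K * W))) := by
            simp only [Matrix.mul_assoc]
        _ = Wᴴ * (Ki * K) * W := by rw [pKW]; simp only [Matrix.mul_assoc]
        _ = 1 := by rw [h', Matrix.mul_one, hWW]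
    · rw [hLL, hVdef, toBlocks_conj_fromBlocks, Matrix.toBlocks_fromBlocks₂₂, left22,
        Matrix.mul_smul, Matrix.mul_one, Matrix.smul_mul, hV₂]
    · have : V₁ᴴ * Matrix.vecMulVec w (star w) = 0 := by
        rw [Matrix.mul_vecMulVec, hVw, Matrix.zero_vecMulVec]
      rw [hMM, hVdef, toBlocks_conj_fromBlocks, Matrix.toBlocks_fromBlocks₁₁, left11,
        Matrix.mul_add, Matrix.mul_smul, Matrix.mul_smul, this, smul_zero, add_zero,
        Matrix.mul_one, Matrix.smul_mul, hV₁]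
    · rw [hRR, hWdef, toBlocks_conj_fromBlocks, Matrix.toBlocks_fromBlocks₁₁, right11,
        Matrix.mul_smul, Matrix.mul_one, Matrix.smul_mul, hW₁]
    · rw [hQQ, hWdef, toBlocks_conj_fromBlocks, Matrix.toBlocks_fromBlocks₂₂, right22,
        Matrix.mul_smul, Matrix.mul_one, Matrix.smul_mul, hW₂]
  rcases hcase with ⟨h1, h2⟩ | ⟨h1, h2⟩
  · have hinj := left_offdiag_injective h h' left22 right11 right22
      (mul_neg_of_pos_of_neg (by linarith) (by linarith))
    have hinj' := conjTranspose_mulVec_injective hinj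
    obtain ⟨b1, b2⟩ := toBlocks_of_projection pLV
    rw [toBlocks₂₁_eq_conjTranspose
      (by rw [Matrix.conjTranspose_mul, Matrix.conjTranspose_conjTranspose])] at b2
    refine hpair.false_of_left_injective (by linarith) (by linarith) (by linarith) hx ?_ ?_ hpos
    · rw [hLL, hVdef, toBlocks_conj_fromBlocks, Matrix.toBlocks_fromBlocks₁₂]
      exact compress_mulVec_injective hV₂ b1 hinj
    · rw [hLL, hVdef, toBlocks_conj_fromBlocks, Matrix.toBlocks_fromBlocks₁₂,
        Matrix.conjTranspose_mul, Matrix.conjTranspose_mul, Matrix.conjTranspose_conjTranspose,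
        ← Matrix.mul_assoc]
      exact compress_mulVec_injective hV₁ b2 hinj'
  · have hinj := right_offdiag_injective h h' left22 right11 right22 h1 h2
    have hinj' := conjTranspose_mulVec_injective hinj
    obtain ⟨b1, b2⟩ := toBlocks_of_projection pQW
    rw [toBlocks₂₁_eq_conjTranspose
      (by rw [Matrix.conjTranspose_mul, Matrix.conjTranspose_conjTranspose])] at b2
    refine hpair.false_of_right_injective (by linarith) hx ?_ ?_ hpos
    · rw [hQQ, hWdef, toBlocks_conj_fromBlocks, Matrix.toBlocks_fromBlocks₁₂]
      exact compress_mulVec_injective hW₂ b1 hinj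
    · rw [hQQ, hWdef, toBlocks_conj_fromBlocks, Matrix.toBlocks_fromBlocks₁₂,
        Matrix.conjTranspose_mul, Matrix.conjTranspose_mul, Matrix.conjTranspose_conjTranspose,
        ← Matrix.mul_assoc]
      exact compress_mulVec_injective hW₁ b2 hinj'

end Stabilizer

/-! ### Slices for actions of compact groups -/

section Slice

open Filter Topology

variable {A B C D M G : Type*} [NormedAddCommGroup A] [NormedSpace ℝ A] [CompleteSpace A]
  [NormedAddCommGroup B] [NormedSpace ℝ B] [CompleteSpace B]
  [NormedAddCommGroup C] [NormedSpace ℝ C] [CompleteSpace C]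
  [NormedAddCommGroup D] [NormedSpace ℝ D]
  [TopologicalSpace M] [T2Space M] [Group G] [TopologicalSpace G] [IsTopologicalGroup G]
  [CompactSpace G] [MulAction G M] [ContinuousSMul G M]

/-- If the stabilizer of `p` acts trivially and the group near the identity moves a slice `σ`
through `p` injectively, then nearby points of the slice lie on different orbits. -/
theorem eventually_slice_injective {σ : A → M} {p : M} (hσ : ContinuousAt σ 0) (h0 : σ 0 = p)
    (hstab : ∀ g : G, g • p = p → ∀ q : M, g • q = q)
    (hloc : ∀ᶠ x : G × A × A in 𝓝 (1, 0, 0), x.1 • σ x.2.1 = σ x.2.2 → x.2.1 = x.2.2) :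
    ∀ᶠ x : A × A in 𝓝 (0, 0), ∀ g : G, g • σ x.1 = σ x.2 → x.1 = x.2 := by
  have key : ∀ g ∈ (Set.univ : Set G), ∀ᶠ y : (A × A) × G in 𝓝 ((0, 0), g),
      y.2 • σ y.1.1 = σ y.1.2 → y.1.1 = y.1.2 := by
    intro g _
    have c1 : ContinuousAt (fun y : (A × A) × G => σ y.1.1) ((0, 0), g) :=
      ContinuousAt.comp (f := fun y : (A × A) × G => y.1.1) (g := σ) (by exact hσ) (by fun_prop)
    have c2 : ContinuousAt (fun y : (A × A) × G => σ y.1.2) ((0, 0), g) :=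
      ContinuousAt.comp (f := fun y : (A × A) × G => y.1.2) (g := σ) (by exact hσ) (by fun_prop)
    -- If `g` fixes `p` it acts trivially, and translating by `g⁻¹` reduces to group elements near
    -- `1`. Otherwise `g • p` and `p` are separated and the equation fails nearby.
    by_cases hg : g • p = p
    · have ht : Tendsto (fun y : (A × A) × G => (g⁻¹ * y.2, y.1.1, y.1.2)) (𝓝 ((0, 0), g))
          (𝓝 (1, 0, 0)) := by
        have : Continuous (fun y : (A × A) × G => (g⁻¹ * y.2, y.1.1, y.1.2)) := by fun_prop
        simpa using this.tendsto ((0, 0), g)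
      filter_upwards [ht.eventually hloc] with y hy e
      apply hy
      rw [mul_smul, e]
      exact hstab g⁻¹ (by rw [inv_smul_eq_iff, hg]) _
    · have c3 : ContinuousAt (fun y : (A × A) × G => y.2 • σ y.1.1) ((0, 0), g) :=
        continuousAt_snd.smul c1
      have hopen : IsOpen {x : M × M | x.1 ≠ x.2} := isClosed_diagonal.isOpen_compl
      have := (c3.prodMk c2).preimage_mem_nhds (hopen.mem_nhds
        (show g • σ 0 ≠ σ 0 by rwa [h0]))
      filter_upwards [this] with y hy e
      exact absurd e hy
  have := isCompact_univ.eventually_forall_of_forall_eventually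
    (P := fun (x : A × A) (g : G) => g • σ x.1 = σ x.2 → x.1 = x.2) key
  exact this.mono fun x hx g => hx g trivial

/-- The inverse function theorem for `f` writes each point near `p` uniquely as `E b • τ (a, c)`
with small parameters. As `Z` is invariant, membership depends only on `(a, c)`, and replacing `c`
by `F (a, c)` makes it the condition `c = 0`. On `Z` the parameter `b` moves along the orbit, and
`a` separates orbits once its range is shrunk by `eventually_slice_injective`. -/
theorem exists_foliated_slice_chart [ChartedSpace D M] [IsManifold 𝓘(ℝ, D) ∞ M]
    {Z : Set M} (hZ : ∀ (g : G) (q : M), g • q ∈ Z ↔ q ∈ Z)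
    {p : M} {φ : OpenPartialHomeomorph M D} (hφ : φ ∈ IsManifold.maximalAtlas 𝓘(ℝ, D) ∞ M)
    (hp : p ∈ φ.source) {E : B → G} (hE : Continuous E) (hE0 : E 0 = 1)
    (hEn : 𝓝 (1 : G) ≤ map E (𝓝 0)) {τ : A × C → M} (hτ : Continuous τ) (hτ0 : τ 0 = p)
    {f : (A × C) × B → D} (hf : ContDiff ℝ ∞ f) {f' : ((A × C) × B) ≃L[ℝ] D}
    (hf' : HasFDerivAt f (f' : (A × C) × B →L[ℝ] D) 0)
    (hfφ : ∀ x, E x.2 • τ x.1 ∈ φ.source → φ (E x.2 • τ x.1) = f x)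
    {F : A × C → C} (hF : ContDiff ℝ ∞ F) (hF' : HasFDerivAt F (ContinuousLinearMap.snd ℝ A C) 0)
    (hF0 : F 0 = 0) (hFZ : ∀ y, τ y ∈ Z ↔ F y = 0)
    (hstab : ∀ g : G, g • p = p → ∀ q : M, g • q = q) :
    ∃ (ψ : OpenPartialHomeomorph M D) (L : D ≃L[ℝ] (A × C) × B),
      ψ ∈ IsManifold.maximalAtlas 𝓘(ℝ, D) ∞ M ∧ p ∈ ψ.source ∧ L (ψ p) = 0 ∧
      (∀ q ∈ ψ.source, q ∈ Z ↔ (L (ψ q)).1.2 = 0) ∧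
      ∀ q ∈ ψ.source, ∀ q' ∈ ψ.source, q ∈ Z → q' ∈ Z →
        ((∃ g : G, g • q = q') ↔ (L (ψ q)).1.1 = (L (ψ q')).1.1) := by
  -- straightening of the constraint
  have hk' : HasFDerivAt (fun y : A × C => (y.1, F y))
      ((ContinuousLinearEquiv.refl ℝ (A × C) : (A × C) ≃L[ℝ] (A × C)) : A × C →L[ℝ] A × C) 0 := by
    have := (hasFDerivAt_fst (𝕜 := ℝ) (E := A) (F := C) (p := (0 : A × C))).prodMk hF'
    exact this
  obtain ⟨k, hk0, -, hk, hks, hkt⟩ := exists_openPartialHomeomorph_of_contDiff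
    (f := fun y : A × C => (y.1, F y)) (contDiff_fst.prodMk hF) hk' isOpen_univ (Set.mem_univ _)
  have hk00 : k 0 = 0 := by rw [hk]; exact Prod.ext rfl hF0
  have hk0t : (0 : A × C) ∈ k.target := by
    have := k.map_source hk0
    rwa [hk00] at this
  have hks0 : k.symm 0 = 0 := by
    have := k.left_inv hk0
    rwa [hk00] at this
  -- the parametrization by the slice and the group
  have hcont : Continuous fun x : (A × C) × B => E x.2 • τ x.1 := by fun_prop
  have hfinj : ∀ x, E x.2 • τ x.1 ∈ φ.source → ∀ q ∈ φ.source, φ q = f x → E x.2 • τ x.1 = q := by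
    intro x hx q hq e
    apply φ.injOn hx hq
    rw [hfφ x hx, e]
  obtain ⟨h, hh0, hhU, hh, hhs, hht⟩ := exists_openPartialHomeomorph_of_contDiff hf hf'
    (U := {x | E x.2 • τ x.1 ∈ φ.source ∧ x.1 ∈ k.source})
    ((φ.open_source.preimage hcont).inter (k.open_source.preimage continuous_fst))
    ⟨by simpa [hE0, hτ0] using hp, hk0⟩
  -- distinct orbits
  obtain ⟨N, hN, hN0, hNinj⟩ : ∃ N : Set A, IsOpen N ∧ 0 ∈ N ∧ ∀ s ∈ N, ∀ s' ∈ N, ∀ g : G,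
      g • τ (k.symm (s, 0)) = τ (k.symm (s', 0)) → s = s' := by
    have hcs : ContinuousAt (fun s : A => k.symm (s, (0 : C))) 0 :=
      ContinuousAt.comp (f := fun s : A => (s, (0 : C))) (g := k.symm)
        (k.symm.continuousAt (by exact hk0t)) (by fun_prop)
    have hcσ : ContinuousAt (fun s : A => τ (k.symm (s, (0 : C)))) 0 :=
      hτ.continuousAt.comp hcs
    have hσ0 : τ (k.symm ((0 : A), (0 : C))) = p := by
      rw [show ((0 : A), (0 : C)) = 0 from rfl, hks0, hτ0]
    have hloc : ∀ᶠ x : G × A × A in 𝓝 (1, 0, 0),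
        x.1 • τ (k.symm (x.2.1, 0)) = τ (k.symm (x.2.2, 0)) → x.2.1 = x.2.2 := by
      have h1 : ∀ᶠ y : B × A × A in 𝓝 (0, 0, 0), E y.1 • τ (k.symm (y.2.1, 0)) =
          τ (k.symm (y.2.2, 0)) → y.2.1 = y.2.2 := by
        have hA1 : ContinuousAt (fun y : B × A × A => (k.symm (y.2.1, (0 : C)), y.1)) (0, 0, 0) :=
          ContinuousAt.prodMk (ContinuousAt.comp (f := fun y : B × A × A => y.2.1)
            (g := fun s : A => k.symm (s, (0 : C))) hcs (by fun_prop)) (by fun_prop)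
        have hA2 : ContinuousAt (fun y : B × A × A => (k.symm (y.2.2, (0 : C)), (0 : B)))
            (0, 0, 0) :=
          ContinuousAt.prodMk (ContinuousAt.comp (f := fun y : B × A × A => y.2.2)
            (g := fun s : A => k.symm (s, (0 : C))) hcs (by fun_prop)) (by fun_prop)
        have hA3 : ContinuousAt (fun y : B × A × A => (y.2.1, (0 : C))) (0, 0, 0) := by fun_prop
        have hA4 : ContinuousAt (fun y : B × A × A => (y.2.2, (0 : C))) (0, 0, 0) := by fun_prop
        have e0 : (k.symm ((0 : A), (0 : C)), (0 : B)) = 0 := by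
          rw [show ((0 : A), (0 : C)) = 0 from rfl, hks0]; rfl
        have m1 := hA1.preimage_mem_nhds (h.open_source.mem_nhds (by simpa only [e0] using hh0))
        have m2 := hA2.preimage_mem_nhds (h.open_source.mem_nhds (by simpa only [e0] using hh0))
        have m3 := hA3.preimage_mem_nhds (k.open_target.mem_nhds (by exact hk0t))
        have m4 := hA4.preimage_mem_nhds (k.open_target.mem_nhds (by exact hk0t))
        filter_upwards [m1, m2, m3, m4] with y y1 y2 y3 y4 e
        -- Both points are values of the parametrization, with group parameters `y.1` and `0`, so
        -- its local injectivity identifies the slice parameters.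
        have e1 : f (k.symm (y.2.1, (0 : C)), y.1) = f (k.symm (y.2.2, (0 : C)), (0 : B)) := by
          rw [← hfφ _ (hhU y1).1, ← hfφ _ (hhU y2).1]
          simp only [hE0, one_smul, e]
        rw [← hh, ← hh] at e1
        have e2 := h.injOn y1 y2 e1
        have e3 := k.symm.injOn y3 y4 (Prod.mk.inj e2).1
        exact (Prod.mk.inj e3).1
      rw [nhds_prod_eq] at h1 ⊢
      -- By `hEn` the map `E` covers a neighbourhood of `1`, so the statement for Lie algebra
      -- parameters passes to group elements near `1`.
      have h2 : 𝓝 (1 : G) ×ˢ 𝓝 ((0 : A), (0 : A)) ≤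
          map (fun y : B × A × A => (E y.1, y.2)) (𝓝 0 ×ˢ 𝓝 (0, 0)) := by
        have : (fun y : B × A × A => (E y.1, y.2)) = Prod.map E id := rfl
        rw [this, ← prod_map_map_eq', Filter.map_id]
        exact prod_mono hEn le_rfl
      exact h2 (eventually_map.2 h1)
    have h3 := eventually_slice_injective hcσ hσ0 hstab hloc
    rw [nhds_prod_eq, eventually_prod_self_iff'] at h3
    obtain ⟨t, ht, ht'⟩ := h3
    obtain ⟨N, hNt, hN, hN0⟩ := mem_nhds_iff.1 ht
    exact ⟨N, hN, hN0, fun s hs s' hs' g => ht' s (hNt hs) s' (hNt hs') g⟩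
  -- the chart
  have hS : IsOpen {x : (A × C) × B | x.1.1 ∈ N} :=
    hN.preimage (continuous_fst.comp continuous_fst)
  -- The parametrization is inverted and the constraint straightened. The linear map `f'` only
  -- returns the result to the model space `D`; the splitting `L = f'.symm` undoes it.
  set T : OpenPartialHomeomorph D D :=
    ((h.symm ≫ₕ k.prod (OpenPartialHomeomorph.refl B)) ≫ₕ OpenPartialHomeomorph.ofSet _ hS) ≫ₕ
      f'.toHomeomorph.toOpenPartialHomeomorph with hTdef
  have hTs : ∀ y, y ∈ T.source ↔
      y ∈ h.target ∧ (h.symm y).1 ∈ k.source ∧ (k (h.symm y).1).1 ∈ N := by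
    intro y
    simp [hTdef, and_assoc]
  have hTy : ∀ y, T y = f' (k (h.symm y).1, (h.symm y).2) := fun y => rfl
  have hTt : ∀ y ∈ T.target, (f'.symm y).1 ∈ k.target ∧
      (k.symm (f'.symm y).1, (f'.symm y).2) ∈ h.source := by
    intro y hy
    simp [hTdef] at hy
    exact ⟨hy.2.1, hy.2.2⟩
  have hTsymm : ∀ y, T.symm y = h (k.symm (f'.symm y).1, (f'.symm y).2) := fun y => rfl
  have hTsm : ContDiffOn ℝ ∞ T T.source := by
    have e1 : ContDiffOn ℝ ∞ h.symm T.source := hht.mono fun y hy => ((hTs y).1 hy).1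
    have e2 : ContDiffOn ℝ ∞ (fun y => k (h.symm y).1) T.source :=
      hks.comp e1.fst fun y hy => ((hTs y).1 hy).2.1
    exact f'.contDiff.comp_contDiffOn (e2.prodMk e1.snd)
  have hTsm' : ContDiffOn ℝ ∞ T.symm T.target := by
    have e1 : ContDiffOn ℝ ∞ f'.symm T.target := f'.symm.contDiff.contDiffOn
    have e2 : ContDiffOn ℝ ∞ (fun y => k.symm (f'.symm y).1) T.target :=
      hkt.comp e1.fst fun y hy => (hTt y hy).1
    exact hhs.comp (e2.prodMk e1.snd) fun y hy => (hTt y hy).2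
  have hfp : φ p = h 0 := by
    have := hfφ 0 (by simpa [hE0, hτ0] using hp)
    simpa [hE0, hτ0, hh] using this
  have hsource : ∀ q ∈ (φ ≫ₕ T).source, ∃ x ∈ h.source, φ q = h x ∧ x.1 ∈ k.source ∧
      (k x.1).1 ∈ N ∧ f'.symm ((φ ≫ₕ T) q) = (k x.1, x.2) ∧ E x.2 • τ x.1 = q := by
    intro q hq
    obtain ⟨hq1, hq2⟩ := hq
    obtain ⟨t1, t2, t3⟩ := (hTs _).1 hq2
    have hx := h.map_target t1
    have hφx : φ q = h (h.symm (φ q)) := (h.right_inv t1).symm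
    refine ⟨h.symm (φ q), hx, hφx, t2, t3, ?_, hfinj _ (hhU hx).1 q hq1 ?_⟩
    · change f'.symm (T (φ q)) = _
      rw [hTy, f'.symm_apply_apply]
    · rw [← hh]; exact hφx
  have hslice : ∀ y ∈ k.source, F y = 0 → k.symm ((k y).1, 0) = y := by
    intro y hy hy0
    have : ((k y).1, (0 : C)) = k y := Prod.ext rfl (by rw [hk]; exact hy0.symm)
    rw [this, k.left_inv hy]
  refine ⟨φ ≫ₕ T, f'.symm, trans_mem_maximalAtlas hφ hTsm hTsm', ?_, ?_, ?_, ?_⟩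
  · refine ⟨hp, (hTs (φ p)).2 ?_⟩
    rw [hfp, h.left_inv hh0]
    exact ⟨h.map_source hh0, hk0, by rw [show ((0 : (A × C) × B)).1 = 0 from rfl, hk00]; exact hN0⟩
  · change f'.symm (T (φ p)) = 0
    rw [hTy, f'.symm_apply_apply, hfp, h.left_inv hh0]
    exact Prod.ext hk00 rfl
  · intro q hq
    obtain ⟨x, hx, -, -, -, e, rfl⟩ := hsource q hq
    rw [hZ, e, hFZ, hk]
  · intro q hq q' hq' hqZ hqZ'
    obtain ⟨x, hx, -, hxk, hxN, e, rfl⟩ := hsource q hq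
    obtain ⟨x', hx', -, hxk', hxN', e', rfl⟩ := hsource q' hq'
    rw [hZ, hFZ] at hqZ hqZ'
    rw [e, e']
    have s1 := hslice _ hxk hqZ
    have s2 := hslice _ hxk' hqZ'
    constructor
    · rintro ⟨g, hg⟩
      -- Both points are moved back into the slice by their group parameters, where `N` allows at
      -- most one point per orbit.
      refine hNinj _ hxN _ hxN' ((E x'.2)⁻¹ * g * E x.2) ?_
      rw [s1, s2, mul_smul, mul_smul, hg, inv_smul_smul]
    · intro h1
      have h1' : (k x.1).1 = (k x'.1).1 := h1
      rw [h1', s2] at s1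
      refine ⟨E x'.2 * (E x.2)⁻¹, ?_⟩
      rw [mul_smul, inv_smul_smul, s1]

end Slice

/-! ### Manifold structures on an invariant set and on its orbit space -/

section Reduction

open Filter Topology

/-- The quotient of a Hausdorff space by a compact group is Hausdorff. -/
theorem properSMul_of_compactSpace {G N : Type*} [Group G] [TopologicalSpace G] [CompactSpace G]
    [TopologicalSpace N] [T2Space N] [MulAction G N] [ContinuousSMul G N] : ProperSMul G N := by
  rw [properSMul_iff_continuousSMul_ultrafilter_tendsto_t2]
  refine ⟨inferInstance, fun 𝒰 _ _ _ => ?_⟩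
  obtain ⟨g, -, hg⟩ := isCompact_univ.ultrafilter_le_nhds (𝒰.map Prod.fst) (by simp)
  exact ⟨g, hg⟩

/-- Reduction: an invariant set which is, locally around each of its points, cut out by coordinates
such that some further coordinates distinguish the orbits, is an embedded submanifold, and its
orbit space is a manifold. -/
theorem exists_reduced_manifold {A B C D M G : Type*} [NormedAddCommGroup A] [NormedSpace ℝ A]
    [FiniteDimensional ℝ A] [NormedAddCommGroup B] [NormedSpace ℝ B] [FiniteDimensional ℝ B]
    [NormedAddCommGroup C] [NormedSpace ℝ C] [NormedAddCommGroup D] [NormedSpace ℝ D]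
    [TopologicalSpace M] [T2Space M] [SecondCountableTopology M] [ChartedSpace D M]
    [IsManifold 𝓘(ℝ, D) ∞ M] [Group G] [TopologicalSpace G]
    [CompactSpace G] [MulAction G M] [ContinuousSMul G M] {Z : Set M} [MulAction G Z]
    (hsmul : ∀ (g : G) (z : Z), ((g • z : Z) : M) = g • (z : M))
    (hsm : ∀ g : G, ContMDiff 𝓘(ℝ, D) 𝓘(ℝ, D) ∞ fun q : M => g • q)
    (hcharts : ∀ p ∈ Z, ∃ (ψ : OpenPartialHomeomorph M D) (L : D ≃L[ℝ] (A × C) × B),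
      ψ ∈ IsManifold.maximalAtlas 𝓘(ℝ, D) ∞ M ∧ p ∈ ψ.source ∧ L (ψ p) = 0 ∧
      (∀ q ∈ ψ.source, q ∈ Z ↔ (L (ψ q)).1.2 = 0) ∧
      ∀ q ∈ ψ.source, ∀ q' ∈ ψ.source, q ∈ Z → q' ∈ Z →
        ((∃ g : G, g • q = q') ↔ (L (ψ q)).1.1 = (L (ψ q')).1.1)) :
    ∃ (d : ℕ) (_ : ChartedSpace (EuclideanSpace ℝ (Fin d)) Z)
      (e : ℕ) (_ : ChartedSpace (EuclideanSpace ℝ (Fin e)) (Quotient (MulAction.orbitRel G Z))),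
      IsManifold (𝓡 d) ∞ Z ∧
      IsSmoothEmbedding (𝓡 d) 𝓘(ℝ, D) ∞ (Subtype.val : Z → M) ∧
      T2Space (Quotient (MulAction.orbitRel G Z)) ∧
      SecondCountableTopology (Quotient (MulAction.orbitRel G Z)) ∧
      IsManifold (𝓡 e) ∞ (Quotient (MulAction.orbitRel G Z)) ∧
      IsSubmersion (𝓡 d) (𝓡 e) ∞ (Quotient.mk (MulAction.orbitRel G Z)) := by
  have : ContinuousSMul G Z := ⟨by
    refine continuous_induced_rng.2 ?_
    have : (Subtype.val ∘ fun p : G × Z => p.1 • p.2) = fun p : G × Z => p.1 • (p.2 : M) :=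
      funext fun p => hsmul p.1 p.2
    rw [this]
    fun_prop⟩
  have := properSMul_of_compactSpace (G := G) (N := Z)
  choose ψ L hψ hp hL0 hLZ hLr using hcharts
  let e := Module.finrank ℝ A
  let d := Module.finrank ℝ (A × B)
  let eA : A ≃L[ℝ] EuclideanSpace ℝ (Fin e) :=
    ContinuousLinearEquiv.ofFinrankEq (by simp [e])
  let eAB : (A × B) ≃L[ℝ] EuclideanSpace ℝ (Fin d) :=
    ContinuousLinearEquiv.ofFinrankEq (by simp only [d, finrank_euclideanSpace_fin])
  -- For the submanifold the constraint `C` is split off, while orbit parameter `A` and orbit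
  -- direction `B` together form its model space.
  let sw : ((A × C) × B) ≃L[ℝ] (A × B) × C :=
    { toFun := fun x => ((x.1.1, x.2), x.1.2)
      invFun := fun x => ((x.1.1, x.2), x.1.2)
      map_add' := fun _ _ => rfl
      map_smul' := fun _ _ => rfl
      left_inv := fun _ => rfl
      right_inv := fun _ => rfl
      continuous_toFun := by fun_prop
      continuous_invFun := by fun_prop }
  let S : Z → SliceChart (E := D) Z (EuclideanSpace ℝ (Fin d)) C := fun p =>
    { chart := ψ p p.2
      chart_mem := hψ p p.2
      equiv := ((L p p.2).trans sw).trans (eAB.prodCongr (ContinuousLinearEquiv.refl ℝ C))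
      mem_iff := hLZ p p.2 }
  have hS : ∀ p : Z, (p : M) ∈ (S p).chart.source := fun p => hp p p.2
  let csZ : ChartedSpace (EuclideanSpace ℝ (Fin d)) Z := SliceChart.chartedSpace S hS
  have hZm : IsManifold (𝓡 d) ∞ Z := SliceChart.isManifold S hS
  have hZe : IsSmoothEmbedding (𝓡 d) 𝓘(ℝ, D) ∞ (Subtype.val : Z → M) :=
    SliceChart.isSmoothEmbedding S hS
  have hsmZ : ∀ g : G, ContMDiff (𝓡 d) (𝓡 d) ∞ fun z : Z => g • z := by
    intro g
    -- A continuous map into `Z` is smooth as soon as its composition with the immersion into `M`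
    -- is.
    refine (ContMDiff.iff_comp_isImmersion hZe.isImmersion).2 ⟨continuous_const_smul g, ?_⟩
    have : (Subtype.val ∘ fun z : Z => g • z) = (fun q : M => g • q) ∘ (Subtype.val : Z → M) :=
      funext fun z => hsmul g z
    rw [this]
    exact (hsm g).comp hZe.contMDiff
  have hr : IsOpenMap (Quotient.mk (MulAction.orbitRel G Z)) := isOpenMap_quotient_mk'_mul
  have hsm' : ∀ q q' : Z, (MulAction.orbitRel G Z) q q' → ∃ φ : Z → Z,
      ContMDiff (𝓡 d) (𝓡 d) ∞ φ ∧ φ q = q' ∧ ∀ z, (MulAction.orbitRel G Z) z (φ z) := by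
    intro q q' h
    obtain ⟨g, hg⟩ := (MulAction.orbitRel G Z).symm h
    refine ⟨fun z => g • z, hsmZ g, hg, fun z => (MulAction.orbitRel G Z).symm ⟨g, rfl⟩⟩
  let T : Z → FoliatedChart (D := EuclideanSpace ℝ (Fin d)) (MulAction.orbitRel G Z)
      (EuclideanSpace ℝ (Fin e)) B := fun p =>
    { chart := (S p).restrict p
      chart_mem := IsManifold.subset_maximalAtlas ⟨p, rfl⟩
      equiv := eAB.symm.trans (eA.prodCongr (ContinuousLinearEquiv.refl ℝ B))
      rel_iff := by
        intro q hq q' hq'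
        have hc : ∀ z : Z, (eAB.symm.trans (eA.prodCongr (ContinuousLinearEquiv.refl ℝ B))
            ((S p).restrict p z)).1 = eA (L p p.2 (ψ p p.2 z)).1.1 := by
          intro z
          change eA (eAB.symm (eAB _)).1 = _
          rw [eAB.symm_apply_apply]
          rfl
        rw [hc, hc, eA.injective.eq_iff, ← hLr p p.2 q hq q' hq' q.2 q'.2]
        constructor
        · intro h
          obtain ⟨g, hg⟩ := (MulAction.orbitRel G Z).symm h
          exact ⟨g, by rw [← hsmul]; exact congrArg Subtype.val hg⟩
        · rintro ⟨g, hg⟩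
          refine (MulAction.orbitRel G Z).symm ⟨g, Subtype.ext ?_⟩
          rw [← hg]
          exact hsmul g q }
  have hT : ∀ p, p ∈ (T p).dom := by
    intro p
    -- The chart is centred at `p`, so `p` is itself the transversal point with parameter `0`; this
    -- puts `p` in `dom`.
    have h0 : (T p).equiv ((T p).chart p) = 0 := by
      change (eA.prodCongr (ContinuousLinearEquiv.refl ℝ B)) (eAB.symm (eAB
        (sw (L p p.2 (ψ p p.2 p))).1)) = 0
      rw [hL0, map_zero, Prod.fst_zero, map_zero, map_zero, map_zero]
    refine ⟨hS p, ?_⟩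
    change (T p).equiv.symm (((T p).equiv ((T p).chart p)).1, 0) ∈ (T p).chart.target
    have h1 : (((T p).equiv ((T p).chart p)).1, (0 : B)) = (T p).equiv ((T p).chart p) := by
      rw [h0]; rfl
    rw [h1, ContinuousLinearEquiv.symm_apply_apply]
    exact (T p).chart.map_source (hS p)
  exact ⟨d, csZ, e, FoliatedChart.chartedSpace hr T hT, hZm, hZe, inferInstance,
    ContinuousConstSMul.secondCountableTopology, FoliatedChart.isManifold hr hsm' T hT,
    FoliatedChart.isSubmersion hr hsm' T hT⟩

end Reduction

open HeisenbergReduction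

/-! ### The level set in terms of blocks -/

section LevelSet

theorem coe_inv_mul_coe {n : ℕ} (K : SL2n n) : (K⁻¹).1 * K.1 = 1 := by
  rw [← Matrix.SpecialLinearGroup.coe_mul, inv_mul_cancel, Matrix.SpecialLinearGroup.coe_one]

theorem coe_mul_coe_inv {n : ℕ} (K : SL2n n) : K.1 * (K⁻¹).1 = 1 := by
  rw [← Matrix.SpecialLinearGroup.coe_mul, mul_inv_cancel, Matrix.SpecialLinearGroup.coe_one]

theorem toBlocks_mul {m : Type*} [Fintype m] (a b : Matrix (m ⊕ m) (m ⊕ m) ℂ) :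
    (a * b).toBlocks₁₁ = a.toBlocks₁₁ * b.toBlocks₁₁ + a.toBlocks₁₂ * b.toBlocks₂₁ ∧
    (a * b).toBlocks₂₂ = a.toBlocks₂₁ * b.toBlocks₁₂ + a.toBlocks₂₂ * b.toBlocks₂₂ := by
  constructor <;> ext i j <;>
    simp [Matrix.toBlocks₁₁, Matrix.toBlocks₁₂, Matrix.toBlocks₂₁, Matrix.toBlocks₂₂,
      Matrix.mul_apply, Fintype.sum_sum_type]

/-- With `K = b g⁻¹` one has `K Kᴴ = b bᴴ`, whose lower right block is `b₂₂ b₂₂ᴴ`, while the upper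
left block of its inverse is `(b₁₁ b₁₁ᴴ)⁻¹`. These products fix the diagonal blocks up to a unitary
factor, and a unitary element of `SB n` is `1`. -/
theorem diagProj_bL_eq_iff {n : ℕ} (K : SL2n n) (c : GplusStar n) :
    diagProj (bL K) = c ↔
      (K.1 * K.1ᴴ).toBlocks₂₂ = c.1.1.toBlocks₂₂ * c.1.1.toBlocks₂₂ᴴ ∧
      c.1.1.toBlocks₁₁ᴴ * ((K⁻¹).1ᴴ * (K⁻¹).1).toBlocks₁₁ * c.1.1.toBlocks₁₁ = 1 := by
  obtain ⟨g, hg, hK⟩ := exists_eq_bL_mul K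
  set b := bL K
  have hgi : (g⁻¹).1 = g.1ᴴ := coe_inv_of_mem_SU hg
  have hgg : g.1ᴴ * g.1 = 1 := hg
  have e1 : K.1 * K.1ᴴ = b.1.1 * b.1.1ᴴ := by
    have : K.1 = b.1.1 * g.1ᴴ := by
      conv_lhs => rw [hK]
      rw [Matrix.SpecialLinearGroup.coe_mul, hgi]
    rw [this, Matrix.conjTranspose_mul, Matrix.conjTranspose_conjTranspose]
    calc b.1.1 * g.1ᴴ * (g.1 * b.1.1ᴴ) = b.1.1 * (g.1ᴴ * g.1) * b.1.1ᴴ := by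
          simp only [Matrix.mul_assoc]
      _ = _ := by rw [hgg, Matrix.mul_one]
  have e2 : (K⁻¹).1ᴴ * (K⁻¹).1 = (b.1⁻¹).1ᴴ * (b.1⁻¹).1 := by
    have : K⁻¹ = g * b.1⁻¹ := by rw [hK]; group
    rw [this, Matrix.SpecialLinearGroup.coe_mul, Matrix.conjTranspose_mul]
    calc (b.1⁻¹).1ᴴ * g.1ᴴ * (g.1 * (b.1⁻¹).1) = (b.1⁻¹).1ᴴ * (g.1ᴴ * g.1) * (b.1⁻¹).1 := by
          simp only [Matrix.mul_assoc]
      _ = _ := by rw [hgg, Matrix.mul_one]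
  have hb21 := b.2.1.toBlocks₂₁
  have hbi21 : (b.1⁻¹).1.toBlocks₂₁ = 0 := (inv_mem b.2 : b.1⁻¹ ∈ SB n).1.toBlocks₂₁
  have e3 : (K.1 * K.1ᴴ).toBlocks₂₂ = b.1.1.toBlocks₂₂ * b.1.1.toBlocks₂₂ᴴ := by
    rw [e1, (toBlocks_mul _ _).2, hb21, Matrix.zero_mul, zero_add]
    rfl
  have e4 : ((K⁻¹).1ᴴ * (K⁻¹).1).toBlocks₁₁ =
      (b.1⁻¹).1.toBlocks₁₁ᴴ * (b.1⁻¹).1.toBlocks₁₁ := by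
    rw [e2, (toBlocks_mul _ _).1, hbi21, Matrix.mul_zero, add_zero]
    rfl
  have e5 : (b.1⁻¹).1.toBlocks₁₁ * b.1.1.toBlocks₁₁ = 1 := by
    rw [← (toBlocks_mul_of_upper hbi21 hb21).1, coe_inv_mul_coe, ← Matrix.fromBlocks_one,
      Matrix.toBlocks_fromBlocks₁₁]
  have e6 : (b.1⁻¹).1.toBlocks₂₂ * b.1.1.toBlocks₂₂ = 1 := by
    rw [← (toBlocks_mul_of_upper hbi21 hb21).2.2.2, coe_inv_mul_coe, ← Matrix.fromBlocks_one,
      Matrix.toBlocks_fromBlocks₂₂]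
  rw [e3, e4]
  constructor
  · rintro rfl
    refine ⟨rfl, ?_⟩
    change b.1.1.toBlocks₁₁ᴴ * ((b.1⁻¹).1.toBlocks₁₁ᴴ * (b.1⁻¹).1.toBlocks₁₁) *
      b.1.1.toBlocks₁₁ = 1
    rw [Matrix.mul_assoc, Matrix.mul_assoc, e5, Matrix.mul_one, ← Matrix.conjTranspose_mul, e5,
      Matrix.conjTranspose_one]
  · rintro ⟨h1, h2⟩
    set d := diagProj b
    have hd : d.1.1 = Matrix.fromBlocks b.1.1.toBlocks₁₁ 0 0 b.1.1.toBlocks₂₂ := rfl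
    have hc : c.1.1 = Matrix.fromBlocks c.1.1.toBlocks₁₁ 0 0 c.1.1.toBlocks₂₂ := by
      conv_lhs => rw [← Matrix.fromBlocks_toBlocks c.1.1, c.2.2, c.2.1.1.toBlocks₂₁]
    have hdi : (d.1⁻¹).1 =
        Matrix.fromBlocks (b.1⁻¹).1.toBlocks₁₁ 0 0 (b.1⁻¹).1.toBlocks₂₂ := by
      have : Matrix.fromBlocks (b.1⁻¹).1.toBlocks₁₁ 0 0 (b.1⁻¹).1.toBlocks₂₂ * d.1.1 = 1 := by
        rw [hd, Matrix.fromBlocks_multiply, e5, e6]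
        simp only [Matrix.mul_zero, Matrix.zero_mul, add_zero, zero_add, Matrix.fromBlocks_one]
      calc (d.1⁻¹).1 = Matrix.fromBlocks (b.1⁻¹).1.toBlocks₁₁ 0 0 (b.1⁻¹).1.toBlocks₂₂ * d.1.1 *
            (d.1⁻¹).1 := by rw [this, Matrix.one_mul]
        _ = _ := by rw [Matrix.mul_assoc, coe_mul_coe_inv, Matrix.mul_one]
    have he : (d.1⁻¹ * c.1).1 = Matrix.fromBlocks ((b.1⁻¹).1.toBlocks₁₁ * c.1.1.toBlocks₁₁) 0 0
        ((b.1⁻¹).1.toBlocks₂₂ * c.1.1.toBlocks₂₂) := by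
      rw [Matrix.SpecialLinearGroup.coe_mul, hdi, hc, Matrix.fromBlocks_multiply]
      simp
    have hSU : d.1⁻¹ * c.1 ∈ SU n := by
      change (d.1⁻¹ * c.1).1ᴴ * (d.1⁻¹ * c.1).1 = 1
      have h3 : ((b.1⁻¹).1.toBlocks₂₂ * c.1.1.toBlocks₂₂) *
          ((b.1⁻¹).1.toBlocks₂₂ * c.1.1.toBlocks₂₂)ᴴ = 1 := by
        rw [Matrix.conjTranspose_mul]
        calc (b.1⁻¹).1.toBlocks₂₂ * c.1.1.toBlocks₂₂ *
              (c.1.1.toBlocks₂₂ᴴ * (b.1⁻¹).1.toBlocks₂₂ᴴ)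
            = (b.1⁻¹).1.toBlocks₂₂ * (c.1.1.toBlocks₂₂ * c.1.1.toBlocks₂₂ᴴ) *
              (b.1⁻¹).1.toBlocks₂₂ᴴ := by simp only [Matrix.mul_assoc]
          _ = ((b.1⁻¹).1.toBlocks₂₂ * b.1.1.toBlocks₂₂) *
              ((b.1⁻¹).1.toBlocks₂₂ * b.1.1.toBlocks₂₂)ᴴ := by
                rw [← h1, Matrix.conjTranspose_mul]; simp only [Matrix.mul_assoc]
          _ = 1 := by rw [e6, Matrix.conjTranspose_one, Matrix.mul_one]
      have h4 : ((b.1⁻¹).1.toBlocks₁₁ * c.1.1.toBlocks₁₁)ᴴ *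
          ((b.1⁻¹).1.toBlocks₁₁ * c.1.1.toBlocks₁₁) = 1 := by
        rw [← h2, Matrix.conjTranspose_mul]
        simp only [Matrix.mul_assoc]
      rw [he, Matrix.fromBlocks_conjTranspose, Matrix.fromBlocks_multiply, h4,
        mul_eq_one_comm.1 h3]
      simp
    have hSB : d.1⁻¹ * c.1 ∈ SB n := mul_mem (inv_mem d.2.1) c.2.1
    have := eq_one_of_mem_SU_of_mem_SB hSU hSB
    rw [inv_mul_eq_one] at this
    exact Subtype.ext this

/-- The condition on `b_R` is the one on `b_L` applied to `K⁻¹`. -/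
theorem mem_levelSet_mu_iff {n : ℕ} {u v x : ℝ} (K : SL2n n) :
    K ∈ levelSet (mu n u v x) ↔
      (K.1 * K.1ᴴ).toBlocks₂₂ = (Real.exp (-2 * u) : ℂ) • 1 ∧
      (nu n x)ᴴ * ((K⁻¹).1ᴴ * (K⁻¹).1).toBlocks₁₁ * nu n x = (Real.exp (-2 * u) : ℂ) • 1 ∧
      (K.1ᴴ * K.1).toBlocks₁₁ = (Real.exp (-2 * v) : ℂ) • 1 ∧
      ((K⁻¹).1 * (K⁻¹).1ᴴ).toBlocks₂₂ = (Real.exp (-2 * v) : ℂ) • 1 := by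
  have h0 : ∀ t : ℝ, (Real.exp (-t) : ℂ) * (Real.exp (-t) : ℂ) = (Real.exp (-2 * t) : ℂ) := by
    intro t
    rw [← Complex.ofReal_mul, ← Real.exp_add]
    congr 2; ring
  have hs : ∀ t : ℝ, ((Real.exp (-t) : ℂ) • (1 : Matrix (Fin n) (Fin n) ℂ)) *
      ((Real.exp (-t) : ℂ) • (1 : Matrix (Fin n) (Fin n) ℂ))ᴴ = (Real.exp (-2 * t) : ℂ) • 1 := by
    intro t
    rw [Matrix.conjTranspose_smul, Matrix.conjTranspose_one, Matrix.smul_mul, Matrix.one_mul,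
      smul_smul, Complex.star_def, Complex.conj_ofReal, h0]
  have hu : ∀ (t : ℝ) (N X : Matrix (Fin n) (Fin n) ℂ),
      ((Real.exp t : ℂ) • N)ᴴ * X * ((Real.exp t : ℂ) • N) = 1 ↔
        Nᴴ * X * N = (Real.exp (-2 * t) : ℂ) • 1 := by
    intro t N X
    have hne : (Real.exp (-2 * t) : ℂ) ≠ 0 := by exact_mod_cast (Real.exp_pos _).ne'
    have : ((Real.exp t : ℂ) * Real.exp t) = (Real.exp (-2 * t) : ℂ)⁻¹ := by
      rw [← Complex.ofReal_inv, ← Complex.ofReal_mul, ← Real.exp_add, ← Real.exp_neg]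
      congr 2; ring
    rw [Matrix.conjTranspose_smul, Matrix.smul_mul, Matrix.smul_mul, Matrix.mul_smul, smul_smul,
      Complex.star_def, Complex.conj_ofReal, this, inv_smul_eq_iff₀ hne]
  have hmem : K ∈ levelSet (mu n u v x) ↔
      diagProj (bL K) = muL n u x ∧ diagProj (bL K⁻¹) = muR n v := by
    rw [← bR_eq_bL_inv]
    exact Prod.ext_iff
  rw [hmem, diagProj_bL_eq_iff, diagProj_bL_eq_iff, inv_inv]
  simp only [muL, muR, Matrix.toBlocks_fromBlocks₁₁, Matrix.toBlocks_fromBlocks₂₂, hs, hu,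
    Matrix.conjTranspose_one, Matrix.one_mul, Matrix.mul_one]
  rw [and_assoc]
  exact and_congr_right fun _ => and_congr_right fun _ => and_comm

end LevelSet

/-! ### The Gram matrix of `ν(x)` as a rank one perturbation of a scalar -/

section Nu

/-- The vector `w` with `ν ν† = e^{-x} 1 + (1 - e^{-x}) w w†`. -/
noncomputable def nuVec (n : ℕ) (x : ℝ) : Fin n → ℂ :=
  fun j => (Real.exp (((n : ℝ) - 1 - j) * x / 2) : ℂ)

/-- The factor `1 - exp (-x)` makes the geometric sum telescope. -/
theorem sum_exp_tail (n : ℕ) (x : ℝ) (k : ℕ) (hk : k < n) :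
    (1 - Real.exp (-x)) * ∑ l ∈ Finset.Ico (k + 1) n, Real.exp (l * x) =
      Real.exp (((n : ℝ) - 1) * x) - Real.exp (k * x) := by
  induction n, hk using Nat.le_induction with
  | base => simp
  | succ m hm ih =>
    rw [Finset.sum_Ico_succ_top (by omega), mul_add, ih]
    have : Real.exp (-x) * Real.exp (m * x) = Real.exp (((m : ℝ) - 1) * x) := by
      rw [← Real.exp_add]; congr 1; ring
    have h2 : (((m + 1 : ℕ) : ℝ) - 1) * x = m * x := by push_cast; ring
    rw [h2]
    linear_combination -this

/-- The powers in `ν` are such that the tail sums in the product are geometric and telescope to one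
product term. The rank one shape is what makes `ν` admissible: the constraint differs from a scalar
one only along `w`. -/
theorem nu_mul_conjTranspose (n : ℕ) (x : ℝ) : nu n x * (nu n x)ᴴ =
    (Real.exp (-x) : ℂ) • 1 + ((1 - Real.exp (-x) : ℝ) : ℂ) •
      Matrix.vecMulVec (nuVec n x) (star (nuVec n x)) := by
  set s := 1 - Real.exp (-x) with hs
  -- the entries on and above the diagonal
  have key : ∀ j k : Fin n, j ≤ k → ∑ l, (nu n x j l) * star (nu n x k l) =
      ((((if j = k then Real.exp (-x) else 0) +
        s * (Real.exp (((n : ℝ) - 1 - j) * x / 2) * Real.exp (((n : ℝ) - 1 - k) * x / 2)) : ℝ)) : ℂ) := by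
    intro j k hjk
    -- For `j ≤ k` only the terms with `l ≥ k` survive. The one with `l = k` contributes `ν_jk`,
    -- because `ν_kk = 1`.
    have h1 : ∑ l, (nu n x j l) * star (nu n x k l) =
        nu n x j k + ∑ l ∈ Finset.univ.filter (fun l => k < l),
          ((s * Real.exp (((l : ℝ) - j) * x / 2) * (s * Real.exp (((l : ℝ) - k) * x / 2)) : ℝ) : ℂ) := by
      rw [← Finset.sum_filter_add_sum_filter_not Finset.univ (fun l => k < l), add_comm]
      congr 1
      · rw [Finset.sum_eq_single k]
        · simp [nu]
        · intro l hl hlk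
          have : l < k := lt_of_le_of_ne (not_lt.1 (Finset.mem_filter.1 hl).2) hlk
          simp [nu, this.ne', this.not_gt]
        · simp
      · refine Finset.sum_congr rfl fun l hl => ?_
        have hkl : k < l := (Finset.mem_filter.1 hl).2
        have hjl := hjk.trans_lt hkl
        simp only [nu, Matrix.of_apply, hkl.ne, hjl.ne, hkl, hjl, if_true, if_false,
          Complex.star_def, Complex.conj_ofReal]
        rw [← Complex.ofReal_mul]
    have h2 : ∑ l ∈ Finset.univ.filter (fun l : Fin n => k < l),
          (s * Real.exp (((l : ℝ) - j) * x / 2) * (s * Real.exp (((l : ℝ) - k) * x / 2))) =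
        s * Real.exp (-((j : ℝ) + k) * x / 2) *
          (Real.exp (((n : ℝ) - 1) * x) - Real.exp (k * x)) := by
      rw [← sum_exp_tail n x k k.2, ← hs, Finset.mul_sum, Finset.mul_sum]
      have : ∑ l ∈ Finset.Ico ((k : ℕ) + 1) n, s * Real.exp (-((j : ℝ) + k) * x / 2) *
          (s * Real.exp (l * x)) = ∑ l ∈ Finset.univ.filter (fun l : Fin n => k < l),
          s * Real.exp (-((j : ℝ) + k) * x / 2) * (s * Real.exp ((l : ℕ) * x)) := by
        refine (Finset.sum_bij (fun (l : Fin n) _ => (l : ℕ)) ?_ ?_ ?_ ?_).symm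
        · intro l hl
          have : k < l := (Finset.mem_filter.1 hl).2
          exact Finset.mem_Ico.2 ⟨this, l.2⟩
        · intro a _ b _ h
          exact Fin.ext h
        · intro l hl
          have := Finset.mem_Ico.1 hl
          exact ⟨⟨l, this.2⟩, Finset.mem_filter.2 ⟨Finset.mem_univ _, this.1⟩, rfl⟩
        · intro l _
          rfl
      rw [this]
      refine Finset.sum_congr rfl fun l _ => ?_
      have : Real.exp (((l : ℝ) - j) * x / 2) * Real.exp (((l : ℝ) - k) * x / 2) =
          Real.exp (-((j : ℝ) + k) * x / 2) * Real.exp ((l : ℕ) * x) := by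
        rw [← Real.exp_add, ← Real.exp_add]; congr 1; ring
      linear_combination s * s * this
    have h3 : nu n x j k = ((if j = k then 1 else s * Real.exp (((k : ℝ) - j) * x / 2) : ℝ) : ℂ) := by
      rcases hjk.eq_or_lt with rfl | h
      · simp [nu]
      · simp only [nu, Matrix.of_apply, h.ne, if_false, h, if_true]
        rfl
    rw [h1, ← Complex.ofReal_sum, h2, h3, ← Complex.ofReal_add]
    congr 1
    have e1 : Real.exp (-((j : ℝ) + k) * x / 2) * Real.exp (((n : ℝ) - 1) * x) =
        Real.exp (((n : ℝ) - 1 - j) * x / 2) * Real.exp (((n : ℝ) - 1 - k) * x / 2) := by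
      rw [← Real.exp_add, ← Real.exp_add]; congr 1; ring
    have e2 : Real.exp (-((j : ℝ) + k) * x / 2) * Real.exp (k * x) =
        Real.exp (((k : ℝ) - j) * x / 2) := by
      rw [← Real.exp_add]; congr 1; ring
    by_cases hjk' : j = k
    · subst hjk'
      have e3 : Real.exp (((j : ℝ) - j) * x / 2) = 1 := by simp
      rw [e3] at e2
      simp only [if_true]
      rw [← e1, hs]
      linear_combination (-(1 - Real.exp (-x))) * e2
    · simp only [hjk', if_false]
      rw [← e1]
      linear_combination (-s) * e2
  ext j k
  rw [Matrix.mul_apply]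
  simp only [Matrix.conjTranspose_apply, Matrix.add_apply, Matrix.smul_apply, Matrix.one_apply,
    Matrix.vecMulVec_apply, Pi.star_apply, smul_eq_mul, nuVec, Complex.star_def,
    Complex.conj_ofReal]
  rcases le_total j k with h | h
  · have := key j k h
    simp only [Complex.star_def] at this
    rw [this]
    push_cast
    split_ifs <;> simp
  · have := key k j h
    have e : ∑ l, nu n x j l * (starRingEnd ℂ) (nu n x k l) =
        star (∑ l, nu n x k l * star (nu n x j l)) := by
      rw [star_sum]
      refine Finset.sum_congr rfl fun l _ => ?_
      rw [star_mul', star_star, mul_comm]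
      rfl
    rw [e, this, Complex.star_def, Complex.conj_ofReal]
    push_cast
    by_cases hh : j = k
    · simp [hh]
    · simp [hh, Ne.symm hh, mul_comm]

end Nu

/-! ### Inverses and commutants of rank one perturbations -/

section Stabilizers

variable {m : Type} [Fintype m] [DecidableEq m]

/-- Inverse of a rank one perturbation of a scalar matrix. -/
theorem exists_eq_of_mul_rank_one {X : Matrix m m ℂ} {w : m → ℂ} {a s q : ℂ} (ha : a ≠ 0)
    (hq : q ≠ 0) (h : X * (a • 1 + s • Matrix.vecMulVec w (star w)) = q • 1) :
    ∃ τ : ℂ, X = (a⁻¹ * q) • 1 + τ • Matrix.vecMulVec w (star w) := by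
  have hX : a • X + s • Matrix.vecMulVec (X *ᵥ w) (star w) = q • 1 := by
    rw [← h, Matrix.mul_add, Matrix.mul_smul, Matrix.mul_one, Matrix.mul_smul,
      Matrix.mul_vecMulVec]
  have hXw : (a + s * (star w ⬝ᵥ w)) • (X *ᵥ w) = q • w := by
    have := congrArg (fun Y => Y *ᵥ w) hX
    simp only [Matrix.add_mulVec, Matrix.smul_mulVec, Matrix.one_mulVec,
      Matrix.vecMulVec_mulVec] at this
    rw [← this, add_smul, mul_smul]
    simp
  -- Proportionality of `X w` and `w` makes the correction a multiple of `w w†`. If the coefficient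
  -- of `X w` in `hXw` vanishes, then `w = 0`.
  obtain ⟨r, hr⟩ : ∃ r : ℂ, X *ᵥ w = r • w := by
    by_cases hl : a + s * (star w ⬝ᵥ w) = 0
    · rw [hl, zero_smul] at hXw
      have hw : w = 0 := (smul_eq_zero.1 hXw.symm).resolve_left hq
      exact ⟨0, by rw [hw]; simp⟩
    · refine ⟨(a + s * (star w ⬝ᵥ w))⁻¹ * q, ?_⟩
      rw [mul_smul, ← hXw, smul_smul, inv_mul_cancel₀ hl, one_smul]
  rw [hr, Matrix.smul_vecMulVec] at hX
  refine ⟨-(a⁻¹ * (s * r)), ?_⟩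
  have h1 : X = a⁻¹ • (a • X) := by rw [smul_smul, inv_mul_cancel₀ ha, one_smul]
  rw [h1, eq_sub_of_add_eq hX, smul_sub, smul_smul, smul_smul, smul_smul, neg_smul, sub_eq_add_neg,
    mul_assoc]

/-- As `s ≠ 0`, `A` commutes with `w w†` and so preserves the line of `w`. The eigenvalue is the
Rayleigh quotient of `A` at `w`, hence real. -/
theorem exists_eigenvalue_of_commute_rank_one {A : Matrix m m ℂ} (hA : A.IsHermitian) {w : m → ℂ}
    {a s : ℂ} (hs : s ≠ 0) (h : A * (a • 1 + s • Matrix.vecMulVec w (star w)) =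
      (a • 1 + s • Matrix.vecMulVec w (star w)) * A) : ∃ θ : ℝ, A *ᵥ w = (θ : ℂ) • w := by
  by_cases hw : w = 0
  · exact ⟨0, by rw [hw]; simp⟩
  have h1 : Matrix.vecMulVec (A *ᵥ w) (star w) = Matrix.vecMulVec w (star w) * A := by
    rw [Matrix.mul_add, Matrix.add_mul, Matrix.mul_smul, Matrix.smul_mul, Matrix.mul_one,
      Matrix.one_mul, Matrix.mul_smul, Matrix.smul_mul, add_right_inj, smul_right_inj hs,
      Matrix.mul_vecMulVec] at h
    exact h
  have h2 := congrArg (fun Y => Y *ᵥ w) h1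
  simp only [Matrix.vecMulVec_mulVec, ← Matrix.mulVec_mulVec, star_dotProduct_self] at h2
  have hN : (normSqVec w : ℂ) ≠ 0 := by exact_mod_cast (normSqVec_pos hw).ne'
  have hreal : (starRingEnd ℂ) (star w ⬝ᵥ A *ᵥ w) = star w ⬝ᵥ A *ᵥ w := by
    rw [starRingEnd_apply, ← Matrix.star_dotProduct_star, star_star, Matrix.star_mulVec, hA.eq,
      dotProduct_comm, Matrix.dotProduct_mulVec, dotProduct_comm]
  obtain ⟨t, ht⟩ := Complex.conj_eq_iff_real.1 hreal
  refine ⟨t / normSqVec w, ?_⟩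
  have h3 : (normSqVec w : ℂ) • (A *ᵥ w) = (t : ℂ) • w := by
    rw [ht] at h2
    simpa using h2
  rw [Complex.ofReal_div, div_eq_inv_mul, mul_smul, ← h3, smul_smul, inv_mul_cancel₀ hN, one_smul]

end Stabilizers

/-! ### Stabilizers of points of the constraint surface -/

section LevelSetStabilizer

variable {n : ℕ} {u v x : ℝ} {K : SL2n n}

theorem det_nu (n : ℕ) (x : ℝ) : (nu n x).det = 1 := by
  rw [Matrix.det_of_isUpperTriangular (fun i j (h : j < i) => by simp [nu, h.ne', h.not_gt])]
  simp [nu]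

/-- The block is `exp (-2u)` times the inverse of `ν ν†`, and inverting a rank one perturbation
keeps its shape. The scalar part `exp (-γ)` with `γ = 2u - x` is the only place where `x` enters the
spectral argument. -/
theorem exists_left11_of_mem_levelSet (hK : K ∈ levelSet (mu n u v x)) :
    ∃ τ : ℂ, ((K⁻¹).1ᴴ * (K⁻¹).1).toBlocks₁₁ = (Real.exp (2 * u - x) : ℂ)⁻¹ • 1 +
      τ • Matrix.vecMulVec (nuVec n x) (star (nuVec n x)) := by
  obtain ⟨-, h, -, -⟩ := (mem_levelSet_mu_iff K).1 hK
  set X := ((K⁻¹).1ᴴ * (K⁻¹).1).toBlocks₁₁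
  have hν : IsUnit (nu n x)ᴴ := by
    rw [Matrix.isUnit_iff_isUnit_det, Matrix.det_conjTranspose, det_nu]
    simp
  have h1 : X * (nu n x * (nu n x)ᴴ) = (Real.exp (-2 * u) : ℂ) • 1 := by
    apply hν.mul_left_cancel
    rw [← Matrix.mul_assoc, ← Matrix.mul_assoc, h]
    simp
  rw [nu_mul_conjTranspose] at h1
  obtain ⟨τ, hτ⟩ := exists_eq_of_mul_rank_one (by exact_mod_cast (Real.exp_pos _).ne')
    (by exact_mod_cast (Real.exp_pos _).ne') h1
  refine ⟨τ, ?_⟩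
  rw [hτ]
  congr 2
  rw [← Complex.ofReal_inv, ← Complex.ofReal_inv, ← Complex.ofReal_mul, ← Real.exp_neg,
    ← Real.exp_neg, ← Real.exp_add]
  congr 2
  ring

/-- Rigidity with `α = -2v`, `β = -2u`, `γ = 2u - x`. Then `u < v` is `α < β`, `v ≠ -u` is `β ≠ -α`,
and `β + γ = -x`. Moreover `x ≠ 0` makes the rank one part of `ν ν†` nonzero, so that `w` is an
eigenvector of `A₁`. -/
theorem stabilizer_scalar_of_mem_levelSet (huv : u < v) (hvu : v ≠ -u) (hx : x ≠ 0)
    (hK : K ∈ levelSet (mu n u v x)) {A₁ A₂ C₁ C₂ : Matrix (Fin n) (Fin n) ℂ}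
    (hA₁ : A₁.IsHermitian) (hA₂ : A₂.IsHermitian) (hC₁ : C₁.IsHermitian) (hC₂ : C₂.IsHermitian)
    (hAK : Matrix.fromBlocks A₁ 0 0 A₂ * K.1 = K.1 * Matrix.fromBlocks C₁ 0 0 C₂)
    (hν : A₁ * (nu n x * (nu n x)ᴴ) = nu n x * (nu n x)ᴴ * A₁) :
    ∃ θ : ℝ, Matrix.fromBlocks A₁ 0 0 A₂ = (θ : ℂ) • 1 ∧
      Matrix.fromBlocks C₁ 0 0 C₂ = (θ : ℂ) • 1 := by
  obtain ⟨τ, hτ⟩ := exists_left11_of_mem_levelSet hK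
  obtain ⟨h1, -, h3, h4⟩ := (mem_levelSet_mu_iff K).1 hK
  rw [nu_mul_conjTranspose] at hν
  have hs : ((1 - Real.exp (-x) : ℝ) : ℂ) ≠ 0 := by
    rw [Complex.ofReal_ne_zero, sub_ne_zero]
    intro h
    have := (Real.exp_eq_one_iff _).1 h.symm
    exact hx (neg_eq_zero.1 this)
  obtain ⟨θ, hθ⟩ := exists_eigenvalue_of_commute_rank_one hA₁ hs hν
  refine ⟨θ, stabilizer_scalar (coe_mul_coe_inv K) (coe_inv_mul_coe K) h1 hτ h3 h4 ?_ ?_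
    hA₁ hA₂ hC₁ hC₂ hAK hθ⟩
  · intro h
    exact hx (by linarith)
  · rcases lt_or_gt_of_ne hvu with h | h
    · exact Or.inr ⟨by linarith, by linarith⟩
    · exact Or.inl ⟨by linarith, by linarith⟩

/-- A matrix is determined to be scalar by its Hermitian and skew Hermitian part. -/
theorem eq_smul_one_of_hermitian_parts {m : Type*} [DecidableEq m] {g : Matrix m m ℂ} {s t : ℂ}
    (h1 : g + gᴴ = s • 1) (h2 : Complex.I • (g - gᴴ) = t • 1) :
    g = ((s - Complex.I * t) / 2) • 1 := by
  have h3 : g - gᴴ = -(Complex.I * t) • 1 := by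
    have := congrArg (fun X => Complex.I • X) h2
    simp only [smul_smul, Complex.I_mul_I] at this
    rw [neg_smul, ← this, neg_one_smul, neg_neg]
  have h4 : (2 : ℂ) • g = (s - Complex.I * t) • 1 := by
    rw [sub_eq_add_neg, add_smul, ← h1, ← h3, two_smul]
    abel
  rw [div_eq_inv_mul, mul_smul, ← h4, smul_smul, inv_mul_cancel₀ two_ne_zero, one_smul]

/-- By unitarity the adjoints of `η_L`, `η_R` are intertwined by `K` as well, so rigidity applies to
their Hermitian parts and to `i` times their skew Hermitian parts. -/
theorem smul_eq_of_smul_eq (huv : u < v) (hvu : v ≠ -u) (hx : x ≠ 0)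
    (hK : K ∈ levelSet (mu n u v x)) (g : isotropy (mu n u v x)) (hg : g • K = K) (q : SL2n n) :
    g • q = q := by
  obtain ⟨⟨ηL, ηR⟩, hη⟩ := g
  have hL : ηL ∈ dressingIsotropy (muL n u x) := hη.1
  rw [mem_dressingIsotropy_muL] at hL
  have hgK : ηL.1 * K * ηR.1⁻¹ = K := hg
  have hLi : (ηL.1⁻¹).1 = ηL.1.1ᴴ := coe_inv_of_mem_SU ηL.2.1
  have hRi : (ηR.1⁻¹).1 = ηR.1.1ᴴ := coe_inv_of_mem_SU ηR.2.1
  set a := ηL.1.1.toBlocks₁₁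
  set d := ηL.1.1.toBlocks₂₂
  set a' := ηR.1.1.toBlocks₁₁
  set d' := ηR.1.1.toBlocks₂₂
  have eL : ηL.1.1 = Matrix.fromBlocks a 0 0 d := (Gplus_eq_fromBlocks ηL.2).symm
  have eR : ηR.1.1 = Matrix.fromBlocks a' 0 0 d' := (Gplus_eq_fromBlocks ηR.2).symm
  have eLi : (ηL.1⁻¹).1 = Matrix.fromBlocks aᴴ 0 0 dᴴ := by
    rw [hLi, eL, Matrix.fromBlocks_conjTranspose]; simp
  have eRi : (ηR.1⁻¹).1 = Matrix.fromBlocks a'ᴴ 0 0 d'ᴴ := by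
    rw [hRi, eR, Matrix.fromBlocks_conjTranspose]; simp
  have k1 : Matrix.fromBlocks a 0 0 d * K.1 = K.1 * Matrix.fromBlocks a' 0 0 d' := by
    rw [← eL, ← eR, ← Matrix.SpecialLinearGroup.coe_mul, ← Matrix.SpecialLinearGroup.coe_mul]
    exact congrArg Subtype.val (mul_inv_eq_iff_eq_mul.1 hgK)
  have k2 : Matrix.fromBlocks aᴴ 0 0 dᴴ * K.1 = K.1 * Matrix.fromBlocks a'ᴴ 0 0 d'ᴴ := by
    rw [← eLi, ← eRi, ← Matrix.SpecialLinearGroup.coe_mul, ← Matrix.SpecialLinearGroup.coe_mul]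
    have : ηL.1⁻¹ * K = K * ηR.1⁻¹ := by
      rw [inv_mul_eq_iff_eq_mul, ← mul_assoc]
      exact hgK.symm
    exact congrArg Subtype.val this
  have ha : a * aᴴ = 1 := by
    have := coe_mul_coe_inv ηL.1
    rw [eL, eLi, Matrix.fromBlocks_multiply, ← Matrix.fromBlocks_one, Matrix.fromBlocks_inj] at this
    simpa using this.1
  have n1 : a * (nu n x * (nu n x)ᴴ) = nu n x * (nu n x)ᴴ * a := by
    have h0 : ((ηL⁻¹).1.1).toBlocks₁₁ = aᴴ := by
      change ((ηL.1⁻¹).1).toBlocks₁₁ = aᴴ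
      rw [hLi]; rfl
    rw [h0] at hL
    have := congrArg (fun X => X * a) hL
    simpa only [Matrix.mul_assoc, mul_eq_one_comm.1 ha, Matrix.mul_one] using this
  have n2 : aᴴ * (nu n x * (nu n x)ᴴ) = nu n x * (nu n x)ᴴ * aᴴ := by
    have := congrArg Matrix.conjTranspose n1
    simpa only [Matrix.conjTranspose_mul, Matrix.conjTranspose_conjTranspose,
      Matrix.mul_assoc] using this.symm
  have hh : ∀ b : Matrix (Fin n) (Fin n) ℂ, (b + bᴴ).IsHermitian := fun b => by
    rw [Matrix.IsHermitian, Matrix.conjTranspose_add, Matrix.conjTranspose_conjTranspose, add_comm]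
  have hi : ∀ b : Matrix (Fin n) (Fin n) ℂ, (Complex.I • (b - bᴴ)).IsHermitian := fun b => by
    rw [Matrix.IsHermitian, Matrix.conjTranspose_smul, Matrix.conjTranspose_sub,
      Matrix.conjTranspose_conjTranspose, Complex.star_def, Complex.conj_I, neg_smul, ← smul_neg,
      neg_sub]
  have s1 : ∀ b c : Matrix (Fin n) (Fin n) ℂ, Matrix.fromBlocks (b + bᴴ) 0 0 (c + cᴴ) =
      Matrix.fromBlocks b 0 0 c + Matrix.fromBlocks bᴴ 0 0 cᴴ := fun b c => by
    rw [Matrix.fromBlocks_add]; simp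
  have s2 : ∀ b c : Matrix (Fin n) (Fin n) ℂ,
      Matrix.fromBlocks (Complex.I • (b - bᴴ)) 0 0 (Complex.I • (c - cᴴ)) =
      Complex.I • (Matrix.fromBlocks b 0 0 c - Matrix.fromBlocks bᴴ 0 0 cᴴ) := fun b c => by
    rw [sub_eq_add_neg (Matrix.fromBlocks b 0 0 c), Matrix.fromBlocks_neg, Matrix.fromBlocks_add,
      Matrix.fromBlocks_smul]
    simp [sub_eq_add_neg]
  obtain ⟨θ, t1, t2⟩ := stabilizer_scalar_of_mem_levelSet huv hvu hx hK (hh a) (hh d) (hh a')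
    (hh d') (by rw [s1, s1, Matrix.add_mul, Matrix.mul_add, k1, k2])
    (by rw [Matrix.add_mul, Matrix.mul_add, n1, n2])
  obtain ⟨θ', t3, t4⟩ := stabilizer_scalar_of_mem_levelSet huv hvu hx hK (hi a) (hi d) (hi a')
    (hi d') (by rw [s2, s2, Matrix.smul_mul, Matrix.mul_smul, Matrix.sub_mul, Matrix.mul_sub,
      k1, k2])
    (by rw [Matrix.smul_mul, Matrix.mul_smul, Matrix.sub_mul, Matrix.mul_sub, n1, n2])
  rw [s1, ← eL, ← eLi, hLi] at t1
  rw [s1, ← eR, ← eRi, hRi] at t2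
  rw [s2, ← eL, ← eLi, hLi] at t3
  rw [s2, ← eR, ← eRi, hRi] at t4
  -- The scalars `θ`, `θ'` are common to both sides, so `η_L` and `η_R` are the same scalar matrix
  -- and cancel in the action.
  have f1 := eq_smul_one_of_hermitian_parts t1 t3
  have f2 := eq_smul_one_of_hermitian_parts t2 t4
  change ηL.1 * q * ηR.1⁻¹ = q
  rw [mul_inv_eq_iff_eq_mul]
  apply Subtype.ext
  rw [Matrix.SpecialLinearGroup.coe_mul, Matrix.SpecialLinearGroup.coe_mul, f1, f2]
  simp

end LevelSetStabilizer

/-! ### The matrix exponential -/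

section Exponential

open scoped Matrix.Norms.Operator
open NormedSpace Filter Topology

variable {m : Type} [Fintype m] [DecidableEq m]

theorem contDiff_matrix_exp : ContDiff ℝ ∞ (exp : Matrix m m ℂ → Matrix m m ℂ) :=
  contDiff_iff_contDiffAt.2 fun A => (exp_analytic (𝕂 := ℝ) A).contDiffAt

theorem hasFDerivAt_matrix_exp_zero : HasFDerivAt (exp : Matrix m m ℂ → Matrix m m ℂ)
    (ContinuousLinearMap.id ℝ (Matrix m m ℂ)) 0 := by
  have := hasFDerivAt_exp_zero (𝕂 := ℝ) (𝔸 := Matrix m m ℂ)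
  exact this

theorem contDiff_matrix_det : ContDiff ℝ ∞ (Matrix.det : Matrix m m ℂ → ℂ) := by
  have : (Matrix.det : Matrix m m ℂ → ℂ) =
      fun A => ∑ σ : Equiv.Perm m, (σ.sign : ℤ) • ∏ i, A (σ i) i := funext fun A => by
    rw [Matrix.det_apply]; rfl
  rw [this]
  refine ContDiff.sum fun σ _ => ContDiff.const_smul _ (contDiff_prod fun i _ => ?_)
  exact (Matrix.entryLinearMap ℝ ℂ (σ i) i).toContinuousLinearMap.contDiff

/-- Read off from the expansion of `det (1 + tA)` as `1 + t tr A` plus a multiple of `t²`. -/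
theorem fderiv_matrix_det_one (A : Matrix m m ℂ) :
    fderiv ℝ (Matrix.det : Matrix m m ℂ → ℂ) 1 A = A.trace := by
  have hd : HasFDerivAt (Matrix.det : Matrix m m ℂ → ℂ) (fderiv ℝ Matrix.det 1)
      ((1 : Matrix m m ℂ) + (0 : ℝ) • A) := by
    rw [zero_smul, add_zero]
    exact (contDiff_matrix_det.differentiable (by simp) _).hasFDerivAt
  have h1 : HasDerivAt (fun t : ℝ => (1 : Matrix m m ℂ) + t • A) A 0 := by
    have := ((hasDerivAt_id (0 : ℝ)).smul_const A).const_add 1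
    rw [one_smul] at this
    exact this
  have h2 := hd.comp_hasDerivAt (0 : ℝ) h1
  have h3 : HasDerivAt (fun t : ℝ => (Matrix.det ((1 : Matrix m m ℂ) + t • A))) A.trace 0 := by
    have e : (fun t : ℝ => (Matrix.det ((1 : Matrix m m ℂ) + t • A))) = fun t : ℝ =>
        1 + A.trace * (t : ℂ) +
          (((1 + (Polynomial.X : Polynomial ℂ) • A.map Polynomial.C).det.divX.divX).eval (t : ℂ)) *
            (t : ℂ) ^ 2 := by
      funext t
      have := Matrix.det_one_add_smul (t : ℂ) A
      rw [← this]
      congr 2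
    rw [e]
    have ho : HasDerivAt (fun t : ℝ => (t : ℂ)) 1 0 := by
      simpa using (hasDerivAt_id (0 : ℝ)).ofReal_comp
    have hp := ((Polynomial.hasDerivAt ((1 + (Polynomial.X : Polynomial ℂ) •
      A.map Polynomial.C).det.divX.divX) (((0 : ℝ) : ℂ))).scomp (0 : ℝ) ho).mul (ho.pow 2)
    have := ((ho.const_mul A.trace).const_add 1).add hp
    convert! this using 1
    simp
  exact h2.unique h3

/-- The determinant of the exponential of a matrix. -/
theorem det_matrix_exp (A : Matrix m m ℂ) : (exp A).det = Complex.exp A.trace := by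
  -- `f` is multiplicative, so its derivative at `0` yields `f' = tr A · f` everywhere; then `f t *
  -- exp (-t tr A)` is constant.
  let f : ℝ → ℂ := fun t => (exp (t • A)).det
  have hadd : ∀ s t : ℝ, f (s + t) = f s * f t := by
    intro s t
    change (exp ((s + t) • A)).det = (exp (s • A)).det * (exp (t • A)).det
    rw [add_smul, Matrix.exp_add_of_commute _ _ (((Commute.refl A).smul_left s).smul_right t),
      Matrix.det_mul]
  have hf0 : HasDerivAt f A.trace 0 := by
    have h1 : HasDerivAt (fun t : ℝ => t • A) A 0 := by
      have := (hasDerivAt_id (0 : ℝ)).smul_const A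
      rw [one_smul] at this
      exact this
    have h2 : HasFDerivAt (exp : Matrix m m ℂ → Matrix m m ℂ)
        (ContinuousLinearMap.id ℝ (Matrix m m ℂ)) ((0 : ℝ) • A) := by
      rw [zero_smul]; exact hasFDerivAt_matrix_exp_zero
    have h3 := h2.comp_hasDerivAt (0 : ℝ) h1
    have h4 : HasFDerivAt (Matrix.det : Matrix m m ℂ → ℂ) (fderiv ℝ Matrix.det 1)
        (exp ((0 : ℝ) • A)) := by
      rw [zero_smul, exp_zero]
      exact (contDiff_matrix_det.differentiable (by simp) _).hasFDerivAt
    have h5 := h4.comp_hasDerivAt (0 : ℝ) h3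
    rw [← fderiv_matrix_det_one]
    exact h5
  have hf : ∀ t, HasDerivAt f (A.trace * f t) t := by
    intro t
    have h1 : HasDerivAt (fun s : ℝ => f (s - t) * f t) (A.trace * f t) t := by
      have h2 : HasDerivAt (fun s : ℝ => f (s - t)) A.trace t := by
        have h3 : HasDerivAt f A.trace (t - t) := by rw [sub_self]; exact hf0
        exact h3.comp_sub_const t t
      exact h2.mul_const _
    have : f = fun s : ℝ => f (s - t) * f t := by
      funext s
      rw [← hadd, sub_add_cancel]
    rw [this]
    simpa [sub_self, ← hadd] using h1
  let g : ℝ → ℂ := fun t => f t * Complex.exp (-(t * A.trace))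
  have hg : ∀ t, HasDerivAt g 0 t := by
    intro t
    have h1 : HasDerivAt (fun t : ℝ => Complex.exp (-((t : ℂ) * A.trace)))
        (Complex.exp (-((t : ℂ) * A.trace)) * (-A.trace)) t := by
      have ho : HasDerivAt (fun t : ℝ => (t : ℂ)) 1 t := by
        simpa using (hasDerivAt_id t).ofReal_comp
      have := (ho.mul_const A.trace).neg.cexp
      simpa using this
    have := (hf t).mul h1
    convert! this using 1
    ring
  have hc := is_const_of_deriv_eq_zero (fun t => (hg t).differentiableAt)
    (fun t => (hg t).deriv) 1 0
  have h0 : g 0 = 1 := by simp [g, f]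
  have h1 : g 1 = (exp A).det * Complex.exp (-A.trace) := by simp [g, f]
  rw [h0, h1, Complex.exp_neg] at hc
  exact (mul_inv_eq_one₀ (Complex.exp_ne_zero _)).1 hc

theorem exp_mul_exp_neg (A : Matrix m m ℂ) : exp A * exp (-A) = 1 := by
  rw [← Matrix.exp_add_of_commute _ _ ((Commute.refl A).neg_right), add_neg_cancel, exp_zero]

theorem exp_neg_mul_exp (A : Matrix m m ℂ) : exp (-A) * exp A = 1 :=
  mul_eq_one_comm.1 (exp_mul_exp_neg A)

/-- Near the identity, a unitary matrix of determinant one which commutes with `P` is the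
exponential of a skew Hermitian traceless matrix commuting with `P`. -/
theorem eventually_exists_log {P Pi : Matrix m m ℂ} (hP : P * Pi = 1) {W : Set (Matrix m m ℂ)}
    (hW : W ∈ 𝓝 0) : ∀ᶠ g in 𝓝 (1 : Matrix m m ℂ), gᴴ * g = 1 → g.det = 1 → g * P = P * g →
      ∃ ξ ∈ W, ξᴴ = -ξ ∧ ξ.trace = 0 ∧ ξ * P = P * ξ ∧ exp ξ = g := by
  obtain ⟨h, h0, -, hh, -, -⟩ := exists_openPartialHomeomorph_of_contDiff
    (contDiff_matrix_exp (m := m)) (a := 0) (f' := ContinuousLinearEquiv.refl ℝ (Matrix m m ℂ))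
    hasFDerivAt_matrix_exp_zero isOpen_univ (Set.mem_univ _)
  have hh0 : h 0 = 1 := by rw [hh, exp_zero]
  have ht : (1 : Matrix m m ℂ) ∈ h.target := by rw [← hh0]; exact h.map_source h0
  have hs0 : h.symm 1 = 0 := by rw [← hh0, h.left_inv h0]
  have hc : ContinuousAt h.symm 1 := h.symm.continuousAt ht
  -- The other candidates `-ξᴴ` and `P ξ P⁻¹` for a logarithm must stay where `exp` is injective, so
  -- that they equal `ξ`. The bound on the trace excludes the nonzero multiples of `2πi` allowed by
  -- `det g = 1`.
  have hV : ∀ᶠ ξ in 𝓝 (0 : Matrix m m ℂ), ξ ∈ W ∧ -ξᴴ ∈ h.source ∧ P * ξ * Pi ∈ h.source ∧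
      ‖ξ.trace‖ < 2 * Real.pi := by
    have c1 : Continuous fun ξ : Matrix m m ℂ => -ξᴴ := continuous_id.matrix_conjTranspose.neg
    have c2 : Continuous fun ξ : Matrix m m ℂ => P * ξ * Pi := by fun_prop
    have c3 : Continuous fun ξ : Matrix m m ℂ => ‖ξ.trace‖ := continuous_id.matrix_trace.norm
    refine (eventually_mem_set.2 hW).and (((c1.tendsto 0).eventually
      (h.open_source.mem_nhds (by simpa using h0))).and (((c2.tendsto 0).eventually
      (h.open_source.mem_nhds (by simpa using h0))).and ((c3.tendsto 0).eventually
      (gt_mem_nhds (by simp [Real.pi_pos])))))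
  have hV' := hc.eventually (by rw [hs0]; exact hV)
  filter_upwards [hV', h.open_target.mem_nhds ht] with g hg hgt hu hd hP'
  obtain ⟨h1, h2, h3, h4⟩ := hg
  set ξ := h.symm g
  have hξ : ξ ∈ h.source := h.map_target hgt
  have hexp : exp ξ = g := by rw [← hh]; exact h.right_inv hgt
  have hinj : ∀ ζ ∈ h.source, exp ζ = g → ζ = ξ := by
    intro ζ hζ e
    apply h.injOn hζ hξ
    rw [hh, hh, e, hexp]
  have hPi : Pi * P = 1 := mul_eq_one_comm.1 hP
  refine ⟨ξ, h1, ?_, ?_, ?_, hexp⟩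
  · rw [eq_neg_iff_add_eq_zero, ← neg_eq_iff_add_eq_zero]
    refine hinj _ h2 ?_
    have e : exp ξᴴ = gᴴ := by rw [Matrix.exp_conjTranspose, hexp]
    calc exp (-ξᴴ) = g * gᴴ * exp (-ξᴴ) := by rw [mul_eq_one_comm.1 hu, Matrix.one_mul]
      _ = g := by rw [← e, Matrix.mul_assoc, exp_mul_exp_neg, Matrix.mul_one]
  · have e := det_matrix_exp ξ
    rw [hexp, hd] at e
    obtain ⟨k, hk⟩ := Complex.exp_eq_one_iff.1 e.symm
    rw [hk] at h4 ⊢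
    have hk0 : k = 0 := by
      by_contra hne
      have h5 : (1 : ℝ) ≤ |(k : ℝ)| := by
        rw [← Int.cast_abs]
        exact_mod_cast Int.one_le_abs hne
      have h6 : ‖(k : ℂ) * (2 * Real.pi * Complex.I)‖ = |(k : ℝ)| * (2 * Real.pi) := by
        simp [abs_of_pos Real.pi_pos]
      rw [h6] at h4
      nlinarith [Real.pi_pos]
    rw [hk0]
    simp
  · have e : P * ξ * Pi = ξ := by
      refine hinj _ h3 ?_
      have hPu : IsUnit P := ⟨⟨P, Pi, hP, hPi⟩, rfl⟩
      have hinv : Pi = P⁻¹ := (Matrix.inv_eq_right_inv hP).symm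
      rw [hinv, Matrix.exp_conj _ _ hPu, hexp, ← hP', Matrix.mul_assoc, ← hinv, hP, Matrix.mul_one]
    calc ξ * P = P * ξ * Pi * P := by rw [e]
      _ = P * ξ := by rw [Matrix.mul_assoc, hPi, Matrix.mul_one]

end Exponential

/-! ### The isotropy group and its Lie algebra -/

section Isotropy

open Filter Topology

section Blocks

variable {m : Type} [Fintype m] [DecidableEq m]

/-- The block diagonal matrix `diag(S S†, -1)`. Commuting with it means being block diagonal with
first block commuting with `S S†`. -/
def signMatrix (S : Matrix m m ℂ) : Matrix (m ⊕ m) (m ⊕ m) ℂ :=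
  Matrix.fromBlocks (S * Sᴴ) 0 0 (-1)

/-- `S Sᴴ` is positive semidefinite and so has no eigenvalue `-1`. -/
theorem eq_zero_of_gram_mul_eq_neg {S b : Matrix m m ℂ} (h : S * Sᴴ * b = -b) : b = 0 := by
  ext i j
  have h1 : S *ᵥ (Sᴴ *ᵥ fun i => b i j) = -fun i => b i j := by
    rw [Matrix.mulVec_mulVec]
    exact funext fun i => congrFun (congrFun h i) j
  set φ : m → ℂ := fun i => b i j
  have h2 := star_dotProduct_conjTranspose_mul Sᴴ φ
  rw [Matrix.conjTranspose_conjTranspose, h1, dotProduct_neg, star_dotProduct_self] at h2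
  have h3 : -normSqVec φ = normSqVec (Sᴴ *ᵥ φ) := by exact_mod_cast h2
  have h4 : normSqVec φ = 0 := by
    have := normSqVec_nonneg φ
    have := normSqVec_nonneg (Sᴴ *ᵥ φ)
    linarith
  exact congrFun (normSqVec_eq_zero.1 h4) i

/-- The two diagonal blocks of `signMatrix S` have disjoint spectra, which forces block diagonality.
Both isotropy factors thereby become unitary commutants of a single matrix, a condition the
exponential respects. -/
theorem commute_signMatrix_iff {S : Matrix m m ℂ} {X : Matrix (m ⊕ m) (m ⊕ m) ℂ} :
    X * signMatrix S = signMatrix S * X ↔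
      X.toBlocks₁₂ = 0 ∧ X.toBlocks₂₁ = 0 ∧ X.toBlocks₁₁ * (S * Sᴴ) = S * Sᴴ * X.toBlocks₁₁ := by
  have h : X * signMatrix S = signMatrix S * X ↔
      X.toBlocks₁₁ * (S * Sᴴ) = S * Sᴴ * X.toBlocks₁₁ ∧ -X.toBlocks₁₂ = S * Sᴴ * X.toBlocks₁₂ ∧
        X.toBlocks₂₁ * (S * Sᴴ) = -X.toBlocks₂₁ := by
    conv_lhs => rw [← Matrix.fromBlocks_toBlocks X, signMatrix, Matrix.fromBlocks_multiply,
      Matrix.fromBlocks_multiply, Matrix.fromBlocks_inj]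
    simp
  rw [h]
  constructor
  · rintro ⟨h1, h2, h3⟩
    refine ⟨eq_zero_of_gram_mul_eq_neg h2.symm, ?_, h1⟩
    rw [← Matrix.conjTranspose_eq_zero]
    refine eq_zero_of_gram_mul_eq_neg (S := S) ?_
    have := congrArg Matrix.conjTranspose h3
    simpa [Matrix.mul_assoc] using this
  · rintro ⟨h1, h2, h3⟩
    simp [h1, h2, h3]

theorem signMatrix_mul_inv {S T : Matrix m m ℂ} (h : S * T = 1) :
    signMatrix S * Matrix.fromBlocks (Tᴴ * T) 0 0 (-1) = 1 := by
  have h' : S * Sᴴ * (Tᴴ * T) = 1 := by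
    calc S * Sᴴ * (Tᴴ * T) = S * (T * S)ᴴ * T := by
          simp only [Matrix.conjTranspose_mul, Matrix.mul_assoc]
      _ = 1 := by rw [mul_eq_one_comm.1 h, Matrix.conjTranspose_one, Matrix.mul_one, h]
  rw [signMatrix, Matrix.fromBlocks_multiply, h']
  simp

/-- The skew Hermitian traceless matrices commuting with `P`. -/
def skewAlgebra (P : Matrix m m ℂ) : Submodule ℝ (Matrix m m ℂ) where
  carrier := {ξ | ξᴴ = -ξ ∧ ξ.trace = 0 ∧ ξ * P = P * ξ}
  add_mem' := by
    rintro a b ⟨h1, h2, h3⟩ ⟨h4, h5, h6⟩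
    refine ⟨?_, ?_, ?_⟩
    · rw [Matrix.conjTranspose_add, h1, h4, neg_add]
    · rw [Matrix.trace_add, h2, h5, add_zero]
    · rw [Matrix.add_mul, Matrix.mul_add, h3, h6]
  zero_mem' := by simp
  smul_mem' := by
    rintro c a ⟨h1, h2, h3⟩
    refine ⟨?_, ?_, ?_⟩
    · rw [Matrix.conjTranspose_smul, h1, star_trivial, smul_neg]
    · rw [Matrix.trace_smul, h2, smul_zero]
    · rw [Matrix.smul_mul, Matrix.mul_smul, h3]

/-- Closed, and bounded because the entries of a unitary matrix have modulus at most `1`. -/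
theorem isCompact_unitary_commutant (P : Matrix m m ℂ) :
    IsCompact {g : Matrix m m ℂ | gᴴ * g = 1 ∧ g.det = 1 ∧ g * P = P * g} := by
  have hK : IsCompact (Set.pi Set.univ fun _ : m => Set.pi Set.univ fun _ : m =>
      Metric.closedBall (0 : ℂ) 1) :=
    isCompact_univ_pi fun _ => isCompact_univ_pi fun _ => isCompact_closedBall _ _
  refine IsCompact.of_isClosed_subset (X := Matrix m m ℂ) hK ?_ ?_
  · refine IsClosed.inter (isClosed_eq ?_ continuous_const) (IsClosed.inter
      (isClosed_eq ?_ continuous_const) (isClosed_eq ?_ ?_))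
    · exact continuous_id.matrix_conjTranspose.matrix_mul continuous_id
    · exact continuous_id.matrix_det
    · exact continuous_id.matrix_mul continuous_const
    · exact continuous_const.matrix_mul continuous_id
  · rintro g ⟨hg, -, -⟩ i - j -
    rw [mem_closedBall_zero_iff]
    exact entry_norm_bound_of_unitary (Matrix.mem_unitaryGroup_iff'.2 hg) i j

end Blocks

/-! ### The isotropy group as a compact group of pairs of matrices -/

variable {n : ℕ} {u v x : ℝ}

theorem mem_Gplus_iff {g : SL2n n} :
    g ∈ Gplus n ↔ g.1ᴴ * g.1 = 1 ∧ g.1 * signMatrix 1 = signMatrix 1 * g.1 := by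
  rw [commute_signMatrix_iff]
  constructor
  · rintro ⟨h1, h2, h3⟩
    exact ⟨h1, h2, h3, by simp⟩
  · rintro ⟨h1, h2, h3, -⟩
    exact ⟨h1, h2, h3⟩

theorem mem_dressingIsotropy_muL_iff {g : SL2n n} :
    (∃ h : g ∈ Gplus n, (⟨g, h⟩ : Gplus n) ∈ dressingIsotropy (muL n u x)) ↔
      g.1ᴴ * g.1 = 1 ∧ g.1 * signMatrix (nu n x) = signMatrix (nu n x) * g.1 := by
  have key : ∀ h : g ∈ Gplus n, (⟨g, h⟩ : Gplus n) ∈ dressingIsotropy (muL n u x) ↔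
      g.1.toBlocks₁₁ * (nu n x * (nu n x)ᴴ) = nu n x * (nu n x)ᴴ * g.1.toBlocks₁₁ := by
    intro h
    rw [mem_dressingIsotropy_muL]
    have h0 : ((⟨g, h⟩ : Gplus n)⁻¹).1.1.toBlocks₁₁ = g.1.toBlocks₁₁ᴴ := by
      change (g⁻¹).1.toBlocks₁₁ = _
      rw [coe_inv_of_mem_SU h.1]; rfl
    have h1 : g.1.toBlocks₁₁ᴴ * g.1.toBlocks₁₁ = 1 := by
      have := (toBlocks_mul g.1ᴴ g.1).1
      rw [show g.1ᴴ * g.1 = 1 from h.1, h.2.2, Matrix.mul_zero, add_zero, ← Matrix.fromBlocks_one,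
        Matrix.toBlocks_fromBlocks₁₁] at this
      exact this.symm
    rw [h0]
    constructor
    · intro e
      have := congrArg (fun X => X * g.1.toBlocks₁₁) e
      simpa only [Matrix.mul_assoc, h1, Matrix.mul_one] using this
    · intro e
      change g.1.toBlocks₁₁ * (nu n x * (nu n x)ᴴ) * g.1.toBlocks₁₁ᴴ = _
      rw [e, Matrix.mul_assoc, mul_eq_one_comm.1 h1, Matrix.mul_one]
  rw [commute_signMatrix_iff]
  constructor
  · rintro ⟨h, h'⟩
    exact ⟨h.1, h.2.1, h.2.2, (key h).1 h'⟩
  · rintro ⟨h1, h2, h3, h4⟩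
    exact ⟨⟨h1, h2, h3⟩, (key _).2 h4⟩

/-- Elements of the isotropy group from pairs of matrices. -/
def mkIsotropy (gL gR : SL2n n) (hL : gL.1ᴴ * gL.1 = 1)
    (hL' : gL.1 * signMatrix (nu n x) = signMatrix (nu n x) * gL.1) (hR : gR.1ᴴ * gR.1 = 1)
    (hR' : gR.1 * signMatrix 1 = signMatrix 1 * gR.1) : isotropy (mu n u v x) :=
  have hL₁ := (mem_dressingIsotropy_muL_iff (u := u)).2 ⟨hL, hL'⟩
  have hR₁ : (⟨gR, mem_Gplus_iff.2 ⟨hR, hR'⟩⟩ : Gplus n) ∈ dressingIsotropy (muR n v) := by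
    rw [dressingIsotropy_muR]; trivial
  ⟨(⟨gL, hL₁.choose⟩, ⟨gR, mem_Gplus_iff.2 ⟨hR, hR'⟩⟩), hL₁.choose_spec, hR₁⟩

/-- The two matrices of an element of the isotropy group. -/
def isotropyPair (g : isotropy (mu n u v x)) : Matrix (Idx n) (Idx n) ℂ × Matrix (Idx n) (Idx n) ℂ :=
  (g.1.1.1.1, g.1.2.1.1)

theorem isInducing_isotropyPair : IsInducing (isotropyPair : isotropy (mu n u v x) → _) := by
  have h1 : IsInducing (Subtype.val : isotropy (mu n u v x) → Gplus n × Gplus n) :=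
    IsInducing.subtypeVal
  have h2 : IsInducing fun g : Gplus n => g.1.1 :=
    (IsInducing.subtypeVal (t := {A : Matrix (Idx n) (Idx n) ℂ | A.det = 1})).comp
      IsInducing.subtypeVal
  exact (h2.prodMap h2).comp h1

theorem isotropyPair_spec (g : isotropy (mu n u v x)) :
    ((isotropyPair g).1ᴴ * (isotropyPair g).1 = 1 ∧ (isotropyPair g).1.det = 1 ∧
      (isotropyPair g).1 * signMatrix (nu n x) = signMatrix (nu n x) * (isotropyPair g).1) ∧
    ((isotropyPair g).2ᴴ * (isotropyPair g).2 = 1 ∧ (isotropyPair g).2.det = 1 ∧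
      (isotropyPair g).2 * signMatrix 1 = signMatrix 1 * (isotropyPair g).2) := by
  obtain ⟨h1, h2⟩ := mem_dressingIsotropy_muL_iff.1 ⟨g.1.1.2, g.2.1⟩
  obtain ⟨h3, h4⟩ := mem_Gplus_iff.1 g.1.2.2
  exact ⟨⟨h1, g.1.1.1.2, h2⟩, ⟨h3, g.1.2.1.2, h4⟩⟩

instance compactSpace_isotropy : CompactSpace (isotropy (mu n u v x)) := by
  rw [← isCompact_univ_iff, isInducing_isotropyPair.isCompact_iff]
  have h := (isCompact_unitary_commutant (signMatrix (nu n x))).prod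
    (isCompact_unitary_commutant (signMatrix (1 : Matrix (Fin n) (Fin n) ℂ)))
  convert h
  ext ⟨a, b⟩
  constructor
  · rintro ⟨g, -, h⟩
    rw [← h]
    exact isotropyPair_spec g
  · rintro ⟨⟨h1, h2, h3⟩, h4, h5, h6⟩
    exact ⟨mkIsotropy ⟨a, h2⟩ ⟨b, h5⟩ h1 h3 h4 h6, trivial, rfl⟩

instance continuousSMul_gplus : ContinuousSMul (Gplus n × Gplus n) (SL2n n) := ⟨by
  change Continuous fun p : (Gplus n × Gplus n) × SL2n n => p.1.1.1 * p.2 * (p.1.2.1)⁻¹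
  fun_prop⟩

theorem isotropy_smul_def (g : isotropy (mu n u v x)) (K : SL2n n) :
    (g • K).1 = (isotropyPair g).1 * K.1 * ((isotropyPair g).2)ᴴ := by
  have : (g.1.2.1⁻¹).1 = (isotropyPair g).2ᴴ := coe_inv_of_mem_SU g.1.2.2.1
  rw [← this]
  rfl

theorem smul_mem_levelSet_iff (g : isotropy (mu n u v x)) (K : SL2n n) :
    g • K ∈ levelSet (mu n u v x) ↔ K ∈ levelSet (mu n u v x) := by
  constructor
  · intro h
    have := momentumMapPlus_smul g⁻¹ h
    rwa [inv_smul_smul] at this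
  · exact fun h => momentumMapPlus_smul g h

/-! ### The exponential map of the isotropy group -/

section Exp

open scoped Matrix.Norms.Operator

/-- The exponential map of a commutant, with values in `SL(2n, ℂ)`. -/
noncomputable def expSL (A : Matrix (Idx n) (Idx n) ℂ) (hA : A.trace = 0) : SL2n n :=
  ⟨NormedSpace.exp A, by rw [det_matrix_exp, hA, Complex.exp_zero]⟩

theorem exp_skewAlgebra {P : Matrix (Idx n) (Idx n) ℂ} (ξ : skewAlgebra P) :
    (NormedSpace.exp ξ.1)ᴴ * NormedSpace.exp ξ.1 = 1 ∧
      NormedSpace.exp ξ.1 * P = P * NormedSpace.exp ξ.1 := by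
  obtain ⟨h1, h2, h3⟩ := ξ.2
  constructor
  · rw [← Matrix.exp_conjTranspose, h1, exp_neg_mul_exp]
  · exact (Commute.exp_left (show Commute ξ.1 P from h3))

/-- The exponential map of the isotropy group. -/
noncomputable def isotropyExp
    (ξ : skewAlgebra (signMatrix (nu n x)) ×
      skewAlgebra (signMatrix (1 : Matrix (Fin n) (Fin n) ℂ))) : isotropy (mu n u v x) :=
  mkIsotropy (expSL ξ.1.1 ξ.1.2.2.1) (expSL ξ.2.1 ξ.2.2.2.1) (exp_skewAlgebra ξ.1).1
    (exp_skewAlgebra ξ.1).2 (exp_skewAlgebra ξ.2).1 (exp_skewAlgebra ξ.2).2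

theorem isotropyPair_isotropyExp (ξ : skewAlgebra (signMatrix (nu n x)) ×
      skewAlgebra (signMatrix (1 : Matrix (Fin n) (Fin n) ℂ))) :
    isotropyPair (isotropyExp ξ : isotropy (mu n u v x)) =
      (NormedSpace.exp ξ.1.1, NormedSpace.exp ξ.2.1) := rfl

theorem isotropyPair_injective :
    Function.Injective (isotropyPair : isotropy (mu n u v x) → _) := by
  intro g g' h
  obtain ⟨h1, h2⟩ := Prod.mk.inj h
  exact Subtype.ext (Prod.ext (Subtype.ext (Subtype.ext h1)) (Subtype.ext (Subtype.ext h2)))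

theorem isotropyExp_zero : (isotropyExp 0 : isotropy (mu n u v x)) = 1 := by
  apply isotropyPair_injective
  rw [isotropyPair_isotropyExp]
  exact Prod.ext NormedSpace.exp_zero NormedSpace.exp_zero

theorem continuous_isotropyExp :
    Continuous (isotropyExp (n := n) (u := u) (v := v) (x := x)) := by
  rw [isInducing_isotropyPair.continuous_iff]
  have he : Continuous (NormedSpace.exp : Matrix (Idx n) (Idx n) ℂ → _) :=
    contDiff_matrix_exp.continuous
  exact (he.comp (continuous_subtype_val.comp continuous_fst)).prodMk
    (he.comp (continuous_subtype_val.comp continuous_snd))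

/-- Elements near `1` have small logarithms, which lie in the Lie algebra by
`eventually_exists_log`. -/
theorem nhds_one_le_map_isotropyExp :
    𝓝 (1 : isotropy (mu n u v x)) ≤ map isotropyExp (𝓝 0) := by
  intro s hs
  rw [mem_map] at hs
  have h0 : 𝓝 (0 : skewAlgebra (signMatrix (nu n x)) ×
      skewAlgebra (signMatrix (1 : Matrix (Fin n) (Fin n) ℂ))) =
      comap (fun ξ => (ξ.1.1, ξ.2.1)) (𝓝 (0, 0)) := by
    have : IsInducing (fun ξ : skewAlgebra (signMatrix (nu n x)) ×
      skewAlgebra (signMatrix (1 : Matrix (Fin n) (Fin n) ℂ)) => (ξ.1.1, ξ.2.1)) :=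
      IsInducing.subtypeVal.prodMap IsInducing.subtypeVal
    exact this.nhds_eq_comap 0
  rw [h0, mem_comap] at hs
  obtain ⟨t, ht, hts⟩ := hs
  rw [nhds_prod_eq, mem_prod_iff] at ht
  obtain ⟨W₁, hW₁, W₂, hW₂, hW⟩ := ht
  obtain ⟨T, hT⟩ : ∃ T : Matrix (Fin n) (Fin n) ℂ, nu n x * T = 1 :=
    ⟨(nu n x)⁻¹, Matrix.mul_nonsing_inv _ (by rw [det_nu]; exact isUnit_one)⟩
  have l1 := eventually_exists_log (signMatrix_mul_inv hT) hW₁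
  have l2 := eventually_exists_log (signMatrix_mul_inv
    (Matrix.one_mul (1 : Matrix (Fin n) (Fin n) ℂ))) hW₂
  have hc : Tendsto (isotropyPair : isotropy (mu n u v x) → _) (𝓝 1) (𝓝 (1, 1)) :=
    isInducing_isotropyPair.continuous.tendsto 1
  rw [nhds_prod_eq] at hc
  filter_upwards [(tendsto_fst.comp hc).eventually l1, (tendsto_snd.comp hc).eventually l2]
    with g h1 h2
  obtain ⟨⟨a1, a2, a3⟩, a4, a5, a6⟩ := isotropyPair_spec g
  obtain ⟨ξ, hξ, b1, b2, b3, b4⟩ := h1 a1 a2 a3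
  obtain ⟨ζ, hζ, c1, c2, c3, c4⟩ := h2 a4 a5 a6
  have hmem : isotropyExp (⟨ξ, b1, b2, b3⟩, ⟨ζ, c1, c2, c3⟩) ∈ s :=
    hts (show (ξ, ζ) ∈ t from hW ⟨hξ, hζ⟩)
  have : isotropyExp (⟨ξ, b1, b2, b3⟩, ⟨ζ, c1, c2, c3⟩) = g := by
    apply isotropyPair_injective
    rw [isotropyPair_isotropyExp]
    exact Prod.ext b4 c4
  rwa [this] at hmem

end Exp

end Isotropy

/-! ### Hermitian matrices and surjectivity criteria -/

section LinearAlgebra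

/-- A proper range is annihilated by a nonzero functional, and a definite form on a finite
dimensional space represents it by some `w`. -/
theorem surjective_of_definite_form {V W : Type*} [AddCommGroup V] [Module ℝ V] [AddCommGroup W]
    [Module ℝ W] [FiniteDimensional ℝ W] (B : W →ₗ[ℝ] W →ₗ[ℝ] ℝ) (hB : ∀ w, B w w = 0 → w = 0)
    (T : V →ₗ[ℝ] W) (hT : ∀ w, (∀ v, B w (T v) = 0) → w = 0) : Function.Surjective T := by
  by_contra h
  rw [← LinearMap.range_eq_top] at h
  obtain ⟨f, hf, hfT⟩ := Submodule.exists_le_ker_of_lt_top _ (lt_top_iff_ne_top.2 h)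
  have hinj : Function.Injective B := by
    rw [← LinearMap.ker_eq_bot, LinearMap.ker_eq_bot']
    intro w hw
    exact hB w (by rw [hw]; rfl)
  have hsurj : Function.Surjective B :=
    (LinearMap.injective_iff_surjective_of_finrank_eq_finrank (f := B)
      (Subspace.dual_finrank_eq (K := ℝ) (V := W)).symm).1 hinj
  obtain ⟨w, rfl⟩ := hsurj f
  refine hf ?_
  rw [hT w fun v => hfT ⟨v, rfl⟩, map_zero]

/-- A space with a surjection `T` onto `F` and an injection `O` into the kernel of `T` splits. -/
theorem exists_splitting {V F 𝔤 : Type*} [AddCommGroup V] [Module ℝ V] [FiniteDimensional ℝ V]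
    [AddCommGroup F] [Module ℝ F] [FiniteDimensional ℝ F] [AddCommGroup 𝔤] [Module ℝ 𝔤]
    [FiniteDimensional ℝ 𝔤] (T : V →ₗ[ℝ] F) (hT : Function.Surjective T) (O : 𝔤 →ₗ[ℝ] V)
    (hO : Function.Injective O) (hTO : ∀ ξ, T (O ξ) = 0)
    {e : ℕ} (he : e = Module.finrank ℝ V - Module.finrank ℝ F - Module.finrank ℝ 𝔤) :
    ∃ (ι : EuclideanSpace ℝ (Fin e) →ₗ[ℝ] V) (ρ : F →ₗ[ℝ] V)
      (Φ : ((EuclideanSpace ℝ (Fin e) × F) × 𝔤) ≃ₗ[ℝ] V),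
      (∀ s, T (ι s) = 0) ∧ (∀ f, T (ρ f) = f) ∧
      ∀ x, Φ x = ι x.1.1 + ρ x.1.2 + O x.2 := by
  obtain ⟨ρ, hρ⟩ := T.exists_rightInverse_of_surjective (LinearMap.range_eq_top.2 hT)
  have hρ' : ∀ f, T (ρ f) = f := fun f => LinearMap.congr_fun hρ f
  let O' : 𝔤 →ₗ[ℝ] LinearMap.ker T := O.codRestrict _ hTO
  have hO' : Function.Injective O' := fun a b h => hO (congrArg Subtype.val h)
  obtain ⟨S, hS⟩ := (LinearMap.range O').exists_isCompl
  have h1 : Module.finrank ℝ (LinearMap.range O') + Module.finrank ℝ S =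
    Module.finrank ℝ (LinearMap.ker T) := Submodule.finrank_add_eq_of_isCompl hS
  have h2 : Module.finrank ℝ (LinearMap.range O') = Module.finrank ℝ 𝔤 :=
    LinearMap.finrank_range_of_inj hO'
  have h3 := T.finrank_range_add_finrank_ker
  rw [LinearMap.range_eq_top.2 hT, finrank_top] at h3
  have hdim : Module.finrank ℝ (EuclideanSpace ℝ (Fin e)) = Module.finrank ℝ S := by
    rw [finrank_euclideanSpace_fin]; omega
  let eS := LinearEquiv.ofFinrankEq _ S hdim
  let ι := (LinearMap.ker T).subtype ∘ₗ S.subtype ∘ₗ eS.toLinearMap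
  have hι : ∀ s, T (ι s) = 0 := fun s => (eS s).1.2
  let Φ₀ := (ι.coprod ρ).coprod O
  have hΦ₀ : ∀ x, Φ₀ x = ι x.1.1 + ρ x.1.2 + O x.2 := fun x => rfl
  have hinj : Function.Injective Φ₀ := by
    rw [← LinearMap.ker_eq_bot, LinearMap.ker_eq_bot']
    rintro ⟨⟨s, f⟩, ξ⟩ h
    rw [hΦ₀] at h
    have hf : f = 0 := by
      have := congrArg T h
      simpa [hι, hρ', hTO] using this
    subst hf
    rw [map_zero, add_zero] at h
    have h4 : (eS s).1 = -O' ξ := Subtype.ext (eq_neg_of_add_eq_zero_left h)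
    have h5 : (eS s).1 = 0 := by
      have := hS.disjoint.le_bot (x := (eS s).1)
        ⟨by rw [h4]; exact neg_mem ⟨ξ, rfl⟩, (eS s).2⟩
      exact this
    have h6 : s = 0 := by
      have : eS s = 0 := Subtype.ext h5
      simpa using this
    have h7 : ξ = 0 := by
      rw [h5] at h4
      have : O' ξ = 0 := by simpa using h4.symm
      exact hO' (by rw [this, map_zero])
    rw [h6, h7]; rfl
  have hfin : Module.finrank ℝ ((EuclideanSpace ℝ (Fin e) × F) × 𝔤) = Module.finrank ℝ V := by
    rw [Module.finrank_prod, Module.finrank_prod, hdim]; omega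
  exact ⟨ι, ρ, LinearEquiv.ofInjectiveOfFinrankEq Φ₀ hinj hfin, hι, hρ', fun x => rfl⟩

variable {m : Type} [Fintype m] [DecidableEq m]

/-- The Hermitian matrices. -/
def hermitianSubmodule (m : Type) : Submodule ℝ (Matrix m m ℂ) where
  carrier := {X | Xᴴ = X}
  add_mem' {a b} ha hb := by
    simp only [Set.mem_ofPred_eq] at *
    rw [Matrix.conjTranspose_add, ha, hb]
  zero_mem' := by simp
  smul_mem' c a ha := by
    simp only [Set.mem_ofPred_eq] at *
    rw [Matrix.conjTranspose_smul, ha, star_trivial]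

/-- The traceless matrices. -/
def tracelessSubmodule (m : Type) [Fintype m] : Submodule ℝ (Matrix m m ℂ) where
  carrier := {X | X.trace = 0}
  add_mem' {a b} ha hb := by
    simp only [Set.mem_ofPred_eq] at *
    rw [Matrix.trace_add, ha, hb, add_zero]
  zero_mem' := by simp
  smul_mem' c a ha := by
    simp only [Set.mem_ofPred_eq] at *
    rw [Matrix.trace_smul, ha, smul_zero]

/-- The Hermitian part of a matrix. -/
noncomputable def hermPart : Matrix m m ℂ →ₗ[ℝ] hermitianSubmodule m where
  toFun X := ⟨(1 / 2 : ℝ) • (X + Xᴴ), by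
    change (_ : Matrix m m ℂ)ᴴ = _
    rw [Matrix.conjTranspose_smul, Matrix.conjTranspose_add, Matrix.conjTranspose_conjTranspose,
      star_trivial, add_comm]⟩
  map_add' X Y := Subtype.ext (by
    change (1 / 2 : ℝ) • (X + Y + (X + Y)ᴴ) = (1 / 2 : ℝ) • (X + Xᴴ) + (1 / 2 : ℝ) • (Y + Yᴴ)
    rw [Matrix.conjTranspose_add, ← smul_add]
    congr 1; abel)
  map_smul' c X := Subtype.ext (by
    change (1 / 2 : ℝ) • (c • X + (c • X)ᴴ) = c • ((1 / 2 : ℝ) • (X + Xᴴ))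
    rw [Matrix.conjTranspose_smul, star_trivial, ← smul_add, smul_comm])

/-- The traceless part of a matrix. -/
noncomputable def tracelessPart : Matrix m m ℂ →ₗ[ℝ] Matrix m m ℂ where
  toFun X := X - (X.trace / (Fintype.card m : ℂ)) • 1
  map_add' X Y := by
    rw [Matrix.trace_add, add_div, add_smul]; abel
  map_smul' c X := by
    rw [Matrix.trace_smul, RingHom.id_apply, smul_sub, smul_div_assoc, smul_assoc]

theorem trace_tracelessPart [Nonempty m] (X : Matrix m m ℂ) : (tracelessPart X).trace = 0 := by
  change (X - (X.trace / (Fintype.card m : ℂ)) • (1 : Matrix m m ℂ)).trace = 0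
  rw [Matrix.trace_sub, Matrix.trace_smul, Matrix.trace_one, smul_eq_mul, div_mul_cancel₀, sub_self]
  exact_mod_cast Fintype.card_ne_zero

/-- The Hermitian traceless part of a matrix. -/
noncomputable def hermTracelessPart [Nonempty m] : Matrix m m ℂ →ₗ[ℝ]
    (hermitianSubmodule m ⊓ tracelessSubmodule m : Submodule ℝ (Matrix m m ℂ)) :=
  ((hermitianSubmodule m).subtype ∘ₗ hermPart ∘ₗ tracelessPart).codRestrict _ fun X =>
    ⟨(hermPart (tracelessPart X)).2, by
      change ((1 / 2 : ℝ) • (tracelessPart X + (tracelessPart X)ᴴ)).trace = 0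
      rw [Matrix.trace_smul, Matrix.trace_add, Matrix.trace_conjTranspose, trace_tracelessPart]
      simp⟩

theorem coe_hermPart_of_isHermitian {X : Matrix m m ℂ} (hX : Xᴴ = X) :
    (hermPart X : Matrix m m ℂ) = X := by
  change (1 / 2 : ℝ) • (X + Xᴴ) = X
  rw [hX, ← two_smul ℝ X, smul_smul]; norm_num

theorem conjTranspose_tracelessPart {X : Matrix m m ℂ} (hX : Xᴴ = X) :
    (tracelessPart X)ᴴ = tracelessPart X := by
  change (X - (X.trace / (Fintype.card m : ℂ)) • (1 : Matrix m m ℂ))ᴴ = X - _ • 1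
  have : star X.trace = X.trace := by rw [← Matrix.trace_conjTranspose, hX]
  rw [Matrix.conjTranspose_sub, hX, Matrix.conjTranspose_smul, Matrix.conjTranspose_one, star_div₀,
    this, star_natCast]

theorem coe_hermTracelessPart_of_isHermitian [Nonempty m] {X : Matrix m m ℂ} (hX : Xᴴ = X) :
    (hermTracelessPart X : Matrix m m ℂ) = X - (X.trace / (Fintype.card m : ℂ)) • 1 :=
  coe_hermPart_of_isHermitian (conjTranspose_tracelessPart hX)

/-- The real trace form. -/
noncomputable def reTrace (A B : Matrix m m ℂ) : ℝ := ((A * B).trace).re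

theorem reTrace_comm (A B : Matrix m m ℂ) : reTrace A B = reTrace B A := by
  rw [reTrace, Matrix.trace_mul_comm, reTrace]

theorem reTrace_conjTranspose {A : Matrix m m ℂ} (hA : Aᴴ = A) (B : Matrix m m ℂ) :
    reTrace A Bᴴ = reTrace A B := by
  have : (A * Bᴴ).trace = star ((B * A).trace) := by
    rw [← Matrix.trace_conjTranspose, Matrix.conjTranspose_mul, hA]
  rw [reTrace, this, reTrace, Matrix.trace_mul_comm]
  exact Complex.conj_re _

theorem reTrace_add (A B C : Matrix m m ℂ) : reTrace A (B + C) = reTrace A B + reTrace A C := by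
  rw [reTrace, Matrix.mul_add, Matrix.trace_add, Complex.add_re]; rfl

theorem add_reTrace (A B C : Matrix m m ℂ) : reTrace (A + B) C = reTrace A C + reTrace B C := by
  rw [reTrace, Matrix.add_mul, Matrix.trace_add, Complex.add_re]; rfl

theorem reTrace_smul (c : ℝ) (A B : Matrix m m ℂ) : reTrace A (c • B) = c * reTrace A B := by
  rw [reTrace, Matrix.mul_smul, Matrix.trace_smul, Complex.smul_re]; rfl

theorem smul_reTrace (c : ℝ) (A B : Matrix m m ℂ) : reTrace (c • A) B = c * reTrace A B := by
  rw [reTrace_comm, reTrace_smul, reTrace_comm]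

theorem reTrace_hermPart {A : Matrix m m ℂ} (hA : Aᴴ = A) (X : Matrix m m ℂ) :
    reTrace A (hermPart X : Matrix m m ℂ) = reTrace A X := by
  change reTrace A ((1 / 2 : ℝ) • (X + Xᴴ)) = _
  rw [reTrace_smul, reTrace_add, reTrace_conjTranspose hA]; ring

theorem reTrace_hermTracelessPart [Nonempty m] {A : Matrix m m ℂ} (hA : Aᴴ = A)
    (hA' : A.trace = 0) (X : Matrix m m ℂ) :
    reTrace A (hermTracelessPart X : Matrix m m ℂ) = reTrace A X := by
  change reTrace A (hermPart (tracelessPart X) : Matrix m m ℂ) = _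
  rw [reTrace_hermPart hA]
  change reTrace A (X - (X.trace / (Fintype.card m : ℂ)) • (1 : Matrix m m ℂ)) = _
  rw [reTrace, Matrix.mul_sub, Matrix.mul_smul, Matrix.mul_one, Matrix.trace_sub,
    Matrix.trace_smul, hA', smul_zero, sub_zero]; rfl

theorem reTrace_self_nonneg {A : Matrix m m ℂ} (hA : Aᴴ = A) :
    0 ≤ reTrace A A ∧ (reTrace A A = 0 → A = 0) := by
  have h : reTrace A A = ∑ i, ∑ j, Complex.normSq (A j i) := by
    rw [reTrace]
    conv_lhs => rw [show A * A = Aᴴ * A by rw [hA]]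
    rw [Matrix.trace, Complex.re_sum]
    refine Finset.sum_congr rfl fun i _ => ?_
    rw [Matrix.diag_apply, Matrix.mul_apply, Complex.re_sum]
    refine Finset.sum_congr rfl fun j _ => ?_
    rw [Matrix.conjTranspose_apply, Complex.star_def, mul_comm, Complex.mul_conj, Complex.ofReal_re]
  have hp : ∀ i, 0 ≤ ∑ j, Complex.normSq (A j i) := fun i =>
    Finset.sum_nonneg fun j _ => Complex.normSq_nonneg _
  rw [h]
  refine ⟨Finset.sum_nonneg fun i _ => hp i, fun h0 => ?_⟩
  ext j i
  have h1 := (Finset.sum_eq_zero_iff_of_nonneg fun i _ => hp i).1 h0 i (Finset.mem_univ i)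
  have h2 := (Finset.sum_eq_zero_iff_of_nonneg fun j _ => Complex.normSq_nonneg _).1 h1 j
    (Finset.mem_univ j)
  exact Complex.normSq_eq_zero.1 h2

/-- The matrices annihilating the traceless ones are the scalars. -/
theorem exists_eq_smul_one_of_reTrace [Nonempty m] {Θ : Matrix m m ℂ}
    (h : ∀ κ : Matrix m m ℂ, κ.trace = 0 → reTrace Θ κ = 0) : ∃ c : ℂ, Θ = c • 1 := by
  set Y := Θ - (Θ.trace / (Fintype.card m : ℂ)) • (1 : Matrix m m ℂ) with hY
  have hYt : Y.trace = 0 := trace_tracelessPart Θ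
  have hYt' : Yᴴ.trace = 0 := by rw [Matrix.trace_conjTranspose, hYt, star_zero]
  -- The test direction is the adjoint of the traceless part `Y` of `Θ`, for which the scalar part
  -- of `Θ` contributes nothing.
  have h1 : (Yᴴ * Y).trace.re = 0 := by
    have := h Yᴴ hYt'
    rw [reTrace_comm, reTrace, show Θ = Y + (Θ.trace / (Fintype.card m : ℂ)) • 1 by rw [hY]; abel,
      Matrix.mul_add, Matrix.mul_smul, Matrix.mul_one, Matrix.trace_add, Matrix.trace_smul, hYt',
      smul_zero, add_zero] at this
    exact this
  have h2 : (Yᴴ * Y).trace.im = 0 := by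
    have : star (Yᴴ * Y).trace = (Yᴴ * Y).trace := by
      rw [← Matrix.trace_conjTranspose, Matrix.conjTranspose_mul, Matrix.conjTranspose_conjTranspose]
    exact Complex.conj_eq_iff_im.1 this
  have h3 : Y = 0 := by
    open scoped ComplexOrder in
    exact Matrix.trace_conjTranspose_mul_self_eq_zero_iff.1 (Complex.ext h1 h2)
  exact ⟨_, sub_eq_zero.1 h3⟩

end LinearAlgebra

/-! ### The constraints without their redundant parts -/

section Constraints

open scoped ComplexOrder

/-- Complementary minors of a matrix of determinant one and of its inverse. -/
theorem det_toBlocks₁₁_eq {m : Type*} [Fintype m] [DecidableEq m] {L M : Matrix (m ⊕ m) (m ⊕ m) ℂ}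
    (hLM : L * M = 1) (hL : L.det = 1) : M.toBlocks₁₁.det = L.toBlocks₂₂.det := by
  have h : L * Matrix.fromBlocks M.toBlocks₁₁ 0 M.toBlocks₂₁ 1 =
      Matrix.fromBlocks 1 L.toBlocks₁₂ 0 L.toBlocks₂₂ := by
    have h1 : L * M = Matrix.fromBlocks 1 0 0 1 := by rw [hLM, Matrix.fromBlocks_one]
    conv at h1 => lhs; rw [← Matrix.fromBlocks_toBlocks L, ← Matrix.fromBlocks_toBlocks M]
    rw [Matrix.fromBlocks_multiply, Matrix.fromBlocks_inj] at h1
    conv_lhs => rw [← Matrix.fromBlocks_toBlocks L]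
    rw [Matrix.fromBlocks_multiply, h1.1, h1.2.2.1]
    simp
  have h2 := congrArg Matrix.det h
  rwa [Matrix.det_mul, hL, one_mul, Matrix.det_fromBlocks_zero₁₂, Matrix.det_one, mul_one,
    Matrix.det_fromBlocks_zero₂₁, Matrix.det_one, one_mul] at h2

/-- Without its traceless part `Y` is `r • 1` with `r ≥ 0` by positivity, and the determinant then
fixes `r`. So the scalar part of such a constraint carries no information. -/
theorem eq_smul_one_of_tracelessPart_eq_zero {m : Type} [Fintype m] [DecidableEq m] [Nonempty m]
    {Y : Matrix m m ℂ} (hY : Y.PosSemidef) {a : ℝ} (ha : 0 < a)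
    (hdet : Y.det = (a : ℂ) ^ Fintype.card m) (h : hermTracelessPart Y = 0) :
    Y = (a : ℂ) • 1 := by
  have h1 : Y = (Y.trace / (Fintype.card m : ℂ)) • 1 := by
    have := congrArg Subtype.val h
    rw [coe_hermTracelessPart_of_isHermitian hY.isHermitian] at this
    exact sub_eq_zero.1 this
  obtain ⟨r, hr0, hr⟩ : ∃ r : ℝ, 0 ≤ r ∧ Y.trace / (Fintype.card m : ℂ) = r := by

    obtain ⟨h2, h3⟩ := Complex.nonneg_iff.1 hY.trace_nonneg
    refine ⟨Y.trace.re / Fintype.card m, by positivity, ?_⟩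
    have : Y.trace = (Y.trace.re : ℂ) := Complex.ext rfl (by simpa using h3.symm)
    rw [this]; push_cast; simp
  rw [hr] at h1
  rw [h1, Matrix.det_smul, Matrix.det_one, mul_one] at hdet
  have h4 : r ^ Fintype.card m = a ^ Fintype.card m := by exact_mod_cast hdet
  rw [h1, (pow_left_inj₀ hr0 ha.le Fintype.card_ne_zero).1 h4]

variable {n : ℕ} {u v x : ℝ}

/-- The space of values of the irredundant constraints. -/
abbrev ConstraintSpace (n : ℕ) : Type :=
  hermitianSubmodule (Fin n) ×
  (hermitianSubmodule (Fin n) ⊓ tracelessSubmodule (Fin n) :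
    Submodule ℝ (Matrix (Fin n) (Fin n) ℂ)) ×
  hermitianSubmodule (Fin n) ×
  (hermitianSubmodule (Fin n) ⊓ tracelessSubmodule (Fin n) :
    Submodule ℝ (Matrix (Fin n) (Fin n) ℂ))

variable [NeZero n]

/-- The irredundant constraints, as functions of `K K†`, `K⁻¹† K⁻¹`, `K† K` and `K⁻¹ K⁻¹†`. -/
noncomputable def constraintParts (S : Matrix (Fin n) (Fin n) ℂ)
    (X : Matrix (Idx n) (Idx n) ℂ × Matrix (Idx n) (Idx n) ℂ × Matrix (Idx n) (Idx n) ℂ ×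
      Matrix (Idx n) (Idx n) ℂ) : ConstraintSpace n :=
  (hermPart X.1.toBlocks₂₂, hermTracelessPart (Sᴴ * X.2.1.toBlocks₁₁ * S),
    hermPart X.2.2.1.toBlocks₁₁, hermTracelessPart X.2.2.2.toBlocks₂₂)

/-- The irredundant constraints on `SL(2n, ℂ)`. -/
noncomputable def constraintMap (S : Matrix (Fin n) (Fin n) ℂ) (K : SL2n n) : ConstraintSpace n :=
  constraintParts S (K.1 * K.1ᴴ, (K⁻¹).1ᴴ * (K⁻¹).1, K.1ᴴ * K.1, (K⁻¹).1 * (K⁻¹).1ᴴ)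

theorem posSemidef_toBlocks {m : Type*} [Fintype m] {X : Matrix (m ⊕ m) (m ⊕ m) ℂ}
    (hX : X.PosSemidef) : X.toBlocks₁₁.PosSemidef ∧ X.toBlocks₂₂.PosSemidef :=
  ⟨hX.submatrix Sum.inl, hX.submatrix Sum.inr⟩

theorem hermPart_eq_iff {m : Type} [Fintype m] [DecidableEq m] {X Y : Matrix m m ℂ}
    (hX : Xᴴ = X) (hY : Yᴴ = Y) : hermPart X = hermPart Y ↔ X = Y := by
  rw [← Subtype.coe_inj, coe_hermPart_of_isHermitian hX, coe_hermPart_of_isHermitian hY]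

theorem hermTracelessPart_smul_one {m : Type} [Fintype m] [DecidableEq m] [Nonempty m] (a : ℝ) :
    hermTracelessPart ((a : ℂ) • (1 : Matrix m m ℂ)) = 0 := by
  apply Subtype.ext
  rw [coe_hermTracelessPart_of_isHermitian (by simp)]
  have : (Fintype.card m : ℂ) ≠ 0 := by exact_mod_cast Fintype.card_ne_zero
  rw [Matrix.trace_smul, Matrix.trace_one, smul_eq_mul, mul_div_cancel_right₀ _ this, sub_self]
  rfl

/-- The dropped scalar parts are recovered from determinants: for a Gram matrix of determinant one,
a block of the inverse has the same determinant as the complementary block, which is already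
prescribed. -/
theorem mem_levelSet_iff_constraintMap (K : SL2n n) : K ∈ levelSet (mu n u v x) ↔
    constraintMap (nu n x) K = (hermPart ((Real.exp (-2 * u) : ℂ) • 1), 0,
      hermPart ((Real.exp (-2 * v) : ℂ) • 1), 0) := by
  have hreal : ∀ t : ℝ, ((Real.exp t : ℂ) • (1 : Matrix (Fin n) (Fin n) ℂ))ᴴ =
      (Real.exp t : ℂ) • 1 := fun t => by
    rw [Matrix.conjTranspose_smul, Matrix.conjTranspose_one, Complex.star_def, Complex.conj_ofReal]
  have p1 : (K.1 * K.1ᴴ).PosSemidef := Matrix.posSemidef_self_mul_conjTranspose _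
  have p2 : ((K⁻¹).1ᴴ * (K⁻¹).1).PosSemidef := Matrix.posSemidef_conjTranspose_mul_self _
  have p3 : (K.1ᴴ * K.1).PosSemidef := Matrix.posSemidef_conjTranspose_mul_self _
  have p4 : ((K⁻¹).1 * (K⁻¹).1ᴴ).PosSemidef := Matrix.posSemidef_self_mul_conjTranspose _
  have q2 := (posSemidef_toBlocks p2).1.conjTranspose_mul_mul_same (nu n x)
  rw [mem_levelSet_mu_iff, constraintMap, constraintParts, Prod.mk.injEq, Prod.mk.injEq,
    Prod.mk.injEq, hermPart_eq_iff (posSemidef_toBlocks p1).2.isHermitian (hreal _),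
    hermPart_eq_iff (posSemidef_toBlocks p3).1.isHermitian (hreal _)]
  have hKi := coe_mul_coe_inv K
  have hKi' := coe_inv_mul_coe K
  constructor
  · rintro ⟨h1, h2, h3, h4⟩
    refine ⟨h1, ?_, h3, ?_⟩
    · rw [h2, hermTracelessPart_smul_one]
    · rw [h4, hermTracelessPart_smul_one]
  · rintro ⟨h1, h2, h3, h4⟩
    refine ⟨h1, ?_, h3, ?_⟩
    · refine eq_smul_one_of_tracelessPart_eq_zero q2 (Real.exp_pos _) ?_ h2
      have hLM : (K.1 * K.1ᴴ) * ((K⁻¹).1ᴴ * (K⁻¹).1) = 1 := by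
        calc _ = K.1 * ((K⁻¹).1 * K.1)ᴴ * (K⁻¹).1 := by
              simp only [Matrix.conjTranspose_mul, Matrix.mul_assoc]
          _ = 1 := by rw [hKi', Matrix.conjTranspose_one, Matrix.mul_one, hKi]
      rw [Matrix.det_mul, Matrix.det_mul, Matrix.det_conjTranspose, det_nu, det_toBlocks₁₁_eq hLM
        (by rw [Matrix.det_mul, Matrix.det_conjTranspose, K.2]; simp), h1, Matrix.det_smul,
        Matrix.det_one]
      simp
    · refine eq_smul_one_of_tracelessPart_eq_zero (posSemidef_toBlocks p4).2 (Real.exp_pos _) ?_ h4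
      have hLM : ((K⁻¹).1 * (K⁻¹).1ᴴ) * (K.1ᴴ * K.1) = 1 := by
        calc _ = (K⁻¹).1 * (K.1 * (K⁻¹).1)ᴴ * K.1 := by
              simp only [Matrix.conjTranspose_mul, Matrix.mul_assoc]
          _ = 1 := by rw [hKi, Matrix.conjTranspose_one, Matrix.mul_one, hKi']
      rw [← det_toBlocks₁₁_eq hLM
        (by rw [Matrix.det_mul, Matrix.det_conjTranspose, (K⁻¹).2]; simp), h3, Matrix.det_smul,
        Matrix.det_one, mul_one]

end Constraints

/-! ### The derivative of the constraints and the orbit directions -/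

section Tangent

variable {m : Type} [Fintype m] [DecidableEq m]

theorem reTrace_mul_mul (A P X Q : Matrix m m ℂ) :
    reTrace A (P * X * Q) = reTrace (Q * A * P) X := by
  rw [reTrace, reTrace, ← Matrix.mul_assoc, Matrix.trace_mul_comm]
  simp only [Matrix.mul_assoc]

theorem reTrace_add_conjTranspose {A : Matrix m m ℂ} (hA : Aᴴ = A) (Y : Matrix m m ℂ) :
    reTrace A (Y + Yᴴ) = 2 * reTrace A Y := by
  rw [reTrace_add, reTrace_conjTranspose hA, two_mul]

theorem trace_fromBlocks_diag (A B C D : Matrix m m ℂ) :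
    (Matrix.fromBlocks A B C D).trace = A.trace + D.trace := by
  simp [Matrix.trace, Fintype.sum_sum_type]

theorem fromBlocks_sub_fromBlocks (A B C D A' B' C' D' : Matrix m m ℂ) :
    Matrix.fromBlocks A B C D - Matrix.fromBlocks A' B' C' D' =
      Matrix.fromBlocks (A - A') (B - B') (C - C') (D - D') := by
  rw [sub_eq_add_neg, Matrix.fromBlocks_neg, Matrix.fromBlocks_add]
  simp only [sub_eq_add_neg]

theorem reTrace_toBlocks₁₁ (A : Matrix m m ℂ) (X : Matrix (m ⊕ m) (m ⊕ m) ℂ) :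
    reTrace A X.toBlocks₁₁ = reTrace (Matrix.fromBlocks A 0 0 0) X := by
  rw [reTrace, reTrace]
  conv_rhs => rw [← Matrix.fromBlocks_toBlocks X, Matrix.fromBlocks_multiply,
    trace_fromBlocks_diag]
  simp

theorem reTrace_toBlocks₂₂ (A : Matrix m m ℂ) (X : Matrix (m ⊕ m) (m ⊕ m) ℂ) :
    reTrace A X.toBlocks₂₂ = reTrace (Matrix.fromBlocks 0 0 0 A) X := by
  rw [reTrace, reTrace]
  conv_rhs => rw [← Matrix.fromBlocks_toBlocks X, Matrix.fromBlocks_multiply,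
    trace_fromBlocks_diag]
  simp

variable {n : ℕ} {u v x : ℝ} {K : SL2n n}

instance finiteDimensional_constraintSpace : FiniteDimensional ℝ (ConstraintSpace n) := by
  have h1 : FiniteDimensional ℝ (hermitianSubmodule (Fin n)) := inferInstance
  have h2 : FiniteDimensional ℝ (hermitianSubmodule (Fin n) ⊓ tracelessSubmodule (Fin n) :
    Submodule ℝ (Matrix (Fin n) (Fin n) ℂ)) := inferInstance
  have h3 := @Module.Finite.prod ℝ _ _ _ _ _ _ _ h1 h2
  exact @Module.Finite.prod ℝ _ _ _ _ _ _ _ h1 (@Module.Finite.prod ℝ _ _ _ _ _ _ _ h2 h3)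

/-- The linear map underlying `constraintParts`. -/
noncomputable def constraintPartsLin [NeZero n] (S : Matrix (Fin n) (Fin n) ℂ) :
    (Matrix (Idx n) (Idx n) ℂ × Matrix (Idx n) (Idx n) ℂ × Matrix (Idx n) (Idx n) ℂ ×
      Matrix (Idx n) (Idx n) ℂ) →ₗ[ℝ] ConstraintSpace n where
  toFun := constraintParts S
  map_add' X Y := by
    refine Prod.ext (map_add hermPart _ _) (Prod.ext ?_ (Prod.ext (map_add hermPart _ _)
      (map_add hermTracelessPart _ _)))
    change hermTracelessPart (Sᴴ * (X.2.1.toBlocks₁₁ + Y.2.1.toBlocks₁₁) * S) =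
      hermTracelessPart _ + hermTracelessPart _
    rw [Matrix.mul_add, Matrix.add_mul, map_add]
  map_smul' c X := by
    refine Prod.ext (map_smul hermPart _ _) (Prod.ext ?_ (Prod.ext (map_smul hermPart _ _)
      (map_smul hermTracelessPart _ _)))
    change hermTracelessPart (Sᴴ * (c • X.2.1.toBlocks₁₁) * S) = c • hermTracelessPart _
    rw [Matrix.mul_smul, Matrix.smul_mul, map_smul]

/-- The sum of a matrix and its conjugate transpose. -/
def addStar : Matrix m m ℂ →ₗ[ℝ] Matrix m m ℂ where
  toFun Y := Y + Yᴴ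
  map_add' X Y := by rw [Matrix.conjTranspose_add]; abel
  map_smul' c X := by
    rw [Matrix.conjTranspose_smul, star_trivial, RingHom.id_apply, smul_add]

/-- The derivatives of `K K†`, `K⁻¹† K⁻¹`, `K† K` and `K⁻¹ K⁻¹†` in the direction `κ K`. -/
noncomputable def gramTangent (K : SL2n n) : Matrix (Idx n) (Idx n) ℂ →ₗ[ℝ]
    (Matrix (Idx n) (Idx n) ℂ × Matrix (Idx n) (Idx n) ℂ × Matrix (Idx n) (Idx n) ℂ ×
      Matrix (Idx n) (Idx n) ℂ) :=
  (addStar ∘ₗ LinearMap.mulRight ℝ (K.1 * K.1ᴴ)).prod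
    ((addStar ∘ₗ LinearMap.mulLeft ℝ (-((K⁻¹).1ᴴ * (K⁻¹).1))).prod
      ((addStar ∘ₗ LinearMap.mulLeft ℝ K.1ᴴ ∘ₗ LinearMap.mulRight ℝ K.1).prod
        (addStar ∘ₗ LinearMap.mulLeft ℝ (-(K⁻¹).1) ∘ₗ LinearMap.mulRight ℝ (K⁻¹).1ᴴ)))

theorem gramTangent_apply (K : SL2n n) (κ : Matrix (Idx n) (Idx n) ℂ) :
    gramTangent K κ = (κ * (K.1 * K.1ᴴ) + (κ * (K.1 * K.1ᴴ))ᴴ,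
      -((K⁻¹).1ᴴ * (K⁻¹).1) * κ + (-((K⁻¹).1ᴴ * (K⁻¹).1) * κ)ᴴ,
      K.1ᴴ * (κ * K.1) + (K.1ᴴ * (κ * K.1))ᴴ,
      -(K⁻¹).1 * (κ * (K⁻¹).1ᴴ) + (-(K⁻¹).1 * (κ * (K⁻¹).1ᴴ))ᴴ) := rfl

/-- The trace form on the space of constraints. -/
noncomputable def constraintForm (n : ℕ) :
    ConstraintSpace n →ₗ[ℝ] ConstraintSpace n →ₗ[ℝ] ℝ :=
  LinearMap.mk₂ ℝ (fun w X => reTrace w.1.1 X.1.1 + reTrace w.2.1.1 X.2.1.1 +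
    reTrace w.2.2.1.1 X.2.2.1.1 + reTrace w.2.2.2.1 X.2.2.2.1)
    (fun a b c => by
      change reTrace (a.1.1 + b.1.1) _ + reTrace (a.2.1.1 + b.2.1.1) _ +
        reTrace (a.2.2.1.1 + b.2.2.1.1) _ + reTrace (a.2.2.2.1 + b.2.2.2.1) _ = _
      simp only [add_reTrace]; ring)
    (fun r a c => by
      change reTrace (r • a.1.1) _ + reTrace (r • a.2.1.1) _ +
        reTrace (r • a.2.2.1.1) _ + reTrace (r • a.2.2.2.1) _ = _
      simp only [smul_reTrace, smul_eq_mul]; ring)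
    (fun a b c => by
      change reTrace _ (b.1.1 + c.1.1) + reTrace _ (b.2.1.1 + c.2.1.1) +
        reTrace _ (b.2.2.1.1 + c.2.2.1.1) + reTrace _ (b.2.2.2.1 + c.2.2.2.1) = _
      simp only [reTrace_add]; ring)
    (fun r a c => by
      change reTrace _ (r • c.1.1) + reTrace _ (r • c.2.1.1) +
        reTrace _ (r • c.2.2.1.1) + reTrace _ (r • c.2.2.2.1) = _
      simp only [reTrace_smul, smul_eq_mul]; ring)

theorem constraintForm_apply (w X : ConstraintSpace n) : constraintForm n w X =
    reTrace w.1.1 X.1.1 + reTrace w.2.1.1 X.2.1.1 +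
    reTrace w.2.2.1.1 X.2.2.1.1 + reTrace w.2.2.2.1 X.2.2.2.1 := rfl

theorem constraintForm_definite (w : ConstraintSpace n) (h : constraintForm n w w = 0) : w = 0 := by
  rw [constraintForm_apply] at h
  obtain ⟨a1, a2⟩ := reTrace_self_nonneg (show w.1.1ᴴ = w.1.1 from w.1.2)
  obtain ⟨b1, b2⟩ := reTrace_self_nonneg (show w.2.1.1ᴴ = w.2.1.1 from w.2.1.2.1)
  obtain ⟨c1, c2⟩ := reTrace_self_nonneg (show w.2.2.1.1ᴴ = w.2.2.1.1 from w.2.2.1.2)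
  obtain ⟨d1, d2⟩ := reTrace_self_nonneg (show w.2.2.2.1ᴴ = w.2.2.2.1 from w.2.2.2.2.1)
  exact Prod.ext (Subtype.ext (a2 (by linarith))) (Prod.ext (Subtype.ext (b2 (by linarith)))
    (Prod.ext (Subtype.ext (c2 (by linarith))) (Subtype.ext (d2 (by linarith)))))

/-- The covector on `κ` defined by multipliers `α, β, γ, δ` of the constraints. -/
def multiplierMatrix (S : Matrix (Fin n) (Fin n) ℂ) (K : SL2n n)
    (α β γ δ : Matrix (Fin n) (Fin n) ℂ) : Matrix (Idx n) (Idx n) ℂ :=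
  K.1 * K.1ᴴ * Matrix.fromBlocks 0 0 0 α -
    Matrix.fromBlocks (S * β * Sᴴ) 0 0 0 * ((K⁻¹).1ᴴ * (K⁻¹).1) +
    (K.1 * Matrix.fromBlocks γ 0 0 0 * K.1ᴴ -
      (K⁻¹).1ᴴ * Matrix.fromBlocks 0 0 0 δ * (K⁻¹).1)

/-- Cyclicity of the trace isolates `κ`; the factor `2` comes from the Hermitian multipliers pairing
equally with a matrix and its adjoint. -/
theorem constraintForm_gramTangent [NeZero n] (S : Matrix (Fin n) (Fin n) ℂ) (K : SL2n n)
    (w : ConstraintSpace n) (κ : Matrix (Idx n) (Idx n) ℂ) :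
    constraintForm n w (constraintPartsLin S (gramTangent K κ)) =
      2 * reTrace (multiplierMatrix S K w.1.1 w.2.1.1 w.2.2.1.1 w.2.2.2.1) κ := by
  obtain ⟨⟨α, hα⟩, ⟨β, hβ, hβ'⟩, ⟨γ, hγ⟩, ⟨δ, hδ, hδ'⟩⟩ := w
  change αᴴ = α at hα
  change βᴴ = β at hβ
  change γᴴ = γ at hγ
  change δᴴ = δ at hδ
  change β.trace = 0 at hβ'
  change δ.trace = 0 at hδ'
  have e : constraintForm n (⟨α, hα⟩, ⟨β, hβ, hβ'⟩, ⟨γ, hγ⟩, ⟨δ, hδ, hδ'⟩)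
      (constraintPartsLin S (gramTangent K κ)) =
      reTrace α (gramTangent K κ).1.toBlocks₂₂ +
      reTrace β (Sᴴ * (gramTangent K κ).2.1.toBlocks₁₁ * S) +
      reTrace γ (gramTangent K κ).2.2.1.toBlocks₁₁ +
      reTrace δ (gramTangent K κ).2.2.2.toBlocks₂₂ := by
    rw [← reTrace_hermPart hα, ← reTrace_hermPart hγ, ← reTrace_hermTracelessPart hβ hβ',
      ← reTrace_hermTracelessPart hδ hδ']
    rfl
  have h1 : (Matrix.fromBlocks 0 0 0 α : Matrix (Idx n) (Idx n) ℂ)ᴴ =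
      Matrix.fromBlocks 0 0 0 α := by simp [Matrix.fromBlocks_conjTranspose, hα]
  have h2 : (Matrix.fromBlocks (S * β * Sᴴ) 0 0 0 : Matrix (Idx n) (Idx n) ℂ)ᴴ =
      Matrix.fromBlocks (S * β * Sᴴ) 0 0 0 := by
    simp [Matrix.fromBlocks_conjTranspose, hβ, Matrix.mul_assoc]
  have h3 : (Matrix.fromBlocks γ 0 0 0 : Matrix (Idx n) (Idx n) ℂ)ᴴ =
      Matrix.fromBlocks γ 0 0 0 := by simp [Matrix.fromBlocks_conjTranspose, hγ]
  have h4 : (Matrix.fromBlocks 0 0 0 δ : Matrix (Idx n) (Idx n) ℂ)ᴴ =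
      Matrix.fromBlocks 0 0 0 δ := by simp [Matrix.fromBlocks_conjTranspose, hδ]
  rw [e, reTrace_mul_mul, reTrace_toBlocks₁₁, reTrace_toBlocks₁₁, reTrace_toBlocks₂₂,
    reTrace_toBlocks₂₂, gramTangent_apply]
  simp only
  rw [reTrace_add_conjTranspose h1, reTrace_add_conjTranspose h2, reTrace_add_conjTranspose h3,
    reTrace_add_conjTranspose h4]
  have c1 : reTrace (Matrix.fromBlocks 0 0 0 α) (κ * (K.1 * K.1ᴴ)) =
      reTrace (K.1 * K.1ᴴ * Matrix.fromBlocks 0 0 0 α) κ := by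
    have := reTrace_mul_mul (Matrix.fromBlocks 0 0 0 α) 1 κ (K.1 * K.1ᴴ)
    rwa [Matrix.one_mul, Matrix.mul_one] at this
  have c2 : reTrace (Matrix.fromBlocks (S * β * Sᴴ) 0 0 0) (-((K⁻¹).1ᴴ * (K⁻¹).1) * κ) =
      -reTrace (Matrix.fromBlocks (S * β * Sᴴ) 0 0 0 * ((K⁻¹).1ᴴ * (K⁻¹).1)) κ := by
    have := reTrace_mul_mul (Matrix.fromBlocks (S * β * Sᴴ) 0 0 0) (-((K⁻¹).1ᴴ * (K⁻¹).1)) κ 1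
    rw [Matrix.one_mul, Matrix.mul_one] at this
    rw [this, Matrix.mul_neg, reTrace, Matrix.neg_mul, Matrix.trace_neg, Complex.neg_re]; rfl
  have c3 : reTrace (Matrix.fromBlocks γ 0 0 0) (K.1ᴴ * (κ * K.1)) =
      reTrace (K.1 * Matrix.fromBlocks γ 0 0 0 * K.1ᴴ) κ := by
    rw [← Matrix.mul_assoc, reTrace_mul_mul]
  have c4 : reTrace (Matrix.fromBlocks 0 0 0 δ) (-(K⁻¹).1 * (κ * (K⁻¹).1ᴴ)) =
      -reTrace ((K⁻¹).1ᴴ * Matrix.fromBlocks 0 0 0 δ * (K⁻¹).1) κ := by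
    rw [← Matrix.mul_assoc, reTrace_mul_mul, Matrix.mul_neg, reTrace, Matrix.neg_mul,
      Matrix.trace_neg, Complex.neg_re]; rfl
  have hs : ∀ A B : Matrix (Idx n) (Idx n) ℂ, reTrace (A - B) κ = reTrace A κ - reTrace B κ := by
    intro A B
    rw [reTrace, Matrix.sub_mul, Matrix.trace_sub, Complex.sub_re]; rfl
  rw [c1, c2, c3, c4, multiplierMatrix, add_reTrace, hs, hs]
  ring

theorem left11_mul_gram (hK : K ∈ levelSet (mu n u v x)) :
    ((K⁻¹).1ᴴ * (K⁻¹).1).toBlocks₁₁ * (nu n x * (nu n x)ᴴ) = (Real.exp (-2 * u) : ℂ) • 1 := by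
  obtain ⟨-, h, -, -⟩ := (mem_levelSet_mu_iff K).1 hK
  have hν : IsUnit (nu n x)ᴴ := by
    rw [Matrix.isUnit_iff_isUnit_det, Matrix.det_conjTranspose, det_nu]
    simp
  apply hν.mul_left_cancel
  calc (nu n x)ᴴ * (((K⁻¹).1ᴴ * (K⁻¹).1).toBlocks₁₁ * (nu n x * (nu n x)ᴴ))
      = ((nu n x)ᴴ * ((K⁻¹).1ᴴ * (K⁻¹).1).toBlocks₁₁ * nu n x) * (nu n x)ᴴ := by
        simp only [Matrix.mul_assoc]
    _ = _ := by rw [h, Matrix.smul_mul, Matrix.one_mul, Matrix.mul_smul, Matrix.mul_one]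

/-- Multipliers with a scalar covector vanish. -/
theorem eq_zero_of_multiplierMatrix_eq_smul_one [NeZero n] (huv : u < v) (hvu : v ≠ -u)
    (hx : x ≠ 0) (hK : K ∈ levelSet (mu n u v x)) {α β γ δ : Matrix (Fin n) (Fin n) ℂ}
    (hα : αᴴ = α) (hβ : βᴴ = β) (hγ : γᴴ = γ) (hδ : δᴴ = δ) (hβ' : β.trace = 0)
    (hδ' : δ.trace = 0) {s : ℂ} (h : multiplierMatrix (nu n x) K α β γ δ = s • 1) :
    α = 0 ∧ β = 0 ∧ γ = 0 ∧ δ = 0 := by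
  obtain ⟨l1, l2, l3, l4⟩ := (mem_levelSet_mu_iff K).1 hK
  have hKi := coe_mul_coe_inv K
  have hKi' := coe_inv_mul_coe K
  set k := K.1 with hk
  set ki := (K⁻¹).1 with hki
  set S := nu n x with hS
  set a : ℂ := (Real.exp (-2 * u) : ℂ) with ha
  set c : ℂ := (Real.exp (-2 * v) : ℂ) with hc
  have ha0 : a ≠ 0 := by rw [ha]; exact_mod_cast (Real.exp_pos _).ne'
  have hc0 : c ≠ 0 := by rw [hc]; exact_mod_cast (Real.exp_pos _).ne'
  have hn0 : (n : ℂ) ≠ 0 := by exact_mod_cast NeZero.ne n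
  set H := k * Matrix.fromBlocks γ 0 0 0 * kᴴ - kiᴴ * Matrix.fromBlocks 0 0 0 δ * ki with hH
  set A := k * kᴴ * Matrix.fromBlocks 0 0 0 α -
    Matrix.fromBlocks (S * β * Sᴴ) 0 0 0 * (kiᴴ * ki) with hA
  have hAH : A + H = s • 1 := h
  have hHH : Hᴴ = H := by
    rw [hH]
    simp [Matrix.conjTranspose_mul, Matrix.fromBlocks_conjTranspose, hγ, hδ, Matrix.mul_assoc]
  -- the blocks of `A`
  have hAb : A = Matrix.fromBlocks (-(S * β * Sᴴ * (kiᴴ * ki).toBlocks₁₁))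
      ((k * kᴴ).toBlocks₁₂ * α - S * β * Sᴴ * (kiᴴ * ki).toBlocks₁₂) 0 (a • α) := by
    rw [hA]
    conv_lhs => rw [← Matrix.fromBlocks_toBlocks (k * kᴴ), ← Matrix.fromBlocks_toBlocks (kiᴴ * ki)]
    rw [Matrix.fromBlocks_multiply, Matrix.fromBlocks_multiply, fromBlocks_sub_fromBlocks, l1]
    simp
  set A₁ := -(S * β * Sᴴ * (kiᴴ * ki).toBlocks₁₁) with hA₁
  have hHA : H = s • 1 - A := eq_sub_of_add_eq' hAH
  have hsb : (s • 1 : Matrix (Idx n) (Idx n) ℂ) = Matrix.fromBlocks (s • 1) 0 0 (s • 1) := by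
    rw [← Matrix.fromBlocks_one, Matrix.fromBlocks_smul, smul_zero]
  -- `H = s • 1 - A` is Hermitian with vanishing lower left block, so the upper right block vanishes
  -- as well and `A` is block diagonal.
  have hA12 : (k * kᴴ).toBlocks₁₂ * α - S * β * Sᴴ * (kiᴴ * ki).toBlocks₁₂ = 0 := by
    have e := hHH
    rw [hHA, hAb, hsb, fromBlocks_sub_fromBlocks, Matrix.fromBlocks_conjTranspose,
      Matrix.fromBlocks_inj] at e
    have := e.2.1
    rw [sub_zero, Matrix.conjTranspose_zero, zero_sub, eq_comm, neg_eq_zero] at this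
    exact this
  rw [hA12] at hAb
  have hs : star s = s := by
    have e := hHH
    rw [hHA, hAb, hsb, fromBlocks_sub_fromBlocks, Matrix.fromBlocks_conjTranspose,
      Matrix.fromBlocks_inj] at e
    have e := e.2.2.2
    have haα : (a • α)ᴴ = a • α := by
      rw [Matrix.conjTranspose_smul, hα, ha, Complex.star_def, Complex.conj_ofReal]
    rw [Matrix.conjTranspose_sub, haα, sub_left_inj, Matrix.conjTranspose_smul,
      Matrix.conjTranspose_one] at e
    have := congrFun (congrFun e 0) 0
    simpa using this
  have hs1 : (s • 1 : Matrix (Idx n) (Idx n) ℂ)ᴴ = s • 1 := by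
    rw [Matrix.conjTranspose_smul, Matrix.conjTranspose_one, hs]
  have hAs : A = s • 1 - H := eq_sub_of_add_eq hAH
  have hAA : Aᴴ = A := by rw [hAs, Matrix.conjTranspose_sub, hs1, hHH]
  have hAA' := hAA
  rw [hAb, Matrix.fromBlocks_conjTranspose, Matrix.fromBlocks_inj] at hAA'
  have hA₁S : A₁ * S = -(a • (S * β)) := by
    calc A₁ * S = -(S * β * (Sᴴ * (kiᴴ * ki).toBlocks₁₁ * S)) := by
          rw [hA₁, Matrix.neg_mul]; simp only [Matrix.mul_assoc]
      _ = _ := by rw [l2, Matrix.mul_smul, Matrix.mul_one]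
  -- The product `A₁ S Sᴴ = -a S β Sᴴ` of Hermitian matrices is Hermitian, so its factors commute.
  have hcomm : A₁ * (S * Sᴴ) = S * Sᴴ * A₁ := by
    have e1 : A₁ * (S * Sᴴ) = -(a • (S * β * Sᴴ)) := by
      rw [← Matrix.mul_assoc, hA₁S, Matrix.neg_mul, Matrix.smul_mul]
    have e2 : (A₁ * (S * Sᴴ))ᴴ = A₁ * (S * Sᴴ) := by
      rw [e1, Matrix.conjTranspose_neg, Matrix.conjTranspose_smul, ha, Complex.star_def,
        Complex.conj_ofReal]
      simp only [Matrix.conjTranspose_mul, Matrix.conjTranspose_conjTranspose, hβ, Matrix.mul_assoc]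
    rw [← e2, Matrix.conjTranspose_mul, Matrix.conjTranspose_mul, hAA'.1,
      Matrix.conjTranspose_conjTranspose]
  -- the conjugate of `A`
  set C := s • 1 - Matrix.fromBlocks γ 0 0 0 * (kᴴ * k) +
    ki * kiᴴ * Matrix.fromBlocks 0 0 0 δ with hC
  have hkk : kᴴ * kiᴴ = 1 := by
    rw [← Matrix.conjTranspose_mul, hKi', Matrix.conjTranspose_one]
  have hkk' : kiᴴ * kᴴ = 1 := by
    rw [← Matrix.conjTranspose_mul, hKi, Matrix.conjTranspose_one]
  have hAK : A * k = k * C := by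
    calc A * k = s • k - k * Matrix.fromBlocks γ 0 0 0 * (kᴴ * k) +
          kiᴴ * Matrix.fromBlocks 0 0 0 δ * (ki * k) := by
          rw [hAs, hH]
          simp only [Matrix.sub_mul, Matrix.smul_mul, Matrix.one_mul, Matrix.mul_assoc]
          abel
      _ = s • k - k * Matrix.fromBlocks γ 0 0 0 * (kᴴ * k) +
          (k * ki) * kiᴴ * Matrix.fromBlocks 0 0 0 δ := by
          rw [hKi, hKi', Matrix.mul_one, Matrix.one_mul]
      _ = k * C := by
          rw [hC]
          simp only [Matrix.mul_add, Matrix.mul_sub, Matrix.mul_smul, Matrix.mul_one,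
            Matrix.mul_assoc]
  -- `C = K⁻¹ (A K Kᴴ) (K⁻¹)ᴴ`, and the definition of `A` shows that `A K Kᴴ` is Hermitian.
  have hCC : Cᴴ = C := by
    have e1 : A * (k * kᴴ) = k * kᴴ * Matrix.fromBlocks 0 0 0 α * (k * kᴴ) -
        Matrix.fromBlocks (S * β * Sᴴ) 0 0 0 := by
      rw [hA, Matrix.sub_mul]
      congr 1
      calc _ = Matrix.fromBlocks (S * β * Sᴴ) 0 0 0 * (kiᴴ * (ki * k) * kᴴ) := by
            simp only [Matrix.mul_assoc]
        _ = _ := by rw [hKi', Matrix.mul_one, hkk', Matrix.mul_one]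
    have e2 : (A * (k * kᴴ))ᴴ = A * (k * kᴴ) := by
      rw [e1]
      simp [Matrix.conjTranspose_mul, Matrix.fromBlocks_conjTranspose, hα, hβ, Matrix.mul_assoc]
    have e3 : C = ki * (A * (k * kᴴ)) * kiᴴ := by
      calc C = (ki * k) * C * (kᴴ * kiᴴ) := by rw [hKi', hkk, Matrix.one_mul, Matrix.mul_one]
        _ = ki * (k * C) * kᴴ * kiᴴ := by simp only [Matrix.mul_assoc]
        _ = _ := by rw [← hAK]; simp only [Matrix.mul_assoc]
    rw [e3, Matrix.conjTranspose_mul, Matrix.conjTranspose_mul, e2,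
      Matrix.conjTranspose_conjTranspose]
    simp only [Matrix.mul_assoc]
  have hCb : C = Matrix.fromBlocks (s • 1 - c • γ)
      (-(γ * (kᴴ * k).toBlocks₁₂) + (ki * kiᴴ).toBlocks₁₂ * δ) 0 (s • 1 + c • δ) := by
    rw [hC]
    conv_lhs => rw [← Matrix.fromBlocks_toBlocks (kᴴ * k), ← Matrix.fromBlocks_toBlocks (ki * kiᴴ)]
    rw [Matrix.fromBlocks_multiply, Matrix.fromBlocks_multiply, hsb, fromBlocks_sub_fromBlocks,
      Matrix.fromBlocks_add, l3, l4]
    simp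
  have hCC' := hCC
  rw [hCb, Matrix.fromBlocks_conjTranspose, Matrix.fromBlocks_inj] at hCC'
  rw [← hCC'.2.1, Matrix.conjTranspose_zero] at hCb
  rw [hAb, hCb] at hAK
  obtain ⟨θ, t1, t2⟩ := stabilizer_scalar_of_mem_levelSet huv hvu hx hK hAA'.1 hAA'.2.2.2 hCC'.1
    hCC'.2.2.2 hAK hcomm
  rw [← Matrix.fromBlocks_one, Matrix.fromBlocks_smul, Matrix.fromBlocks_inj] at t1 t2
  obtain ⟨t11, -, -, t14⟩ := t1
  obtain ⟨t21, -, -, t24⟩ := t2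
  have hSu : IsUnit S := by
    rw [Matrix.isUnit_iff_isUnit_det, hS, det_nu]; exact isUnit_one
  have hβθ : -(a • β) = (θ : ℂ) • 1 := by
    apply hSu.mul_left_cancel
    rw [Matrix.mul_neg, Matrix.mul_smul, ← hA₁S, t11, Matrix.smul_mul, Matrix.one_mul,
      Matrix.mul_smul, Matrix.mul_one]
  -- Here the removal of the redundant constraints pays off: `β` traceless gives `θ = 0`, and then
  -- `δ` traceless gives `s = 0`.
  have hθ : (θ : ℂ) = 0 := by
    have := congrArg Matrix.trace hβθ
    rw [Matrix.trace_neg, Matrix.trace_smul, hβ', smul_zero, neg_zero, Matrix.trace_smul,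
      Matrix.trace_one, Fintype.card_fin, smul_eq_mul, eq_comm, mul_eq_zero] at this
    exact this.resolve_right hn0
  rw [hθ, zero_smul] at hβθ t14 t21 t24
  have hs0 : s = 0 := by
    have := congrArg Matrix.trace t24
    rw [Matrix.trace_add, Matrix.trace_smul, Matrix.trace_smul, hδ', smul_zero, add_zero,
      Matrix.trace_one, Fintype.card_fin, smul_eq_mul, Matrix.trace_zero, mul_eq_zero] at this
    exact this.resolve_right hn0
  rw [hs0, zero_smul] at t21 t24
  refine ⟨(smul_eq_zero.1 t14).resolve_left ha0, ?_, ?_, ?_⟩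
  · exact (smul_eq_zero.1 (neg_eq_zero.1 hβθ)).resolve_left ha0
  · rw [zero_sub, neg_eq_zero] at t21
    exact (smul_eq_zero.1 t21).resolve_left hc0
  · rw [zero_add] at t24
    exact (smul_eq_zero.1 t24).resolve_left hc0

/-- The derivative of the constraints on the traceless matrices. -/
noncomputable def constraintTangent [NeZero n] (x : ℝ) (K : SL2n n) :
    tracelessSubmodule (Idx n) →ₗ[ℝ] ConstraintSpace n :=
  constraintPartsLin (nu n x) ∘ₗ gramTangent K ∘ₗ (tracelessSubmodule (Idx n)).subtype

/-- A multiplier annihilating the image on all traceless directions has a scalar multiplier matrix,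
hence vanishes. -/
theorem constraintTangent_surjective [NeZero n] (huv : u < v) (hvu : v ≠ -u) (hx : x ≠ 0)
    (hK : K ∈ levelSet (mu n u v x)) : Function.Surjective (constraintTangent x K) := by
  refine surjective_of_definite_form (constraintForm n) constraintForm_definite _ fun w hw => ?_
  obtain ⟨s, hs⟩ := exists_eq_smul_one_of_reTrace fun κ hκ => by
    have := hw ⟨κ, hκ⟩
    have e := constraintForm_gramTangent (nu n x) K w κ
    rw [show constraintForm n w (constraintPartsLin (nu n x) (gramTangent K κ)) = 0 from this] at e
    linarith
  obtain ⟨h1, h2, h3, h4⟩ := eq_zero_of_multiplierMatrix_eq_smul_one huv hvu hx hK w.1.2 w.2.1.2.1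
    w.2.2.1.2 w.2.2.2.2.1 w.2.1.2.2 w.2.2.2.2.2 hs
  exact Prod.ext (Subtype.ext h1) (Prod.ext (Subtype.ext h2) (Prod.ext (Subtype.ext h3)
    (Subtype.ext h4)))

/-- The Lie algebra of the isotropy group. -/
abbrev IsotropyAlgebra (n : ℕ) (x : ℝ) : Type :=
  skewAlgebra (signMatrix (nu n x)) × skewAlgebra (signMatrix (1 : Matrix (Fin n) (Fin n) ℂ))

/-- The infinitesimal action of the isotropy group, in the form `δK K⁻¹`. -/
noncomputable def orbitTangent (x : ℝ) (K : SL2n n) :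
    IsotropyAlgebra n x →ₗ[ℝ] tracelessSubmodule (Idx n) :=
  (((skewAlgebra (signMatrix (nu n x))).subtype.coprod
    (-(LinearMap.mulLeft ℝ K.1 ∘ₗ LinearMap.mulRight ℝ (K⁻¹).1 ∘ₗ
      (skewAlgebra (signMatrix (1 : Matrix (Fin n) (Fin n) ℂ))).subtype))).codRestrict _ fun ξ => by
    change (ξ.1.1 + -(K.1 * (ξ.2.1 * (K⁻¹).1))).trace = 0
    rw [Matrix.trace_add, Matrix.trace_neg, ξ.1.2.2.1, Matrix.trace_mul_comm, Matrix.mul_assoc,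
      coe_inv_mul_coe, Matrix.mul_one, ξ.2.2.2.1, neg_zero, add_zero])

theorem coe_orbitTangent (K : SL2n n) (ξ : IsotropyAlgebra n x) :
    (orbitTangent x K ξ : Matrix (Idx n) (Idx n) ℂ) = ξ.1.1 + -(K.1 * (ξ.2.1 * (K⁻¹).1)) := rfl

/-- A kernel element satisfies `ξ K = K ζ`. Multiplied by `i`, the pair is Hermitian and block
diagonal, hence scalar by rigidity, and tracelessness makes it zero. -/
theorem orbitTangent_injective [NeZero n] (huv : u < v) (hvu : v ≠ -u) (hx : x ≠ 0)
    (hK : K ∈ levelSet (mu n u v x)) : Function.Injective (orbitTangent x K) := by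
  rw [← LinearMap.ker_eq_bot, LinearMap.ker_eq_bot']
  rintro ⟨⟨ξ, a1, a2, a3⟩, ⟨ζ, b1, b2, b3⟩⟩ h
  have h1 : ξ + -(K.1 * (ζ * (K⁻¹).1)) = 0 := congrArg Subtype.val h
  have h2 : ξ * K.1 = K.1 * ζ := by
    rw [add_neg_eq_zero] at h1
    rw [h1]
    simp only [Matrix.mul_assoc, coe_inv_mul_coe, Matrix.mul_one]
  obtain ⟨a31, a32, a33⟩ := commute_signMatrix_iff.1 a3
  obtain ⟨b31, b32, -⟩ := commute_signMatrix_iff.1 b3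
  have hb : ∀ {χ : Matrix (Idx n) (Idx n) ℂ}, χ.toBlocks₁₂ = 0 → χ.toBlocks₂₁ = 0 → χᴴ = -χ →
      Complex.I • χ = Matrix.fromBlocks (Complex.I • χ.toBlocks₁₁) 0 0
        (Complex.I • χ.toBlocks₂₂) ∧ (Complex.I • χ.toBlocks₁₁).IsHermitian ∧
        (Complex.I • χ.toBlocks₂₂).IsHermitian := by
    intro χ h12 h21 hχ
    have e : (Complex.I • χ).IsHermitian := by
      rw [Matrix.IsHermitian, Matrix.conjTranspose_smul, hχ]; simp
    refine ⟨?_, e.submatrix Sum.inl, e.submatrix Sum.inr⟩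
    conv_lhs => rw [← Matrix.fromBlocks_toBlocks χ, h12, h21, Matrix.fromBlocks_smul, smul_zero]
  obtain ⟨c1, c2, c3⟩ := hb a31 a32 a1
  obtain ⟨d1, d2, d3⟩ := hb b31 b32 b1
  obtain ⟨θ, t1, t2⟩ := stabilizer_scalar_of_mem_levelSet huv hvu hx hK c2 c3 d2 d3
    (by rw [← c1, ← d1, Matrix.smul_mul, h2, Matrix.mul_smul])
    (by rw [Matrix.smul_mul, a33, Matrix.mul_smul])
  rw [← c1] at t1
  rw [← d1] at t2
  have hθ : (θ : ℂ) = 0 := by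
    have := congrArg Matrix.trace t1
    rw [Matrix.trace_smul, a2, smul_zero, Matrix.trace_smul, Matrix.trace_one, smul_eq_mul,
      eq_comm, mul_eq_zero] at this
    exact this.resolve_right (by exact_mod_cast Fintype.card_ne_zero)
  rw [hθ, zero_smul] at t1 t2
  have e1 : ξ = 0 := (smul_eq_zero.1 t1).resolve_left Complex.I_ne_zero
  have e2 : ζ = 0 := (smul_eq_zero.1 t2).resolve_left Complex.I_ne_zero
  exact Prod.ext (Subtype.ext e1) (Subtype.ext e2)

/-- Along the orbit the four Gram matrices change by commutators with `ξ` or `ζ`. In the prescribed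
blocks these vanish: three blocks are scalar, and the fourth is a multiple of `(ν ν†)⁻¹`, with which
`ξ₁₁` commutes. -/
theorem constraintTangent_orbitTangent [NeZero n] (hK : K ∈ levelSet (mu n u v x))
    (χ : IsotropyAlgebra n x) : constraintTangent x K (orbitTangent x K χ) = 0 := by
  obtain ⟨⟨ξ, a1, a2, a3⟩, ⟨ζ, b1, b2, b3⟩⟩ := χ
  obtain ⟨l1, -, l3, l4⟩ := (mem_levelSet_mu_iff K).1 hK
  have l2 := left11_mul_gram hK
  obtain ⟨a31, a32, a33⟩ := commute_signMatrix_iff.1 a3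
  obtain ⟨b31, b32, -⟩ := commute_signMatrix_iff.1 b3
  have hKi := coe_mul_coe_inv K
  have hKi' := coe_inv_mul_coe K
  change constraintParts (nu n x) (gramTangent K (ξ + -(K.1 * (ζ * (K⁻¹).1)))) = 0
  rw [gramTangent_apply]
  set k := K.1 with hk
  set ki := (K⁻¹).1 with hki
  have hkk : kᴴ * kiᴴ = 1 := by
    rw [← Matrix.conjTranspose_mul, hKi', Matrix.conjTranspose_one]
  have hkk' : kiᴴ * kᴴ = 1 := by
    rw [← Matrix.conjTranspose_mul, hKi, Matrix.conjTranspose_one]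
  have r1 : ∀ X, k * (ki * X) = X := fun X => by rw [← Matrix.mul_assoc, hKi, Matrix.one_mul]
  have r2 : ∀ X, ki * (k * X) = X := fun X => by rw [← Matrix.mul_assoc, hKi', Matrix.one_mul]
  have r3 : ∀ X, kᴴ * (kiᴴ * X) = X := fun X => by rw [← Matrix.mul_assoc, hkk, Matrix.one_mul]
  have r4 : ∀ X, kiᴴ * (kᴴ * X) = X := fun X => by rw [← Matrix.mul_assoc, hkk', Matrix.one_mul]
  have e1 : (ξ + -(k * (ζ * ki))) * (k * kᴴ) + ((ξ + -(k * (ζ * ki))) * (k * kᴴ))ᴴ =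
      ξ * (k * kᴴ) - k * kᴴ * ξ := by
    simp only [Matrix.conjTranspose_mul, Matrix.conjTranspose_add, Matrix.conjTranspose_neg, a1, b1,
      Matrix.conjTranspose_conjTranspose, Matrix.add_mul, Matrix.neg_mul,
      Matrix.mul_neg, Matrix.mul_assoc, r2]
    abel
  have e2 : -(kiᴴ * ki) * (ξ + -(k * (ζ * ki))) + (-(kiᴴ * ki) * (ξ + -(k * (ζ * ki))))ᴴ =
      ξ * (kiᴴ * ki) - kiᴴ * ki * ξ := by
    simp only [Matrix.conjTranspose_mul, Matrix.conjTranspose_add, Matrix.conjTranspose_neg, a1, b1,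
      Matrix.conjTranspose_conjTranspose, Matrix.mul_add, Matrix.neg_mul,
      Matrix.mul_neg, Matrix.mul_assoc, r2]
    abel
  have e3 : kᴴ * ((ξ + -(k * (ζ * ki))) * k) + (kᴴ * ((ξ + -(k * (ζ * ki))) * k))ᴴ =
      ζ * (kᴴ * k) - kᴴ * k * ζ := by
    simp only [Matrix.conjTranspose_mul, Matrix.conjTranspose_add, Matrix.conjTranspose_neg, a1, b1,
      Matrix.conjTranspose_conjTranspose, Matrix.add_mul, Matrix.mul_add, Matrix.neg_mul,
      Matrix.mul_neg, Matrix.mul_assoc, hKi', Matrix.mul_one]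
    abel
  have e4 : -ki * ((ξ + -(k * (ζ * ki))) * kiᴴ) + (-ki * ((ξ + -(k * (ζ * ki))) * kiᴴ))ᴴ =
      ζ * (ki * kiᴴ) - ki * kiᴴ * ζ := by
    simp only [Matrix.conjTranspose_mul, Matrix.conjTranspose_add, Matrix.conjTranspose_neg, a1, b1,
      Matrix.conjTranspose_conjTranspose, Matrix.add_mul, Matrix.mul_add, Matrix.neg_mul,
      Matrix.mul_neg, Matrix.mul_assoc, r2]
    abel
  rw [e1, e2, e3, e4]
  have hb : ∀ {χ X : Matrix (Idx n) (Idx n) ℂ}, χ.toBlocks₁₂ = 0 → χ.toBlocks₂₁ = 0 →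
      (χ * X - X * χ).toBlocks₁₁ = χ.toBlocks₁₁ * X.toBlocks₁₁ - X.toBlocks₁₁ * χ.toBlocks₁₁ ∧
      (χ * X - X * χ).toBlocks₂₂ = χ.toBlocks₂₂ * X.toBlocks₂₂ - X.toBlocks₂₂ * χ.toBlocks₂₂ := by
    intro χ X h12 h21
    have p := toBlocks_mul χ X
    have q := toBlocks_mul X χ
    rw [h12, h21] at p q
    constructor
    · calc _ = (χ * X).toBlocks₁₁ - (X * χ).toBlocks₁₁ := rfl
        _ = _ := by rw [p.1, q.1]; simp
    · calc _ = (χ * X).toBlocks₂₂ - (X * χ).toBlocks₂₂ := rfl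
        _ = _ := by rw [p.2, q.2]; simp
  have f1 : (ξ * (k * kᴴ) - k * kᴴ * ξ).toBlocks₂₂ = 0 := by
    rw [(hb a31 a32).2, l1]; simp
  have f2 : (ξ * (kiᴴ * ki) - kiᴴ * ki * ξ).toBlocks₁₁ = 0 := by
    rw [(hb a31 a32).1]
    have hG : IsUnit (nu n x * (nu n x)ᴴ) := by
      rw [Matrix.isUnit_iff_isUnit_det, Matrix.det_mul, Matrix.det_conjTranspose, det_nu]; simp
    apply hG.mul_right_cancel
    rw [Matrix.zero_mul, Matrix.sub_mul, Matrix.mul_assoc, l2, Matrix.mul_assoc, a33,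
      ← Matrix.mul_assoc (kiᴴ * ki).toBlocks₁₁, l2]
    simp
  have f3 : (ζ * (kᴴ * k) - kᴴ * k * ζ).toBlocks₁₁ = 0 := by
    rw [(hb b31 b32).1, l3]; simp
  have f4 : (ζ * (ki * kiᴴ) - ki * kiᴴ * ζ).toBlocks₂₂ = 0 := by
    rw [(hb b31 b32).2, l4]; simp
  rw [constraintParts]
  simp only
  rw [f1, f2, f3, f4, Matrix.mul_zero, Matrix.zero_mul, map_zero, map_zero]
  rfl

end Tangent

/-! ### Exponential coordinates -/

section ExponentialCoordinates

open Filter Topology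
open scoped Matrix.Norms.Operator

variable {m : Type} [Fintype m] [DecidableEq m]

/-- Conjugate transposition as a real linear map. -/
def conjTransposeLin : Matrix m m ℂ →ₗ[ℝ] Matrix m m ℂ where
  toFun X := Xᴴ
  map_add' := Matrix.conjTranspose_add
  map_smul' c X := by rw [Matrix.conjTranspose_smul, star_trivial]; rfl

theorem contDiff_linearMap {E F : Type*} [NormedAddCommGroup E] [NormedSpace ℝ E]
    [FiniteDimensional ℝ E] [NormedAddCommGroup F] [NormedSpace ℝ F] (T : E →ₗ[ℝ] F) :
    ContDiff ℝ ∞ T :=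
  (LinearMap.toContinuousLinearMap T).contDiff

theorem hasFDerivAt_linearMap {E F : Type*} [NormedAddCommGroup E] [NormedSpace ℝ E]
    [FiniteDimensional ℝ E] [NormedAddCommGroup F] [NormedSpace ℝ F] (T : E →ₗ[ℝ] F) (a : E) :
    HasFDerivAt T (LinearMap.toContinuousLinearMap T) a :=
  (LinearMap.toContinuousLinearMap T).hasFDerivAt

/-- A product of two exponentials of linear maps around a constant matrix. -/
theorem contDiff_exp_mul_mul_exp {E : Type*} [NormedAddCommGroup E] [NormedSpace ℝ E]
    [FiniteDimensional ℝ E] (S T : E →ₗ[ℝ] Matrix m m ℂ) (U : Matrix m m ℂ) :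
    ContDiff ℝ ∞ fun y => NormedSpace.exp (S y) * U * NormedSpace.exp (T y) :=
  ((contDiff_matrix_exp.comp (contDiff_linearMap S)).mul contDiff_const).mul
    (contDiff_matrix_exp.comp (contDiff_linearMap T))

theorem hasFDerivAt_exp_linearMap {E : Type*} [NormedAddCommGroup E] [NormedSpace ℝ E]
    [FiniteDimensional ℝ E] (S : E →ₗ[ℝ] Matrix m m ℂ) :
    HasFDerivAt (fun y => NormedSpace.exp (S y)) (LinearMap.toContinuousLinearMap S) 0 := by
  have h0 : HasFDerivAt (NormedSpace.exp : Matrix m m ℂ → Matrix m m ℂ)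
    (ContinuousLinearMap.id ℝ (Matrix m m ℂ)) (S 0) := by
    rw [map_zero]; exact hasFDerivAt_matrix_exp_zero
  exact h0.comp 0 (hasFDerivAt_linearMap S 0)

theorem hasFDerivAt_exp_mul_mul_exp {E : Type*} [NormedAddCommGroup E] [NormedSpace ℝ E]
    [FiniteDimensional ℝ E] (S T : E →ₗ[ℝ] Matrix m m ℂ) (U : Matrix m m ℂ) :
    HasFDerivAt (fun y => NormedSpace.exp (S y) * U * NormedSpace.exp (T y))
      (LinearMap.toContinuousLinearMap
        (LinearMap.mulRight ℝ U ∘ₗ S + LinearMap.mulLeft ℝ U ∘ₗ T)) 0 := by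
  have h := ((hasFDerivAt_exp_linearMap S).mul_const' U).mul' (hasFDerivAt_exp_linearMap T)
  refine h.congr_fderiv ?_
  ext1 y
  change (NormedSpace.exp (S 0) * U) * T y + (S y * U) * NormedSpace.exp (T 0) =
    S y * U + U * T y
  rw [map_zero, map_zero, NormedSpace.exp_zero, Matrix.one_mul, Matrix.mul_one, add_comm]

variable {n : ℕ} {u v x : ℝ}

/-- `K K†`, `K⁻¹† K⁻¹`, `K† K` and `K⁻¹ K⁻¹†` along `K = exp(κ) K₀`. -/
noncomputable def gramCoords (K : SL2n n) (κ : Matrix (Idx n) (Idx n) ℂ) :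
    Matrix (Idx n) (Idx n) ℂ × Matrix (Idx n) (Idx n) ℂ × Matrix (Idx n) (Idx n) ℂ ×
      Matrix (Idx n) (Idx n) ℂ :=
  (NormedSpace.exp κ * (K.1 * K.1ᴴ) * NormedSpace.exp (conjTransposeLin κ),
    NormedSpace.exp (-conjTransposeLin κ) * ((K⁻¹).1ᴴ * (K⁻¹).1) * NormedSpace.exp (-κ),
    K.1ᴴ * (NormedSpace.exp (conjTransposeLin κ) * 1 * NormedSpace.exp κ * K.1),
    (K⁻¹).1 * (NormedSpace.exp (-κ) * 1 * NormedSpace.exp (-conjTransposeLin κ) * (K⁻¹).1ᴴ))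

theorem contDiff_gramCoords (K : SL2n n) : ContDiff ℝ ∞ (gramCoords K) := by
  have h1 := contDiff_exp_mul_mul_exp LinearMap.id conjTransposeLin (K.1 * K.1ᴴ)
  have h2 := contDiff_exp_mul_mul_exp (-conjTransposeLin) (-LinearMap.id) ((K⁻¹).1ᴴ * (K⁻¹).1)
  have h3 := contDiff_exp_mul_mul_exp conjTransposeLin LinearMap.id (1 : Matrix (Idx n) (Idx n) ℂ)
  have h4 := contDiff_exp_mul_mul_exp (-LinearMap.id) (-conjTransposeLin)
    (1 : Matrix (Idx n) (Idx n) ℂ)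
  have h3' := (contDiff_linearMap (LinearMap.mulLeft ℝ K.1ᴴ ∘ₗ LinearMap.mulRight ℝ K.1)).comp h3
  have h4' := (contDiff_linearMap (LinearMap.mulLeft ℝ (K⁻¹).1 ∘ₗ
    LinearMap.mulRight ℝ (K⁻¹).1ᴴ)).comp h4
  exact h1.prodMk (h2.prodMk (h3'.prodMk h4'))

theorem hasFDerivAt_gramCoords (K : SL2n n) :
    HasFDerivAt (gramCoords K) (LinearMap.toContinuousLinearMap (gramTangent K)) 0 := by
  have h1 := hasFDerivAt_exp_mul_mul_exp (LinearMap.id) conjTransposeLin (K.1 * K.1ᴴ)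
  have h2 := hasFDerivAt_exp_mul_mul_exp (-conjTransposeLin) (-LinearMap.id)
    ((K⁻¹).1ᴴ * (K⁻¹).1)
  have h3 := hasFDerivAt_exp_mul_mul_exp conjTransposeLin (LinearMap.id) (1 : Matrix (Idx n) (Idx n) ℂ)
  have h4 := hasFDerivAt_exp_mul_mul_exp (-LinearMap.id) (-conjTransposeLin)
    (1 : Matrix (Idx n) (Idx n) ℂ)
  have h3' := (hasFDerivAt_linearMap (LinearMap.mulLeft ℝ K.1ᴴ ∘ₗ LinearMap.mulRight ℝ K.1)
    _).comp 0 h3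
  have h4' := (hasFDerivAt_linearMap (LinearMap.mulLeft ℝ (K⁻¹).1 ∘ₗ
    LinearMap.mulRight ℝ (K⁻¹).1ᴴ) _).comp 0 h4
  refine (h1.prodMk (h2.prodMk (h3'.prodMk h4'))).congr_fderiv ?_
  ext1 κ
  change (κ * (K.1 * K.1ᴴ) + K.1 * K.1ᴴ * κᴴ,
    -κᴴ * ((K⁻¹).1ᴴ * (K⁻¹).1) + (K⁻¹).1ᴴ * (K⁻¹).1 * -κ,
    K.1ᴴ * ((κᴴ * 1 + 1 * κ) * K.1),
    (K⁻¹).1 * ((-κ * 1 + 1 * -κᴴ) * (K⁻¹).1ᴴ)) = gramTangent K κ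
  rw [gramTangent_apply]
  simp only [Prod.mk.injEq]
  refine ⟨?_, ?_, ?_, ?_⟩
  · simp only [Matrix.conjTranspose_mul, Matrix.conjTranspose_conjTranspose]
  · simp only [Matrix.conjTranspose_mul, Matrix.conjTranspose_conjTranspose,
      Matrix.conjTranspose_neg, Matrix.mul_neg, Matrix.neg_mul]
    abel
  · simp only [Matrix.conjTranspose_mul, Matrix.conjTranspose_conjTranspose, Matrix.mul_one,
      Matrix.one_mul, Matrix.add_mul, Matrix.mul_add, Matrix.mul_assoc]
    abel
  · simp only [Matrix.conjTranspose_mul, Matrix.conjTranspose_conjTranspose, Matrix.mul_one,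
      Matrix.one_mul, Matrix.add_mul, Matrix.mul_add, Matrix.mul_assoc, Matrix.neg_mul,
      Matrix.mul_neg, Matrix.conjTranspose_neg]

theorem coe_expSL (κ : tracelessSubmodule (Idx n)) :
    (expSL κ.1 κ.2).1 = NormedSpace.exp κ.1 := rfl

theorem coe_expSL_inv (κ : tracelessSubmodule (Idx n)) :
    ((expSL κ.1 κ.2)⁻¹).1 = NormedSpace.exp (-κ.1) := by
  have h := coe_inv_mul_coe (expSL κ.1 κ.2)
  rw [coe_expSL] at h
  calc _ = ((expSL κ.1 κ.2)⁻¹).1 * (NormedSpace.exp κ.1 * NormedSpace.exp (-κ.1)) := by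
        rw [exp_mul_exp_neg, Matrix.mul_one]
    _ = _ := by rw [← Matrix.mul_assoc, h, Matrix.one_mul]

theorem constraintMap_expSL_mul [NeZero n] (S : Matrix (Fin n) (Fin n) ℂ) (K : SL2n n)
    (κ : tracelessSubmodule (Idx n)) :
    constraintMap S (expSL κ.1 κ.2 * K) = constraintPartsLin S (gramCoords K κ.1) := by
  change constraintParts S _ = constraintParts S _
  have e1 : (expSL κ.1 κ.2 * K).1 = NormedSpace.exp κ.1 * K.1 := rfl
  have e2 : ((expSL κ.1 κ.2 * K)⁻¹).1 = (K⁻¹).1 * NormedSpace.exp (-κ.1) := by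
    rw [_root_.mul_inv_rev, Matrix.SpecialLinearGroup.coe_mul, coe_expSL_inv]
  have e3 : NormedSpace.exp (conjTransposeLin κ.1) = (NormedSpace.exp κ.1)ᴴ :=
    Matrix.exp_conjTranspose κ.1
  have e4 : NormedSpace.exp (-conjTransposeLin κ.1) = (NormedSpace.exp (-κ.1))ᴴ := by
    rw [← map_neg]; exact Matrix.exp_conjTranspose (-κ.1)
  rw [e1, e2, gramCoords, e3, e4]
  simp only [Matrix.conjTranspose_mul, Matrix.mul_assoc, Matrix.one_mul]

/-- The constraints in exponential coordinates around `K`, normalized to vanish at the origin. -/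
noncomputable def levelFunction [NeZero n] (x : ℝ) (K : SL2n n) (κ : tracelessSubmodule (Idx n)) :
    ConstraintSpace n :=
  constraintPartsLin (nu n x) (gramCoords K κ.1) - constraintMap (nu n x) K

theorem levelFunction_eq_zero_iff [NeZero n] {K : SL2n n} (hK : K ∈ levelSet (mu n u v x))
    (κ : tracelessSubmodule (Idx n)) :
    expSL κ.1 κ.2 * K ∈ levelSet (mu n u v x) ↔ levelFunction x K κ = 0 := by
  rw [mem_levelSet_iff_constraintMap, constraintMap_expSL_mul,
    ← (mem_levelSet_iff_constraintMap K).1 hK, levelFunction, sub_eq_zero]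

theorem levelFunction_zero [NeZero n] (K : SL2n n) : levelFunction x K 0 = 0 := by
  have h := constraintMap_expSL_mul (nu n x) K 0
  have : expSL (0 : tracelessSubmodule (Idx n)).1 (0 : tracelessSubmodule (Idx n)).2 = 1 :=
    Subtype.ext NormedSpace.exp_zero
  rw [this, one_mul] at h
  rw [levelFunction, ← h, sub_self]

theorem contDiff_levelFunction [NeZero n] (K : SL2n n) : ContDiff ℝ ∞ (levelFunction x K) :=
  ((contDiff_linearMap (constraintPartsLin (nu n x))).comp ((contDiff_gramCoords K).comp
    (contDiff_linearMap (tracelessSubmodule (Idx n)).subtype))).sub contDiff_const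

theorem hasFDerivAt_levelFunction [NeZero n] (K : SL2n n) :
    HasFDerivAt (levelFunction x K) (LinearMap.toContinuousLinearMap (constraintTangent x K)) 0 := by
  have h1 := hasFDerivAt_linearMap (tracelessSubmodule (Idx n)).subtype 0
  have h2 := (hasFDerivAt_gramCoords K).comp (0 : tracelessSubmodule (Idx n)) h1
  have h3 := (hasFDerivAt_linearMap (constraintPartsLin (nu n x)) _).comp
    (0 : tracelessSubmodule (Idx n)) h2
  exact h3.sub_const _

end ExponentialCoordinates

/-! ### Adapted charts of `SL(2n, ℂ)` -/

section AdaptedCharts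

open Filter Topology
open scoped Matrix.Norms.Operator

variable {n : ℕ} [NeZero n] {u v x : ℝ}

instance finiteDimensional_isotropyAlgebra : FiniteDimensional ℝ (IsotropyAlgebra n x) :=
  @Module.Finite.prod ℝ _ _ _ _ _ _ _ inferInstance inferInstance

instance finiteDimensional_prod_normedSpace {E F : Type*} [NormedAddCommGroup E] [NormedSpace ℝ E]
    [FiniteDimensional ℝ E] [NormedAddCommGroup F] [NormedSpace ℝ F] [FiniteDimensional ℝ F] :
    FiniteDimensional ℝ (E × F) :=
  inferInstance

/-- Forgetting an entry, as a linear map. -/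
def dropEntryLin (n : ℕ) [NeZero n] : Matrix (Idx n) (Idx n) ℂ →ₗ[ℝ] SLModel n where
  toFun := dropEntry
  map_add' _ _ := rfl
  map_smul' _ _ := rfl

theorem trace_fillEntry (t : ℂ) (Y : SLModel n) :
    (fillEntry t Y).trace = t + (fillEntry 0 Y).trace := by
  have h : ∀ i : Idx n, fillEntry t Y i i = (if i = idx0 n then t else 0) + fillEntry 0 Y i i := by
    intro i
    by_cases hi : i = idx0 n
    · subst hi; simp [fillEntry_same]
    · have : (i, i) ≠ (idx0 n, idx0 n) := fun e => hi (Prod.mk.inj e).1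
      rw [fillEntry_of_ne _ _ this, fillEntry_of_ne _ _ this, if_neg hi, zero_add]
  simp only [Matrix.trace, Matrix.diag_apply]
  rw [Finset.sum_congr rfl fun i _ => h i, Finset.sum_add_distrib]
  simp

theorem fillEntry_zero : fillEntry (0 : ℂ) (0 : SLModel n) = 0 := by
  ext i j
  by_cases h : (i, j) = (idx0 n, idx0 n)
  · obtain ⟨rfl, rfl⟩ := Prod.mk.inj h
    rw [fillEntry_same]; rfl
  · rw [fillEntry_of_ne _ _ h]; rfl

/-- The derivative at `K` of the chart centred at `K`, on the directions `κ K`. -/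
noncomputable def chartTangent (K : SL2n n) : tracelessSubmodule (Idx n) →ₗ[ℝ] SLModel n :=
  dropEntryLin n ∘ₗ LinearMap.mulLeft ℝ (K⁻¹).1 ∘ₗ LinearMap.mulRight ℝ K.1 ∘ₗ
    (tracelessSubmodule (Idx n)).subtype

theorem chartTangent_apply (K : SL2n n) (κ : tracelessSubmodule (Idx n)) :
    chartTangent K κ = dropEntry ((K⁻¹).1 * (κ.1 * K.1)) := rfl

/-- Conjugation by `K` preserves the trace, and a traceless matrix is recovered from all its entries
but one diagonal one. -/
theorem chartTangent_bijective (K : SL2n n) : Function.Bijective (chartTangent K) := by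
  constructor
  · rw [← LinearMap.ker_eq_bot, LinearMap.ker_eq_bot']
    rintro ⟨κ, hκ⟩ h
    change κ.trace = 0 at hκ
    rw [chartTangent_apply] at h
    have ht : ((K⁻¹).1 * (κ * K.1)).trace = 0 := by
      rw [Matrix.trace_mul_comm, Matrix.mul_assoc, coe_mul_coe_inv, Matrix.mul_one, hκ]
    set X := (K⁻¹).1 * (κ * K.1) with hX
    have e := fillEntry_dropEntry X
    rw [h] at e
    have h0 : X (idx0 n) (idx0 n) = 0 := by
      rw [← e, trace_fillEntry, fillEntry_zero, Matrix.trace_zero, add_zero] at ht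
      exact ht
    rw [h0, fillEntry_zero] at e
    have : κ = K.1 * X * (K⁻¹).1 := by
      rw [hX, ← Matrix.mul_assoc, coe_mul_coe_inv, Matrix.one_mul, Matrix.mul_assoc,
        coe_mul_coe_inv, Matrix.mul_one]
    apply Subtype.ext
    change κ = 0
    rw [this, ← e, Matrix.mul_zero, Matrix.zero_mul]
  · intro Y
    set X := fillEntry (-(fillEntry 0 Y).trace) Y with hX
    have ht : X.trace = 0 := by rw [hX, trace_fillEntry, neg_add_cancel]
    refine ⟨⟨K.1 * X * (K⁻¹).1, ?_⟩, ?_⟩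
    · change (K.1 * X * (K⁻¹).1).trace = 0
      rw [Matrix.trace_mul_comm, ← Matrix.mul_assoc, coe_inv_mul_coe, Matrix.one_mul, ht]
    · rw [chartTangent_apply]
      have : (K⁻¹).1 * (K.1 * X * (K⁻¹).1 * K.1) = X := by
        rw [Matrix.mul_assoc (K.1 * X), coe_inv_mul_coe, Matrix.mul_one, ← Matrix.mul_assoc,
          coe_inv_mul_coe, Matrix.one_mul]
      rw [this, hX, dropEntry_fillEntry]

/-- The point `exp(ξ) exp(κ) K exp(ζ)†` in the chart centred at `K`. -/
noncomputable def orbitCoords (x : ℝ) (K : SL2n n) {A : Type*} [AddCommGroup A] [Module ℝ A]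
    (κ : A →ₗ[ℝ] tracelessSubmodule (Idx n)) (y : A × IsotropyAlgebra n x) : SLModel n :=
  dropEntry ((K⁻¹).1 * (NormedSpace.exp y.2.1.1 * (NormedSpace.exp (κ y.1).1 * K.1) *
    NormedSpace.exp (-y.2.2.1)))

theorem contDiff_orbitCoords (K : SL2n n) {A : Type*} [NormedAddCommGroup A] [NormedSpace ℝ A]
    [FiniteDimensional ℝ A] (κ : A →ₗ[ℝ] tracelessSubmodule (Idx n)) :
    ContDiff ℝ ∞ (orbitCoords x K κ) := by
  have h1 := contDiff_matrix_exp.comp (contDiff_linearMap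
    ((skewAlgebra (signMatrix (nu n x))).subtype ∘ₗ LinearMap.fst ℝ _ _ ∘ₗ
      LinearMap.snd ℝ A (IsotropyAlgebra n x)))
  have h2 := contDiff_matrix_exp.comp (contDiff_linearMap
    ((tracelessSubmodule (Idx n)).subtype ∘ₗ κ ∘ₗ LinearMap.fst ℝ A (IsotropyAlgebra n x)))
  have h3 := contDiff_matrix_exp.comp (contDiff_linearMap
    (-((skewAlgebra (signMatrix (1 : Matrix (Fin n) (Fin n) ℂ))).subtype ∘ₗ LinearMap.snd ℝ _ _ ∘ₗ
      LinearMap.snd ℝ A (IsotropyAlgebra n x))))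
  exact (contDiff_linearMap (dropEntryLin n ∘ₗ LinearMap.mulLeft ℝ (K⁻¹).1)).comp
    ((h1.mul (h2.mul contDiff_const)).mul h3)

theorem hasFDerivAt_orbitCoords (K : SL2n n) {A : Type*} [NormedAddCommGroup A] [NormedSpace ℝ A]
    [FiniteDimensional ℝ A] (κ : A →ₗ[ℝ] tracelessSubmodule (Idx n)) :
    HasFDerivAt (orbitCoords x K κ) (LinearMap.toContinuousLinearMap
      (chartTangent K ∘ₗ (κ.coprod (orbitTangent x K)))) 0 := by
  have h1 := hasFDerivAt_exp_linearMap
    ((skewAlgebra (signMatrix (nu n x))).subtype ∘ₗ LinearMap.fst ℝ _ _ ∘ₗ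
      LinearMap.snd ℝ A (IsotropyAlgebra n x))
  have h2 := hasFDerivAt_exp_linearMap
    ((tracelessSubmodule (Idx n)).subtype ∘ₗ κ ∘ₗ LinearMap.fst ℝ A (IsotropyAlgebra n x))
  have h3 := hasFDerivAt_exp_linearMap
    (-((skewAlgebra (signMatrix (1 : Matrix (Fin n) (Fin n) ℂ))).subtype ∘ₗ LinearMap.snd ℝ _ _ ∘ₗ
      LinearMap.snd ℝ A (IsotropyAlgebra n x)))
  have h4 := (h1.mul' (h2.mul_const' K.1)).mul' h3
  have h5 := (hasFDerivAt_linearMap (dropEntryLin n ∘ₗ LinearMap.mulLeft ℝ (K⁻¹).1) _).comp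
    (0 : A × IsotropyAlgebra n x) h4
  refine h5.congr_fderiv ?_
  refine ContinuousLinearMap.ext fun y => ?_
  have e0 : (κ (0 : A × IsotropyAlgebra n x).1).1 = 0 := by
    rw [show (0 : A × IsotropyAlgebra n x).1 = 0 from rfl, map_zero]; rfl
  have e1 : (-((0 : A × IsotropyAlgebra n x).2.2.1) : Matrix (Idx n) (Idx n) ℂ) = 0 := neg_zero
  change dropEntry ((K⁻¹).1 * (
    (NormedSpace.exp ((0 : A × IsotropyAlgebra n x).2.1.1) *
      (NormedSpace.exp (κ (0 : A × IsotropyAlgebra n x).1).1 * K.1)) * (-y.2.2.1) +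
    (NormedSpace.exp ((0 : A × IsotropyAlgebra n x).2.1.1) * ((κ y.1).1 * K.1) +
      y.2.1.1 * (NormedSpace.exp (κ (0 : A × IsotropyAlgebra n x).1).1 * K.1)) *
      NormedSpace.exp (-(0 : A × IsotropyAlgebra n x).2.2.1))) =
    dropEntry ((K⁻¹).1 * (((κ y.1).1 + (orbitTangent x K y.2).1) * K.1))
  rw [e0, e1, show ((0 : A × IsotropyAlgebra n x).2.1.1 : Matrix (Idx n) (Idx n) ℂ) = 0 from rfl,
    NormedSpace.exp_zero, coe_orbitTangent]
  congr 2
  simp only [Matrix.one_mul, Matrix.mul_one, Matrix.add_mul, Matrix.neg_mul, Matrix.mul_neg,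
    Matrix.mul_assoc, coe_inv_mul_coe]
  abel

theorem slChart_isotropyExp_smul (K : SL2n n) {A : Type*} [AddCommGroup A] [Module ℝ A]
    (κ : A →ₗ[ℝ] tracelessSubmodule (Idx n)) (y : A × IsotropyAlgebra n x) :
    slChart K ((isotropyExp y.2 : isotropy (mu n u v x)) • (expSL (κ y.1).1 (κ y.1).2 * K)) =
      orbitCoords x K κ y := by
  change dropEntry ((K⁻¹).1 * ((isotropyExp y.2 : isotropy (mu n u v x)) •
    (expSL (κ y.1).1 (κ y.1).2 * K)).1) = _
  -- The action involves the adjoint of the right factor, which is `exp (-ζ)` because `ζ` is skew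
  -- Hermitian.
  rw [isotropy_smul_def, isotropyPair_isotropyExp, orbitCoords, ← y.2.2.2.1,
    Matrix.exp_conjTranspose]
  rfl

theorem continuous_expSL_mul (K : SL2n n) {A : Type*} [NormedAddCommGroup A] [NormedSpace ℝ A]
    [FiniteDimensional ℝ A] (κ : A →ₗ[ℝ] tracelessSubmodule (Idx n)) :
    Continuous fun y => expSL (κ y).1 (κ y).2 * K := by
  have h : Continuous fun y => expSL (κ y).1 (κ y).2 := by
    refine continuous_induced_rng.2 ?_
    exact (contDiff_matrix_exp.comp (contDiff_linearMap
      ((tracelessSubmodule (Idx n)).subtype ∘ₗ κ))).continuous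
  exact h.mul continuous_const

/-- The dimension of the reduced space. -/
noncomputable def reducedDim (n : ℕ) (x : ℝ) : ℕ :=
  Module.finrank ℝ (tracelessSubmodule (Idx n)) - Module.finrank ℝ (ConstraintSpace n) -
    Module.finrank ℝ (IsotropyAlgebra n x)

/-- The traceless matrices, as tangent space at `K`, split into a complement `ι` of the orbit in the
kernel of the constraints, a section `ρ` of the constraints, and the orbit directions. The slice is
`exp (ι s + ρ c) K`, and moving it by `isotropyExp` has invertible derivative. -/
theorem exists_adapted_chart (huv : u < v) (hvu : v ≠ -u) (hx : x ≠ 0)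
    {K : SL2n n} (hK : K ∈ levelSet (mu n u v x)) :
    ∃ (ψ : OpenPartialHomeomorph (SL2n n) (SLModel n))
      (L : SLModel n ≃L[ℝ] (EuclideanSpace ℝ (Fin (reducedDim n x)) × ConstraintSpace n) ×
        IsotropyAlgebra n x),
      ψ ∈ IsManifold.maximalAtlas 𝓘(ℝ, SLModel n) ∞ (SL2n n) ∧ K ∈ ψ.source ∧ L (ψ K) = 0 ∧
      (∀ q ∈ ψ.source, q ∈ levelSet (mu n u v x) ↔ (L (ψ q)).1.2 = 0) ∧
      ∀ q ∈ ψ.source, ∀ q' ∈ ψ.source, q ∈ levelSet (mu n u v x) → q' ∈ levelSet (mu n u v x) →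
        ((∃ g : isotropy (mu n u v x), g • q = q') ↔ (L (ψ q)).1.1 = (L (ψ q')).1.1) := by
  obtain ⟨ι, ρ, Φ, hι, hρ, hΦ⟩ := exists_splitting (constraintTangent x K)
    (constraintTangent_surjective huv hvu hx hK) (orbitTangent x K)
    (orbitTangent_injective huv hvu hx hK) (constraintTangent_orbitTangent hK) (e := reducedDim n x) rfl
  set κ := ι.coprod ρ with hκ
  let f' := Φ.trans (LinearEquiv.ofBijective (chartTangent K) (chartTangent_bijective K))
  have hf' : HasFDerivAt (orbitCoords x K κ) (f'.toContinuousLinearEquiv :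
      (EuclideanSpace ℝ (Fin (reducedDim n x)) × ConstraintSpace n) × IsotropyAlgebra n x →L[ℝ]
        SLModel n) 0 := by
    refine (hasFDerivAt_orbitCoords K κ).congr_fderiv ?_
    refine ContinuousLinearMap.ext fun y => ?_
    change chartTangent K _ = chartTangent K (Φ y)
    rw [hΦ]; rfl
  have hF' : HasFDerivAt (fun y => levelFunction x K (κ y)) (ContinuousLinearMap.snd ℝ
      (EuclideanSpace ℝ (Fin (reducedDim n x))) (ConstraintSpace n)) 0 := by
    have h0 : HasFDerivAt (levelFunction x K)
        (LinearMap.toContinuousLinearMap (constraintTangent x K)) (κ 0) := by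
      rw [map_zero]; exact hasFDerivAt_levelFunction K
    refine (h0.comp 0 (hasFDerivAt_linearMap κ 0)).congr_fderiv ?_
    refine ContinuousLinearMap.ext fun y => ?_
    change constraintTangent x K (ι y.1 + ρ y.2) = y.2
    rw [map_add, hι, hρ, zero_add]
  refine exists_foliated_slice_chart (G := isotropy (mu n u v x)) (φ := slChart K)
    smul_mem_levelSet_iff
    (IsManifold.subset_maximalAtlas ⟨K, rfl⟩) (mem_chart_source (SLModel n) K)
    continuous_isotropyExp isotropyExp_zero nhds_one_le_map_isotropyExp
    (τ := fun y => expSL (κ y).1 (κ y).2 * K) (continuous_expSL_mul K κ) ?_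
    (contDiff_orbitCoords K κ) hf' (fun y _ => slChart_isotropyExp_smul K κ y)
    (F := fun y => levelFunction x K (κ y))
    ((contDiff_levelFunction K).comp (contDiff_linearMap κ)) hF' ?_
    (fun y => levelFunction_eq_zero_iff hK (κ y))
    (fun g hg q => smul_eq_of_smul_eq huv hvu hx hK g hg q)
  · have : expSL (κ 0).1 (κ 0).2 = 1 := Subtype.ext (by
      change NormedSpace.exp (κ 0).1 = 1
      rw [map_zero]; exact NormedSpace.exp_zero)
    rw [this, one_mul]
  · rw [map_zero]; exact levelFunction_zero K

theorem contDiffOn_mul_entry {E : Type*} [NormedAddCommGroup E] [NormedSpace ℝ E] {s : Set E}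
    {f g : E → Matrix (Idx n) (Idx n) ℂ} (hf : ∀ i j, ContDiffOn ℝ ∞ (fun y => f y i j) s)
    (hg : ∀ i j, ContDiffOn ℝ ∞ (fun y => g y i j) s) (i j : Idx n) :
    ContDiffOn ℝ ∞ (fun y => (f y * g y) i j) s := by
  simp only [Matrix.mul_apply]
  exact ContDiffOn.sum fun k _ => (hf i k).mul (hg k j)

/-- Multiplication on both sides is smooth. -/
theorem contMDiff_mul_mul (a b : SL2n n) :
    ContMDiff 𝓘(ℝ, SLModel n) 𝓘(ℝ, SLModel n) ∞ fun K : SL2n n => a * K * b := by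
  refine contMDiff_iff.2 ⟨(continuous_const.mul continuous_id).mul continuous_const, ?_⟩
  intro A A'
  have key : ContDiffOn ℝ ∞ (fun Y : SLModel n =>
      dropEntry (((A'⁻¹ * a * A : SL2n n).1 * fillEntry (solveEntry Y) Y) * b.1))
      {Y | cofactor0 (fillEntry 0 Y) ≠ 0} := by
    have h1 : ∀ i j, ContDiffOn ℝ ∞ (fun Y : SLModel n =>
        ((A'⁻¹ * a * A : SL2n n).1 * fillEntry (solveEntry Y) Y) i j)
        {Y | cofactor0 (fillEntry 0 Y) ≠ 0} :=
      contDiffOn_mul_entry (f := fun _ => (A'⁻¹ * a * A : SL2n n).1)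
        (g := fun Y => fillEntry (solveEntry Y) Y) (fun _ _ => contDiffOn_const)
        contDiffOn_fillEntry_solveEntry
    have h2 := contDiffOn_mul_entry (g := fun _ => b.1) h1 (fun _ _ => contDiffOn_const)
    exact contDiffOn_pi.2 fun p => h2 p.1.1 p.1.2
  simp only [mfld_simps]
  have hsub : ∀ Y ∈ (chartAt (SLModel n) A).target, cofactor0 (fillEntry 0 Y) ≠ 0 := by
    intro Y hY
    exact hY
  refine (key.mono fun Y hY => hsub Y hY.1).congr fun Y hY => ?_
  have hY' := hsub Y hY.1
  have : (chartAt (SLModel n) A' ∘ (fun K => a * K * b) ∘ (chartAt (SLModel n) A).symm) Y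
      = dropEntry ((A'⁻¹ * (a * (A⁻¹⁻¹ * slInv Y) * b) : SL2n n) : Matrix (Idx n) (Idx n) ℂ) := rfl
  rw [this, inv_inv, show A'⁻¹ * (a * (A * slInv Y) * b) = A'⁻¹ * a * A * slInv Y * b by group,
    Matrix.SpecialLinearGroup.coe_mul, Matrix.SpecialLinearGroup.coe_mul, coe_slInv hY']

end AdaptedCharts

section AdaptedModel

open scoped Matrix.Norms.Operator

/-- The model spaces of the adapted charts can be chosen independently of the point. -/
theorem exists_adapted_charts (n : ℕ) [NeZero n] {u v x : ℝ} (huv : u < v) (hvu : v ≠ -u)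
    (hx : x ≠ 0) :
    ∃ (A B C : Type) (_ : NormedAddCommGroup A) (_ : NormedSpace ℝ A) (_ : FiniteDimensional ℝ A)
      (_ : NormedAddCommGroup B) (_ : NormedSpace ℝ B) (_ : FiniteDimensional ℝ B)
      (_ : NormedAddCommGroup C) (_ : NormedSpace ℝ C),
      ∀ K ∈ levelSet (mu n u v x), ∃ (ψ : OpenPartialHomeomorph (SL2n n) (SLModel n))
        (L : SLModel n ≃L[ℝ] (A × C) × B),
        ψ ∈ IsManifold.maximalAtlas 𝓘(ℝ, SLModel n) ∞ (SL2n n) ∧ K ∈ ψ.source ∧ L (ψ K) = 0 ∧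
        (∀ q ∈ ψ.source, q ∈ levelSet (mu n u v x) ↔ (L (ψ q)).1.2 = 0) ∧
        ∀ q ∈ ψ.source, ∀ q' ∈ ψ.source, q ∈ levelSet (mu n u v x) → q' ∈ levelSet (mu n u v x) →
          ((∃ g : isotropy (mu n u v x), g • q = q') ↔ (L (ψ q)).1.1 = (L (ψ q')).1.1) :=
  ⟨EuclideanSpace ℝ (Fin (reducedDim n x)), IsotropyAlgebra n x, ConstraintSpace n,
    inferInstance, inferInstance, inferInstance, inferInstance, inferInstance, inferInstance,
    inferInstance, inferInstance, fun _ hK => exists_adapted_chart huv hvu hx hK⟩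

end AdaptedModel

/-! ### The reduced phase space -/

theorem theorem4p4 (n : ℕ) [n.AtLeastTwo] (u v x : ℝ)
    (huv : u < v) (hvu : v ≠ -u) (hx : x ≠ 0) :
    ∃ (d : ℕ) (_ : ChartedSpace (EuclideanSpace ℝ (Fin d)) (ConstraintSurface n u v x))
      (e : ℕ) (_ : ChartedSpace (EuclideanSpace ℝ (Fin e)) (ReducedSpace n u v x)),
      -- the constraint surface is an embedded submanifold of `SL(2n, ℂ)`
      IsManifold (𝓡 d) ∞ (ConstraintSurface n u v x) ∧
      IsSmoothEmbedding (𝓡 d) 𝓘(ℝ, SLModel n) ∞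
        (Subtype.val : ConstraintSurface n u v x → SL2n n) ∧
      -- the reduced space is a smooth manifold
      T2Space (ReducedSpace n u v x) ∧
      SecondCountableTopology (ReducedSpace n u v x) ∧
      IsManifold (𝓡 e) ∞ (ReducedSpace n u v x) ∧
      -- the projection is a smooth submersion
      IsSubmersion (𝓡 d) (𝓡 e) ∞ (reductionMap n u v x) := by
  obtain ⟨A, B, C, _, _, _, _, _, _, _, _, hcharts⟩ := exists_adapted_charts n huv hvu hx
  have hsm (g : isotropy (mu n u v x)) : ContMDiff 𝓘(ℝ, SLModel n) 𝓘(ℝ, SLModel n) ∞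
      fun q : SL2n n => g • q := contMDiff_mul_mul g.1.1.1 (g.1.2.1)⁻¹
  have : SecondCountableTopology (Matrix (Idx n) (Idx n) ℂ) :=
    inferInstanceAs (SecondCountableTopology (Idx n → Idx n → ℂ))
  have : SecondCountableTopology (SL2n n) :=
    TopologicalSpace.Subtype.secondCountableTopology {A : Matrix (Idx n) (Idx n) ℂ | A.det = 1}
  exact exists_reduced_manifold (A := A) (B := B) (C := C) (fun _ _ => rfl) hsm hcharts
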